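/- \textbf{Setting.} Two two-way roads cross at an intersection and left turns are not allowed. There are four lanes, two on each road; lanes of the same road are compatible and lanes of different roads conflict. An instance consists of $n$ platoons, each assigned to one lane and having a real release time $r_p$ and a length $\ell_p>0$, such that on each lane the time intervals $[r_p,r_p+\ell_p]$ are pairwise non-overlapping (common endpoints are allowed). The platoons of each lane are given in their order of arrival. A schedule assigns a crossing time $c_p\in\mathbb R$ to every platoon $p$. It is \emph{valid} if (i) $c_p\ge r_p$ for all $p$; (ii) if $p$ precedes $q$ on the same lane, then $c_q\ge c_p+\ell_p$; (iii) if $p$ and $q$ are on different roads, then the open intervals $(c_p,c_p+\ell_p)$ and $(c_q,c_q+\ell_q)$ are disjoint. The delay of a schedule is $\max_p(c_p-r_p)$ (and $0$ if $n=0$). Let $L=\max_p r_p+\sum_p\ell_p$ (and $L=0$ if $n=0$). Running times are counted on a real RAM: a program with random-access memory for natural numbers (indices) and for real numbers, which can add, subtract and compare numbers of either sort (subtraction of natural numbers being truncated at $0$), each operation taking one step, with natural-number constants and no conversion between the two sorts. \textbf{Theorem (two-way crossing).} (a) There are a program and a constant $C$ such that for every instance and every $d\in\mathbb R$ the program decides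 within $C(1+n^6)$ steps whether there is a valid schedule with delay at most $d$. (b) There are a program and a constant $C$ such that for every instance the program halts within $C(1+n^{12})$ steps and outputs a valid schedule whose delay is minimum among all valid schedules; moreover, if all release times are nonnegative integers and all lengths are positive integers, then the same program halts within $C\bigl(1+\min(n^{12},\,n^6\log L)\bigr)$ steps. That is, a minimum-delay schedule can be found in time $O(\min(n^{12},n^6\log L))$, where the bound involving $L$ refers to integer data. -/

import Mathlib

/-! ### The scheduling problem -/

namespace Platoon

/-- A platoon scheduling instance at a two-way crossing. There are four lanes (an incoming lane
paired with its outgoing lane); lanes `0, 1` are the two directions of the first road and lanes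
`2, 3` those of the second road. The platoons of each lane are numbered in order of arrival. Each
platoon has a release time and a (positive) length; the time ranges
`[release, release + length]` on one lane do not overlap. -/
structure Crossing where
  count : Fin 4 → ℕ
  release : (Σ l : Fin 4, Fin (count l)) → ℝ
  len : (Σ l : Fin 4, Fin (count l)) → ℝ
  len_pos : ∀ p, 0 < len p
  disjoint : ∀ (l : Fin 4) (i j : Fin (count l)), i < j →
    release ⟨l, i⟩ + len ⟨l, i⟩ ≤ release ⟨l, j⟩

/-- The road to which a lane belongs. -/
def road (l : Fin 4) : ℕ := l.val / 2

namespace Crossing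

/-- The platoons: pairs of a lane and a position on that lane. -/
abbrev Plat (I : Crossing) : Type := Σ l : Fin 4, Fin (I.count l)

/-- The size `n` of the instance: the number of platoons. -/
def size (I : Crossing) : ℕ := ∑ l, I.count l

/-- A schedule assigns to each platoon its crossing time. -/
abbrev Schedule (I : Crossing) : Type := I.Plat → ℝ

/-- Validity of a schedule. -/
structure Valid (I : Crossing) (c : I.Schedule) : Prop where
  release_le : ∀ p, I.release p ≤ c p
  lane_order : ∀ (l : Fin 4) (i j : Fin (I.count l)), i < j →
    c ⟨l, i⟩ + I.len ⟨l, i⟩ ≤ c ⟨l, j⟩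
  no_collision : ∀ p q : I.Plat, road p.1 ≠ road q.1 →
    Disjoint (Set.Ioo (c p) (c p + I.len p)) (Set.Ioo (c q) (c q + I.len q))

/-- The delay of a schedule: the maximum of the delays of the platoons
(the value is `0` if there are no platoons). -/
noncomputable def delay (I : Crossing) (c : I.Schedule) : ℝ := ⨆ p, (c p - I.release p)

/-- A minimum-delay schedule. -/
def IsMinDelay (I : Crossing) (c : I.Schedule) : Prop :=
  I.Valid c ∧ ∀ c' : I.Schedule, I.Valid c' → I.delay c ≤ I.delay c'

/-- The discrete setting: all release times and lengths are (nonnegative) integers. -/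
def IsDiscrete (I : Crossing) : Prop :=
  ∀ p, (∃ r : ℕ, I.release p = r) ∧ (∃ m : ℕ, I.len p = m)

/-- `L`: the maximum release time plus the sum of the lengths of all platoons. -/
noncomputable def totalLength (I : Crossing) : ℝ := (⨆ p, I.release p) + ∑ p, I.len p

end Crossing

/-! ### The machine model: a real RAM

A program has finitely many arrays of natural numbers (used for indices) and of real numbers (used
for times), each named by a fixed number; a scalar variable is an array of which only one
cell is used. Cells are accessed by computed index. The only arithmetic is addition and
subtraction (truncated, on natural numbers) and comparison, on either sort; there are no
conversions between the two sorts, and only natural numbers occur as constants. Each elementary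
operation, memory access, or test costs one step. -/

/-- Memory contents: `nat a i` is cell `i` of the natural-number array `a`, and `real a i` is cell
`i` of the real array `a`. -/
structure Memory where
  nat : ℕ → ℕ → ℕ
  real : ℕ → ℕ → ℝ

/-- Expressions for natural numbers; `get a e` is the content of cell `e` of array `a`. -/
inductive NExp where
  | lit (k : ℕ)
  | get (a : ℕ) (e : NExp)
  | add (e f : NExp)
  | sub (e f : NExp)

/-- Expressions for real numbers. -/
inductive RExp where
  | lit (k : ℕ)
  | get (a : ℕ) (e : NExp)
  | add (e f : RExp)
  | sub (e f : RExp)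

/-- Tests. -/
inductive BExp where
  | nle (e f : NExp)
  | rle (e f : RExp)
  | neg (b : BExp)
  | and (b c : BExp)

/-- Programs. -/
inductive Prog where
  | skip
  | nset (a : ℕ) (i e : NExp)
  | rset (a : ℕ) (i : NExp) (e : RExp)
  | seq (P Q : Prog)
  | branch (b : BExp) (P Q : Prog)
  | loop (b : BExp) (P : Prog)

def NExp.eval (s : Memory) : NExp → ℕ
  | .lit k => k
  | .get a e => s.nat a (e.eval s)
  | .add e f => e.eval s + f.eval s
  | .sub e f => e.eval s - f.eval s

def NExp.cost : NExp → ℕ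
  | .lit _ => 1
  | .get _ e => e.cost + 1
  | .add e f => e.cost + f.cost + 1
  | .sub e f => e.cost + f.cost + 1

noncomputable def RExp.eval (s : Memory) : RExp → ℝ
  | .lit k => k
  | .get a e => s.real a (e.eval s)
  | .add e f => e.eval s + f.eval s
  | .sub e f => e.eval s - f.eval s

def RExp.cost : RExp → ℕ
  | .lit _ => 1
  | .get _ e => e.cost + 1
  | .add e f => e.cost + f.cost + 1
  | .sub e f => e.cost + f.cost + 1

def BExp.eval (s : Memory) : BExp → Prop
  | .nle e f => e.eval s ≤ f.eval s
  | .rle e f => e.eval s ≤ f.eval s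
  | .neg b => ¬ b.eval s
  | .and b c => b.eval s ∧ c.eval s

def BExp.cost : BExp → ℕ
  | .nle e f => e.cost + f.cost + 1
  | .rle e f => e.cost + f.cost + 1
  | .neg b => b.cost + 1
  | .and b c => b.cost + c.cost + 1

/-- Assignment to one cell of a natural-number array. -/
def Memory.setNat (s : Memory) (a i v : ℕ) : Memory :=
  { s with nat := Function.update s.nat a (Function.update (s.nat a) i v) }

/-- Assignment to one cell of a real array. -/
noncomputable def Memory.setReal (s : Memory) (a i : ℕ) (v : ℝ) : Memory :=
  { s with real := Function.update s.real a (Function.update (s.real a) i v) }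

/-- `Runs P s s' t`: started on memory `s`, the program `P` halts after exactly `t` steps with
memory `s'`. -/
inductive Runs : Prog → Memory → Memory → ℕ → Prop where
  | skip (s : Memory) : Runs .skip s s 1
  | nset (s : Memory) (a : ℕ) (i e : NExp) :
      Runs (.nset a i e) s (s.setNat a (i.eval s) (e.eval s)) (i.cost + e.cost + 1)
  | rset (s : Memory) (a : ℕ) (i : NExp) (e : RExp) :
      Runs (.rset a i e) s (s.setReal a (i.eval s) (e.eval s)) (i.cost + e.cost + 1)
  | seq {P Q : Prog} {s s' s'' : Memory} {t u : ℕ} :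
      Runs P s s' t → Runs Q s' s'' u → Runs (.seq P Q) s s'' (t + u)
  | branch_true {b : BExp} {P Q : Prog} {s s' : Memory} {t : ℕ} :
      b.eval s → Runs P s s' t → Runs (.branch b P Q) s s' (b.cost + t + 1)
  | branch_false {b : BExp} {P Q : Prog} {s s' : Memory} {t : ℕ} :
      ¬ b.eval s → Runs Q s s' t → Runs (.branch b P Q) s s' (b.cost + t + 1)
  | loop_done {b : BExp} {P : Prog} {s : Memory} :
      ¬ b.eval s → Runs (.loop b P) s s (b.cost + 1)
  | loop_step {b : BExp} {P : Prog} {s s' s'' : Memory} {t u : ℕ} :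
      b.eval s → Runs P s s' t → Runs (.loop b P) s' s'' u →
        Runs (.loop b P) s s'' (b.cost + t + u + 1)

/-! ### Input and output -/

/-- A function on the platoons of lane `l` as the contents of an array (`0` beyond the end). -/
noncomputable def Crossing.laneArray (I : Crossing) (f : I.Plat → ℝ) (l : Fin 4) (i : ℕ) : ℝ :=
  if h : i < I.count l then f ⟨l, ⟨i, h⟩⟩ else 0

/-- The input: the number of platoons of lane `l` is in cell `l` of natural-number array `0`;
their release times are in real array `l` and their lengths in real array `4 + l`; cell `0` of real
array `8` contains the parameter `d`. All other cells are `0`. -/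
noncomputable def Crossing.input (I : Crossing) (d : ℝ) : Memory where
  nat a i := if h : a = 0 ∧ i < 4 then I.count ⟨i, h.2⟩ else 0
  real a i :=
    if h : a < 4 then I.laneArray I.release ⟨a, h⟩ i
    else if h : a - 4 < 4 then I.laneArray I.len ⟨a - 4, h⟩ i
    else if a = 8 ∧ i = 0 then d
    else 0

/-- The schedule that a final memory describes: the crossing times of the platoons of lane `l` are
in real array `l`, in order. -/
def Crossing.output (I : Crossing) (s : Memory) : I.Schedule :=
  fun p => s.real p.1 p.2

end Platoon

/-! Cut a schedule into phases in which only one road is served. Between phases, all that matters is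
a prefix (how many platoons of each lane have been served) and the current time. Within a phase the
two lanes do not interact. Serving each lane greedily makes every platoon cross as early as the
start of the phase allows, so it minimises the finish time and all delays at once. For a delay bound
`d` it therefore suffices to find the earliest finish time of each prefix that can be reached by
greedy phases of delay at most `d`. There are at most `(n+1)^4` prefixes and `O(n^2)` phases from
each, hence `O(n^6)` steps.

Correctness of the table has two halves. `Tab.Sound.feas` follows predecessors back and glues the
phases by `Suffix.step`. `Tab.Closed.flag_of_feas` follows an arbitrary valid schedule and shows
that the table never falls behind it (`exists_cut`, `greedy_le`). `Tab.relax` preserves both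
invariants when one more phase is considered.

The minimum is found by parametric search. The dynamic program uses `d` only to compare delays with
it, so it can be run for a whole interval `[lo, hi)` of bounds at once, with `lo` infeasible and
`hi` feasible. When a delay `v` falls strictly inside, the decision procedure at `v` makes it the
new `lo` or the new `hi`. At the end all bounds in `[lo, hi)` share one table, so they are all
infeasible like `lo`, and `hi` is the minimum (`search_ends`). There are `O(n^6)` comparisons of
cost `O(n^6)`. A bisection with powers of two is run first. For integer data it reduces the width to
`1` after `O(log L)` decisions; no integer delay then lies strictly inside, and the parametric run
costs only `O(n^6)`. The bisection is capped at `(n+1)^6` rounds, which keeps the bound `n^12` in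
all cases.

Both runs are verified by one proof because `TestSpec` leaves the comparison abstract: `D m` is the
set of bounds still possible in memory `m`, and the table invariants are required for each of them.
All times lie in a subgroup `S` of the reals, the integers for integer data and everything
otherwise; this carries integrality through the program. Programs are verified in a small
total-correctness logic with step bounds, `Ends`, and a syntactic frame rule. -/

namespace Platoon

/-! ### Greedy service of a single lane -/

namespace Crossing

/-- Release times as a function on all positions of a lane. -/
noncomputable def rel (I : Crossing) (l : Fin 4) (i : ℕ) : ℝ := I.laneArray I.release l i

/-- Lengths as a function on all positions of a lane. -/
noncomputable def ln (I : Crossing) (l : Fin 4) (i : ℕ) : ℝ := I.laneArray I.len l i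

theorem rel_eq (I : Crossing) (l : Fin 4) (i : Fin (I.count l)) :
    I.rel l i = I.release ⟨l, i⟩ := by
  simp [rel, laneArray]

theorem ln_eq (I : Crossing) (l : Fin 4) (i : Fin (I.count l)) : I.ln l i = I.len ⟨l, i⟩ := by
  simp [ln, laneArray]

theorem ln_nonneg (I : Crossing) (l : Fin 4) (i : ℕ) : 0 ≤ I.ln l i := by
  unfold ln laneArray
  split
  · exact (I.len_pos _).le
  · exact le_rfl

/-- There is a valid schedule in which no platoon is delayed by more than `d`. -/
def Feas (I : Crossing) (d : ℝ) : Prop :=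
  ∃ c : I.Schedule, I.Valid c ∧ ∀ p, c p - I.release p ≤ d

theorem Feas.mono {I : Crossing} {d e : ℝ} (h : I.Feas d) (hde : d ≤ e) : I.Feas e := by
  obtain ⟨c, hc, hd⟩ := h
  exact ⟨c, hc, fun p => (hd p).trans hde⟩

/-- Finish time of lane `l` when its platoons `j, …, i - 1` are served greedily from time `T`. -/
noncomputable def chain (I : Crossing) (l : Fin 4) (T : ℝ) (j : ℕ) : ℕ → ℝ
  | 0 => T
  | i + 1 => if i < j then T else max (I.rel l i) (chain I l T j i) + I.ln l i

/-- Maximum of `0` and the delays of the platoons `j, …, i - 1` of lane `l` when they are served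
greedily from time `T`. -/
noncomputable def lag (I : Crossing) (l : Fin 4) (T : ℝ) (j : ℕ) : ℕ → ℝ
  | 0 => 0
  | i + 1 => if i < j then 0 else
      max (lag I l T j i) (max (I.rel l i) (I.chain l T j i) - I.rel l i)

variable {I : Crossing}

theorem chain_of_le {l : Fin 4} {T : ℝ} {j i : ℕ} (h : i ≤ j) : I.chain l T j i = T := by
  cases i with
  | zero => rfl
  | succ i => simp [chain, Nat.lt_of_succ_le h]

theorem chain_succ {l : Fin 4} {T : ℝ} {j i : ℕ} (h : j ≤ i) :
    I.chain l T j (i + 1) = max (I.rel l i) (I.chain l T j i) + I.ln l i := by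
  simp [chain, h.not_gt]

theorem lag_of_le {l : Fin 4} {T : ℝ} {j i : ℕ} (h : i ≤ j) : I.lag l T j i = 0 := by
  cases i with
  | zero => rfl
  | succ i => simp [lag, Nat.lt_of_succ_le h]

theorem lag_succ {l : Fin 4} {T : ℝ} {j i : ℕ} (h : j ≤ i) :
    I.lag l T j (i + 1) =
      max (I.lag l T j i) (max (I.rel l i) (I.chain l T j i) - I.rel l i) := by
  simp [lag, h.not_gt]

theorem chain_monotone (l : Fin 4) (T : ℝ) (j : ℕ) : Monotone (I.chain l T j) := by
  refine monotone_nat_of_le_succ fun i => ?_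
  rcases le_or_gt j i with h | h
  · rw [chain_succ h]
    have := I.ln_nonneg l i
    have := le_max_right (I.rel l i) (I.chain l T j i)
    linarith
  · rw [chain_of_le h.le, chain_of_le h]

theorem le_chain (l : Fin 4) (T : ℝ) (j i : ℕ) : T ≤ I.chain l T j i :=
  chain_monotone l T j (Nat.zero_le i)

theorem lag_monotone (l : Fin 4) (T : ℝ) (j : ℕ) : Monotone (I.lag l T j) := by
  refine monotone_nat_of_le_succ fun i => ?_
  rcases le_or_gt j i with h | h
  · rw [lag_succ h]
    exact le_max_left _ _
  · rw [lag_of_le h.le, lag_of_le h]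

/-- Finish times arise from the data by maxima and sums only, so they stay in any subgroup
containing the data. Together with `lag_mem` this makes every delay compared by the program an
integer when the data are integers. -/
theorem chain_mem {S : AddSubgroup ℝ} (hr : ∀ l i, I.rel l i ∈ S) (hl : ∀ l i, I.ln l i ∈ S)
    {l : Fin 4} {T : ℝ} (hT : T ∈ S) (j i : ℕ) : I.chain l T j i ∈ S := by
  induction i with
  | zero => exact hT
  | succ i ih =>
    unfold chain
    split
    · exact hT
    · refine S.add_mem ?_ (hl l i)
      rcases max_choice (I.rel l i) (I.chain l T j i) with h | h <;> rw [h]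
      exacts [hr l i, ih]

theorem lag_mem {S : AddSubgroup ℝ} (hr : ∀ l i, I.rel l i ∈ S) (hl : ∀ l i, I.ln l i ∈ S)
    {l : Fin 4} {T : ℝ} (hT : T ∈ S) (j i : ℕ) : I.lag l T j i ∈ S := by
  induction i with
  | zero => exact S.zero_mem
  | succ i ih =>
    unfold lag
    split
    · exact S.zero_mem
    · have h1 : max (I.rel l i) (I.chain l T j i) - I.rel l i ∈ S := by
        refine S.sub_mem ?_ (hr l i)
        rcases max_choice (I.rel l i) (I.chain l T j i) with h | h <;> rw [h]
        exacts [hr l i, chain_mem hr hl hT j i]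
      rcases max_choice (I.lag l T j i) (max (I.rel l i) (I.chain l T j i) - I.rel l i)
        with h | h <;> rw [h]
      exacts [ih, h1]

/-! ### Phases and the gluing of phases to schedules -/

/-- `a` and `c` are the two lanes of a road. -/
def Pair (a c : Fin 4) : Prop := (a = 0 ∧ c = 1) ∨ (a = 2 ∧ c = 3)

theorem Pair.road_eq {a c l l' : Fin 4} (h : Pair a c) (hl : l = a ∨ l = c)
    (hl' : l' = a ∨ l' = c) : road l = road l' := by
  rcases h with ⟨rfl, rfl⟩ | ⟨rfl, rfl⟩ <;> rcases hl with rfl | rfl <;>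
    rcases hl' with rfl | rfl <;> rfl

theorem Pair.of_road_eq {a c l : Fin 4} (h : Pair a c) (hl : road l = road a) :
    l = a ∨ l = c := by
  rcases h with ⟨rfl, rfl⟩ | ⟨rfl, rfl⟩ <;> revert l <;> unfold road <;> decide

theorem exists_pair (l : Fin 4) : ∃ a c, Pair a c ∧ road l = road a := by
  have : (road l = road 0) ∨ (road l = road 2) := by
    revert l; unfold road; decide
  rcases this with h | h
  · exact ⟨0, 1, Or.inl ⟨rfl, rfl⟩, h⟩
  · exact ⟨2, 3, Or.inr ⟨rfl, rfl⟩, h⟩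

/-- From the prefix `p` one gets to the prefix `s` by serving platoons of lanes `a`, `c`, which
form a road. -/
structure Edge (a c : Fin 4) (p s : Fin 4 → ℕ) : Prop where
  pair : Pair a c
  le : ∀ l, p l ≤ s l
  eq : ∀ l, l ≠ a → l ≠ c → s l = p l

/-- Finish time of a phase started at time `T`. -/
noncomputable def fin (I : Crossing) (a c : Fin 4) (p : Fin 4 → ℕ) (T : ℝ) (s : Fin 4 → ℕ) : ℝ :=
  max (I.chain a T (p a) (s a)) (I.chain c T (p c) (s c))

/-- Delay caused by a phase started at time `T`. -/
noncomputable def pen (I : Crossing) (a c : Fin 4) (p : Fin 4 → ℕ) (T : ℝ) (s : Fin 4 → ℕ) : ℝ :=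
  max (I.lag a T (p a) (s a)) (I.lag c T (p c) (s c))

theorem Edge.lane {a c : Fin 4} {p s : Fin 4 → ℕ} (h : Edge a c p s) {l : Fin 4}
    (hl : p l < s l) : l = a ∨ l = c := by
  by_contra! hc
  exact hl.ne' (h.eq l hc.1 hc.2)

theorem Edge.chain_le_fin {a c : Fin 4} {p s : Fin 4 → ℕ} (h : Edge a c p s) {l : Fin 4}
    (hl : p l < s l) (T : ℝ) : I.chain l T (p l) (s l) ≤ I.fin a c p T s := by
  rcases h.lane hl with rfl | rfl
  exacts [le_max_left _ _, le_max_right _ _]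

theorem Edge.lag_le_pen {a c : Fin 4} {p s : Fin 4 → ℕ} (h : Edge a c p s) {l : Fin 4}
    (hl : p l < s l) (T : ℝ) : I.lag l T (p l) (s l) ≤ I.pen a c p T s := by
  rcases h.lane hl with rfl | rfl
  exacts [le_max_left _ _, le_max_right _ _]

theorem le_fin (a c : Fin 4) (p : Fin 4 → ℕ) (T : ℝ) (s : Fin 4 → ℕ) : T ≤ I.fin a c p T s :=
  (le_chain a T (p a) (s a)).trans (le_max_left _ _)

/-- The platoons outside the prefix `s` are scheduled by `c` correctly, with delays at most `d`,
and not before time `T`. -/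
structure Suffix (I : Crossing) (d : ℝ) (s : Fin 4 → ℕ) (T : ℝ) (c : Fin 4 → ℕ → ℝ) : Prop where
  lb : ∀ l i, s l ≤ i → i < I.count l → T ≤ c l i
  rel_le : ∀ l i, s l ≤ i → i < I.count l → I.rel l i ≤ c l i
  delay_le : ∀ l i, s l ≤ i → i < I.count l → c l i - I.rel l i ≤ d
  lane : ∀ l i j, s l ≤ i → i < j → j < I.count l → c l i + I.ln l i ≤ c l j
  cross : ∀ l l' i i', road l ≠ road l' → s l ≤ i → i < I.count l → s l' ≤ i' →
    i' < I.count l' → c l i + I.ln l i ≤ c l' i' ∨ c l' i' + I.ln l' i' ≤ c l i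

theorem Suffix.full (d : ℝ) (T : ℝ) (c : Fin 4 → ℕ → ℝ) : I.Suffix d I.count T c := by
  constructor <;> intros <;> omega

theorem Suffix.valid {d T : ℝ} {s : Fin 4 → ℕ} {c : Fin 4 → ℕ → ℝ} (h : I.Suffix d s T c)
    (hs : ∀ l, s l = 0) : I.Valid (fun p => c p.1 p.2) ∧
      ∀ p : I.Plat, c p.1 p.2 - I.release p ≤ d := by
  refine ⟨⟨?_, ?_, ?_⟩, ?_⟩
  · rintro ⟨l, i⟩
    rw [← I.rel_eq]
    exact h.rel_le l i (by simp [hs]) i.2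
  · intro l i j hij
    rw [← I.ln_eq]
    exact h.lane l i j (by simp [hs]) hij j.2
  · rintro ⟨l, i⟩ ⟨l', i'⟩ hr
    rw [← I.ln_eq, ← I.ln_eq]
    rw [Set.disjoint_left]
    rintro x ⟨h1, h2⟩ ⟨h3, h4⟩
    simp only at h1 h2 h3 h4
    rcases h.cross l l' i i' hr (by simp [hs]) i.2 (by simp [hs]) i'.2 with h5 | h5 <;> linarith
  · rintro ⟨l, i⟩
    rw [← I.rel_eq]
    exact h.delay_le l i (by simp [hs]) i.2

/-- A phase can be put in front of a schedule of the remaining platoons that starts no earlier than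
the phase ends: old and new platoons are then separated in time, and two new ones are on the same
road. The new schedule `c'` is given by its values only, so that the lemma also applies to the array
that the program overwrites. -/
theorem Suffix.step {d T : ℝ} {a b : Fin 4} {p s : Fin 4 → ℕ} {c c' : Fin 4 → ℕ → ℝ}
    (he : Edge a b p s) (h : I.Suffix d s (I.fin a b p T s) c) (hd : I.pen a b p T s ≤ d)
    (hold : ∀ l i, s l ≤ i → c' l i = c l i)
    (hnew : ∀ l i, p l ≤ i → i < s l → c' l i = max (I.rel l i) (I.chain l T (p l) i)) :
    I.Suffix d p T c' := by
  have hfin : ∀ l i, p l ≤ i → i < s l → c' l i + I.ln l i ≤ I.fin a b p T s := by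
    intro l i h1 h2
    rw [hnew l i h1 h2, ← chain_succ h1]
    exact (chain_monotone l T (p l) h2).trans (he.chain_le_fin (h1.trans_lt h2) T)
  have hcross : ∀ l l' i i', p l ≤ i → i < s l → s l' ≤ i' → i' < I.count l' →
      c' l i + I.ln l i ≤ c' l' i' := by
    intro l l' i i' h1 h2 h3 h4
    rw [hold l' i' h3]
    exact (hfin l i h1 h2).trans (h.lb l' i' h3 h4)
  refine ⟨?_, ?_, ?_, ?_, ?_⟩
  · intro l i h1 h2
    rcases lt_or_ge i (s l) with h3 | h3
    · rw [hnew l i h1 h3]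
      exact (le_chain l T (p l) i).trans (le_max_right _ _)
    · rw [hold l i h3]
      exact (le_fin _ _ _ _ _).trans (h.lb l i h3 h2)
  · intro l i h1 h2
    rcases lt_or_ge i (s l) with h3 | h3
    · rw [hnew l i h1 h3]
      exact le_max_left _ _
    · rw [hold l i h3]
      exact h.rel_le l i h3 h2
  · intro l i h1 h2
    rcases lt_or_ge i (s l) with h3 | h3
    · rw [hnew l i h1 h3]
      refine le_trans ?_ ((lag_monotone l T (p l) (show i + 1 ≤ s l from h3)).trans
        ((he.lag_le_pen (h1.trans_lt h3) T).trans hd))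
      rw [lag_succ h1]
      exact le_max_right _ _
    · rw [hold l i h3]
      exact h.delay_le l i h3 h2
  · intro l i j h1 h2 h3
    rcases lt_or_ge i (s l) with h4 | h4
    · rcases lt_or_ge j (s l) with h5 | h5
      · rw [hnew l i h1 h4, hnew l j (h1.trans h2.le) h5, ← chain_succ h1]
        exact (chain_monotone l T (p l) h2).trans (le_max_right _ _)
      · exact hcross l l i j h1 h4 h5 h3
    · rw [hold l i h4, hold l j (h4.trans h2.le)]
      exact h.lane l i j h4 h2 h3
  · intro l l' i i' hr h1 h2 h3 h4
    rcases lt_or_ge i (s l) with h5 | h5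
    · rcases lt_or_ge i' (s l') with h6 | h6
      -- Both platoons belong to the new phase, hence to one road, so they need no separation.
      · exact absurd (he.pair.road_eq (he.lane (h1.trans_lt h5)) (he.lane (h3.trans_lt h6))) hr
      · exact Or.inl (hcross l l' i i' h1 h5 h6 h4)
    · rcases lt_or_ge i' (s l') with h6 | h6
      · exact Or.inr (hcross l' l i' i h3 h6 h5 h2)
      · rw [hold l i h5, hold l' i' h6]
        exact h.cross l l' i i' hr h5 h2 h6 h4

/-! ### Numbering the prefixes -/

/-- The radix used to number the prefixes. -/
def radix (I : Crossing) : ℕ := I.size + 1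

theorem count_lt_radix (l : Fin 4) : I.count l < I.radix :=
  Nat.lt_succ_of_le (Finset.single_le_sum (f := I.count) (fun _ _ => Nat.zero_le _)
    (Finset.mem_univ l))

theorem radix_pos : 0 < I.radix := Nat.succ_pos _

/-- The number of a prefix. -/
def idx (I : Crossing) (s : Fin 4 → ℕ) : ℕ := ∑ l, s l * I.radix ^ (l : ℕ)

/-- Bound for the numbers of prefixes. -/
def states (I : Crossing) : ℕ := I.radix ^ 4

/-- Serving platoons strictly increases the number, so visiting prefixes in numerical order is a
topological order of the phases. -/
theorem idx_lt {p s : Fin 4 → ℕ} (h : ∀ l, p l ≤ s l) (hne : p ≠ s) : I.idx p < I.idx s := by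
  obtain ⟨l, hl⟩ := Function.ne_iff.1 hne
  exact Finset.sum_lt_sum (fun l _ => Nat.mul_le_mul_right _ (h l))
    ⟨l, Finset.mem_univ l, Nat.mul_lt_mul_of_pos_right (lt_of_le_of_ne (h l) hl)
      (pow_pos radix_pos _)⟩

theorem idx_horner (s : Fin 4 → ℕ) :
    I.idx s = s 0 + I.radix * (s 1 + I.radix * (s 2 + I.radix * s 3)) := by
  simp [idx, Fin.sum_univ_four]
  ring

theorem idx_lt_states {s : Fin 4 → ℕ} (h : ∀ l, s l ≤ I.count l) : I.idx s < I.states := by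
  have key : ∀ {a b m N : ℕ}, a < m → b < N → a + m * b < m * N := by
    intro a b m N h1 h2
    calc a + m * b < m + m * b := by omega
      _ = m * (b + 1) := by ring
      _ ≤ m * N := Nat.mul_le_mul_left _ h2
  have hs := fun l => (h l).trans_lt (I.count_lt_radix l)
  rw [idx_horner, states, show I.radix ^ 4 = I.radix * (I.radix * (I.radix * I.radix)) by ring]
  exact key (hs 0) (key (hs 1) (key (hs 2) (hs 3)))

/-- The counts are the digits in base `radix`, which exceeds every one of them. -/
theorem idx_inj {p s : Fin 4 → ℕ} (hp : ∀ l, p l ≤ I.count l) (hs : ∀ l, s l ≤ I.count l)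
    (h : I.idx p = I.idx s) : p = s := by
  have key : ∀ {a b a' b' m : ℕ}, a < m → a' < m → a + m * b = a' + m * b' → a = a' ∧ b = b' := by
    intro a b a' b' m h1 h2 h3
    have h4 : a = a' := by
      have := congrArg (· % m) h3
      simpa [Nat.add_mul_mod_self_left, Nat.mod_eq_of_lt h1, Nat.mod_eq_of_lt h2] using this
    subst h4
    exact ⟨rfl, Nat.eq_of_mul_eq_mul_left (by omega) (Nat.add_left_cancel h3)⟩
  have hp := fun l => (hp l).trans_lt (I.count_lt_radix l)
  have hs := fun l => (hs l).trans_lt (I.count_lt_radix l)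
  rw [idx_horner, idx_horner] at h
  obtain ⟨h0, h⟩ := key (hp 0) (hs 0) h
  obtain ⟨h1, h⟩ := key (hp 1) (hs 1) h
  obtain ⟨h2, h3⟩ := key (hp 2) (hs 2) h
  funext l
  fin_cases l
  exacts [h0, h1, h2, h3]

theorem Edge.idx_lt_or_eq {a c : Fin 4} {p s : Fin 4 → ℕ} (h : Edge a c p s) :
    p = s ∨ I.idx p < I.idx s := by
  by_cases hne : p = s
  · exact Or.inl hne
  · exact Or.inr (idx_lt h.le hne)

/-! ### Tables, and why a reached full prefix gives a schedule -/

/-- Tables of the dynamic program: which prefixes have been reached, their finish times, the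
prefixes themselves, and their predecessors. -/
structure Tab where
  flag : ℕ → ℕ
  val : ℕ → ℝ
  pos : Fin 4 → ℕ → ℕ
  pre : ℕ → ℕ

/-- Record the prefix `s`, reached from the prefix number `t` with finish time `x`. -/
noncomputable def Tab.put (A : Tab) (u : ℕ) (x : ℝ) (s : Fin 4 → ℕ) (t : ℕ) : Tab where
  flag := Function.update A.flag u 1
  val := Function.update A.val u x
  pos l := Function.update (A.pos l) u (s l)
  pre := Function.update A.pre u t

/-- The entries of a table describe schedules with delays at most `d`. -/
structure Tab.Sound (A : Tab) (I : Crossing) (T₀ : ℝ) (S : AddSubgroup ℝ) (d : ℝ) (t : ℕ) :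
    Prop where
  zero_flag : 0 < A.flag 0
  zero_val : A.val 0 = T₀
  zero_pos : ∀ l, A.pos l 0 = 0
  idx : ∀ u < I.states, 0 < A.flag u → I.idx (A.pos · u) = u
  le : ∀ u < I.states, 0 < A.flag u → ∀ l, A.pos l u ≤ I.count l
  mem : ∀ u < I.states, 0 < A.flag u → A.val u ∈ S
  pre : ∀ u < I.states, 0 < A.flag u → u ≠ 0 → A.pre u < u ∧ A.pre u ≤ t ∧
    0 < A.flag (A.pre u) ∧ ∃ a c, Edge a c (A.pos · (A.pre u)) (A.pos · u) ∧
      A.val u = I.fin a c (A.pos · (A.pre u)) (A.val (A.pre u)) (A.pos · u) ∧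
      I.pen a c (A.pos · (A.pre u)) (A.val (A.pre u)) (A.pos · u) ≤ d

/-- The table takes account of the phases singled out by `E`. -/
def Tab.Closed (A : Tab) (I : Crossing) (d : ℝ)
    (E : ℕ → Fin 4 → Fin 4 → (Fin 4 → ℕ) → Prop) : Prop :=
  ∀ p < I.states, 0 < A.flag p → ∀ a c s, Edge a c (A.pos · p) s → (∀ l, s l ≤ I.count l) →
    E p a c s → I.pen a c (A.pos · p) (A.val p) s ≤ d →
      0 < A.flag (I.idx s) ∧ A.val (I.idx s) ≤ I.fin a c (A.pos · p) (A.val p) s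

theorem Tab.Closed.mono {A : Tab} {d : ℝ} {E E' : ℕ → Fin 4 → Fin 4 → (Fin 4 → ℕ) → Prop}
    (h : A.Closed I d E)
    (hE : ∀ p < I.states, 0 < A.flag p → ∀ a c s, Edge a c (A.pos · p) s →
      (∀ l, s l ≤ I.count l) → E' p a c s → E p a c s) : A.Closed I d E' :=
  fun p hp hf a c s he hs h' hv => h p hp hf a c s he hs (hE p hp hf a c s he hs h') hv

/-- Induction along predecessors, which have smaller numbers: each recorded phase is prepended to
the schedule of the rest until the empty prefix is reached. -/
theorem Tab.Sound.feas_of_suffix {A : Tab} {T₀ d : ℝ} {S : AddSubgroup ℝ} {t : ℕ}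
    (h : A.Sound I T₀ S d t) (u : ℕ) (hu : u < I.states) (hf : 0 < A.flag u)
    (c : Fin 4 → ℕ → ℝ) (hc : I.Suffix d (A.pos · u) (A.val u) c) : I.Feas d := by
  classical
  induction u using Nat.strong_induction_on generalizing c with
  | _ u ih =>
    by_cases h0 : u = 0
    · subst h0
      exact ⟨_, hc.valid h.zero_pos⟩
    · obtain ⟨h1, -, h2, a, b, he, hv, hd⟩ := h.pre u hu hf h0
      rw [hv] at hc
      refine ih _ h1 (h1.trans hu) h2
        (fun l i => if i < A.pos l u then
          max (I.rel l i) (I.chain l (A.val (A.pre u)) (A.pos l (A.pre u)) i) else c l i)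
        (Suffix.step he hc hd ?_ ?_)
      · intro l i hi
        simp [not_lt.2 hi]
      · intro l i _ hi
        simp [hi]

theorem Tab.Sound.feas {A : Tab} {T₀ d : ℝ} {S : AddSubgroup ℝ} {t : ℕ}
    (h : A.Sound I T₀ S d t) (hf : 0 < A.flag (I.idx I.count)) : I.Feas d := by
  have hu := I.idx_lt_states (fun l => le_refl (I.count l))
  refine h.feas_of_suffix _ hu hf (fun _ _ => 0) ?_
  have : (A.pos · (I.idx I.count)) = I.count :=
    idx_inj (h.le _ hu hf) (fun _ => le_rfl) (h.idx _ hu hf)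
  rw [this]
  exact Suffix.full _ _ _

end Crossing
end Platoon

/-! ### Completeness of the dynamic program -/

namespace Platoon

namespace Crossing

variable {I : Crossing}

/-- In a valid schedule, the platoons of a lane from position `j` on that start before `τ` end at
some position. -/
theorem exists_cut (I : Crossing) {c : I.Schedule} (hc : I.Valid c) (l : Fin 4) (j : ℕ)
    (hj : j ≤ I.count l) (τ : ℝ) : ∃ s, j ≤ s ∧ s ≤ I.count l ∧
      (∀ i (h : i < I.count l), j ≤ i → i < s → c ⟨l, ⟨i, h⟩⟩ < τ) ∧
      (∀ i (h : i < I.count l), s ≤ i → τ ≤ c ⟨l, ⟨i, h⟩⟩) := by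
  classical
  have hex : ∃ s, j ≤ s ∧ (∀ h : s < I.count l, τ ≤ c ⟨l, ⟨s, h⟩⟩) :=
    ⟨I.count l, hj, fun h => absurd h (lt_irrefl _)⟩
  refine ⟨Nat.find hex, (Nat.find_spec hex).1,
    Nat.find_min' hex ⟨hj, fun h => absurd h (lt_irrefl _)⟩, ?_, ?_⟩
  · intro i h h1 h2
    have := Nat.find_min hex h2
    push Not at this
    exact (this h1).2
  · intro i h h1
    rcases h1.eq_or_lt with h2 | h2
    · have h3 := (Nat.find_spec hex).2
      simp only [h2] at h3
      exact h3 h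
    · have hs := h2.trans h
      have h3 := (Nat.find_spec hex).2 hs
      have h4 := hc.lane_order l ⟨_, hs⟩ ⟨i, h⟩ h2
      have := I.len_pos ⟨l, ⟨_, hs⟩⟩
      linarith

/-- Greedy service of a lane is at least as early as any valid schedule. -/
theorem greedy_le {c : I.Schedule} (hc : I.Valid c) {l : Fin 4} {j s : ℕ} {T d τ : ℝ}
    (hd : ∀ p, c p - I.release p ≤ d) (h0 : 0 ≤ d) (hs : s ≤ I.count l)
    (hT : ∀ i (h : i < I.count l), j ≤ i → T ≤ c ⟨l, ⟨i, h⟩⟩) (hτ : T ≤ τ)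
    (hfin : ∀ i (h : i < I.count l), j ≤ i → i < s →
      c ⟨l, ⟨i, h⟩⟩ + I.len ⟨l, ⟨i, h⟩⟩ ≤ τ) :
    I.chain l T j s ≤ τ ∧ I.lag l T j s ≤ d := by
  -- The greedy finish time stays below the start of the next platoon in `c`; this forces the greedy
  -- crossing time, and with it the delay, below that of `c`.
  have key : ∀ i ≤ s, I.lag l T j i ≤ d ∧ I.chain l T j i ≤ τ ∧
      ∀ h : i < I.count l, j ≤ i → I.chain l T j i ≤ c ⟨l, ⟨i, h⟩⟩ := by
    intro i
    induction i with
    | zero => exact fun _ => ⟨h0, hτ, fun h hj => hT 0 h hj⟩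
    | succ i ih =>
      intro hi
      obtain ⟨h1, h2, h3⟩ := ih (by omega)
      rcases lt_or_ge i j with hij | hij
      · rw [lag_of_le hij, chain_of_le hij]
        exact ⟨h0, hτ, fun h h' => hT _ h h'⟩
      · have hi' : i < I.count l := by omega
        have h4 := h3 hi' hij
        have h5 := hc.release_le ⟨l, ⟨i, hi'⟩⟩
        have h6 : max (I.rel l i) (I.chain l T j i) ≤ c ⟨l, ⟨i, hi'⟩⟩ := by
          refine max_le ?_ h4
          rw [I.rel_eq l ⟨i, hi'⟩]
          exact h5
        have h7 := hd ⟨l, ⟨i, hi'⟩⟩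
        have h8 := hfin i hi' hij hi
        have e1 := I.rel_eq l ⟨i, hi'⟩
        have e2 := I.ln_eq l ⟨i, hi'⟩
        simp only at e1 e2
        rw [lag_succ hij, chain_succ hij]
        refine ⟨max_le h1 (by linarith), by linarith, fun h h' => ?_⟩
        have h9 := hc.lane_order l ⟨i, hi'⟩ ⟨i + 1, h⟩ (Nat.lt_succ_self i)
        linarith
  exact ⟨(key s le_rfl).2.1, (key s le_rfl).1⟩

/-- Follow a feasible schedule `c` phase by phase while keeping a reached prefix whose recorded time
precedes the start in `c` of every remaining platoon. The next phase consists of the remaining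
platoons of the road served first that start before the other road's next start `τ`. Greedy service
of it ends by `τ`, so the property is inherited. -/
theorem Tab.Closed.flag_of_feas {A : Tab} {T₀ d : ℝ} {S : AddSubgroup ℝ} {t : ℕ}
    (h : A.Sound I T₀ S d t) (hC : A.Closed I d (fun _ _ _ _ => True))
    (hT₀ : ∀ p, T₀ ≤ I.release p) (hd : 0 < I.size ∨ 0 ≤ d) (hf : I.Feas d) :
    0 < A.flag (I.idx I.count) := by
  obtain ⟨c, hc, hcd⟩ := hf
  -- Needed because `lag` starts at `0`; with at least one platoon it follows from crossing after
  -- release.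
  have hd0 : 0 ≤ d := by
    rcases hd with hd | hd
    · obtain ⟨l, -, hl⟩ := Finset.exists_ne_zero_of_sum_ne_zero (show ∑ l, I.count l ≠ 0 from hd.ne')
      have h1 := hcd ⟨l, ⟨0, Nat.pos_of_ne_zero hl⟩⟩
      have h2 := hc.release_le ⟨l, ⟨0, Nat.pos_of_ne_zero hl⟩⟩
      linarith
    · exact hd
  have key : ∀ k u, u < I.states → 0 < A.flag u → I.states - u ≤ k →
      (∀ l i (h : i < I.count l), A.pos l u ≤ i → A.val u ≤ c ⟨l, ⟨i, h⟩⟩) →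
      0 < A.flag (I.idx I.count) := by
    intro k
    induction k with
    | zero => intro u hu; omega
    | succ k ih =>
      intro u hu hfu hk hlb
      by_cases hfull : (A.pos · u) = I.count
      · rw [← hfull, h.idx u hu hfu]
        exact hfu
      have hle := h.le u hu hfu
      obtain ⟨l₁, hl₁⟩ := Function.ne_iff.1 hfull
      have hl₁ : A.pos l₁ u < I.count l₁ := lt_of_le_of_ne (hle l₁) hl₁
      -- the platoon served first
      obtain ⟨⟨l₀, i₀⟩, hp₀, hmin⟩ := Set.exists_min_image
        {p : I.Plat | A.pos p.1 u ≤ p.2} c (Set.toFinite _) ⟨⟨l₁, ⟨_, hl₁⟩⟩, le_refl (A.pos l₁ u)⟩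
      simp only [Set.mem_ofPred_eq] at hp₀ hmin
      obtain ⟨a, b, hab, hr⟩ := exists_pair l₀
      -- the end of its phase
      obtain ⟨τ, hτ1, hτ2, hτ3⟩ : ∃ τ, (∀ q : I.Plat, A.pos q.1 u ≤ q.2 → road q.1 ≠ road a →
          τ ≤ c q) ∧ (∀ q : I.Plat, A.pos q.1 u ≤ q.2 → road q.1 = road a → c q < τ →
          c q + I.len q ≤ τ) ∧ c ⟨l₀, i₀⟩ < τ := by
        rcases Set.eq_empty_or_nonempty {p : I.Plat | A.pos p.1 u ≤ p.2 ∧ road p.1 ≠ road a}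
          with hB | hB
        -- The other road has nothing left: any time after all platoons have finished serves as the
        -- end.
        · obtain ⟨τ, hτ⟩ := (Set.finite_range (fun p : I.Plat => c p + I.len p)).bddAbove
          have hτ : ∀ p, c p + I.len p ≤ τ := fun p => hτ ⟨p, rfl⟩
          refine ⟨τ, fun q h1 h2 => ?_, fun q _ _ _ => hτ q, ?_⟩
          · exact absurd (show q ∈ {p : I.Plat | A.pos p.1 u ≤ p.2 ∧ road p.1 ≠ road a} from
              ⟨h1, h2⟩) (by simp [hB])
          · have := hτ ⟨l₀, i₀⟩
            have := I.len_pos ⟨l₀, i₀⟩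
            linarith
        · obtain ⟨q, ⟨hq1, hq2⟩, hq⟩ := Set.exists_min_image _ c (Set.toFinite _) hB
          -- Disjoint open intervals of positive length are ordered: a platoon starting no later
          -- than `q` must finish by the start of `q`.
          have hsep : ∀ p : I.Plat, road p.1 = road a → c p ≤ c q → c p + I.len p ≤ c q := by
            intro p hp hpq
            have h1 := hc.no_collision p q (by rw [hp]; exact hq2.symm)
            rw [Set.disjoint_left] at h1
            by_contra! h2
            have hlp := I.len_pos p
            have hlq := I.len_pos q
            obtain ⟨x, hx1, hx2⟩ := exists_between
              (show c q < min (c p + I.len p) (c q + I.len q) from lt_min h2 (by linarith))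
            rw [lt_min_iff] at hx2
            exact h1 ⟨hpq.trans_lt hx1, hx2.1⟩ ⟨hx1, hx2.2⟩
          refine ⟨c q, fun p h1 h2 => hq p ⟨h1, h2⟩, fun p _ h2 h3 => hsep p h2 h3.le, ?_⟩
          have h1 := hsep ⟨l₀, i₀⟩ hr (hmin q hq1)
          have h2 := I.len_pos ⟨l₀, i₀⟩
          linarith
      have hTτ : A.val u ≤ τ := (hlb l₀ i₀ i₀.2 hp₀).trans hτ3.le
      choose s hs1 hs2 hs3 hs4 using fun l => exists_cut I hc l (A.pos l u) (hle l) τ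
      let s' : Fin 4 → ℕ := fun l => if l = a ∨ l = b then s l else A.pos l u
      have hs'a : s' a = s a := by simp [s']
      have hs'b : s' b = s b := by simp [s']
      have hedge : Edge a b (A.pos · u) s' := by
        refine ⟨hab, fun l => ?_, fun l h1 h2 => ?_⟩
        · simp only [s']
          split
          exacts [hs1 l, le_rfl]
        · simp [s', h1, h2]
      have hs'le : ∀ l, s' l ≤ I.count l := by
        intro l
        simp only [s']
        split
        exacts [hs2 l, hle l]
      have hg : ∀ l, l = a ∨ l = b → I.chain l (A.val u) (A.pos l u) (s l) ≤ τ ∧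
          I.lag l (A.val u) (A.pos l u) (s l) ≤ d := by
        intro l hl
        refine greedy_le hc hcd hd0 (hs2 l) (hlb l) hTτ ?_
        intro i hi h1 h2
        exact hτ2 ⟨l, ⟨i, hi⟩⟩ h1 (hab.road_eq hl (Or.inl rfl)) (hs3 l i hi h1 h2)
      have hga := hg a (Or.inl rfl)
      have hgb := hg b (Or.inr rfl)
      obtain ⟨hf', hv'⟩ := hC u hu hfu a b s' hedge hs'le trivial (by
        unfold pen
        rw [hs'a, hs'b]
        exact max_le hga.2 hgb.2)
      have hv'' : A.val (I.idx s') ≤ τ := by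
        refine hv'.trans ?_
        unfold fin
        rw [hs'a, hs'b]
        exact max_le hga.1 hgb.1
      -- The phase is not empty because it contains the first platoon, which starts before `τ`.
      -- Hence the number of the prefix grows and the induction ends.
      have hlt : u < I.idx s' := by
        rcases hedge.idx_lt_or_eq (I := I) with h1 | h1
        · exfalso
          have h2 : l₀ = a ∨ l₀ = b := hab.of_road_eq hr
          have h3 := congrFun h1 l₀
          simp only [s', h2, if_true] at h3
          have h4 := hs4 l₀ i₀ i₀.2 (by rw [← h3]; exact hp₀)
          exact absurd hτ3 (not_lt.2 h4)
        · rwa [h.idx u hu hfu] at h1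
      have hu' := idx_lt_states hs'le
      have hpos : (A.pos · (I.idx s')) = s' := idx_inj (h.le _ hu' hf') hs'le (h.idx _ hu' hf')
      refine ih _ hu' hf' (by omega) fun l i hi hil => ?_
      rw [show A.pos l (I.idx s') = s' l from congrFun hpos l] at hil
      refine hv''.trans ?_
      by_cases hl : l = a ∨ l = b
      · simp only [s', hl, if_true] at hil
        exact hs4 l i hi hil
      · simp only [s', hl, if_false] at hil
        exact hτ1 ⟨l, ⟨i, hi⟩⟩ hil fun h' => hl (hab.of_road_eq h')
  refine key _ 0 (pow_pos radix_pos _) h.zero_flag le_rfl fun l i hi _ => ?_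
  rw [h.zero_val]
  exact (hT₀ _).trans (hc.release_le _)

/-! ### Considering one more phase -/

/-- An entry is changed only at a number `u > t`. Recorded predecessors are at most `t`, so no
soundness claim refers to the changed entry as a predecessor. The phases of `E'` start at numbers at
most `t`, so closedness can meet `u` only as a target, where a smaller value does no harm. -/
theorem Tab.relax {A : Tab} {T₀ d x v : ℝ} {S : AddSubgroup ℝ} {t : ℕ}
    {E E' : ℕ → Fin 4 → Fin 4 → (Fin 4 → ℕ) → Prop} {a c : Fin 4} {s : Fin 4 → ℕ} {ok : Prop}
    (h : A.Sound I T₀ S d t) (hC : A.Closed I d E) (ht : t < I.states) (hf : 0 < A.flag t)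
    (he : Edge a c (A.pos · t) s) (hs : ∀ l, s l ≤ I.count l)
    (hx : x = I.fin a c (A.pos · t) (A.val t) s) (hv : v = I.pen a c (A.pos · t) (A.val t) s)
    (hxS : x ∈ S) (hok : ok ↔ v ≤ d)
    (hE : ∀ p a' c' s', Edge a' c' (A.pos · p) s' → E' p a' c' s' →
      E p a' c' s' ∨ p = t ∧ a' = a ∧ c' = c ∧ s' = s) (hEt : ∀ p a c s, E' p a c s → p ≤ t)
    {A' : Tab} (hA' : (ok ∧ (0 < A.flag (I.idx s) → x < A.val (I.idx s)) ∧
      A' = A.put (I.idx s) x s t) ∨ (¬ (ok ∧ (0 < A.flag (I.idx s) → x < A.val (I.idx s))) ∧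
      A' = A)) :
    A'.Sound I T₀ S d t ∧ A'.Closed I d E' ∧ A'.flag t = A.flag t ∧ A'.val t = A.val t ∧
      ∀ l, A'.pos l t = A.pos l t := by
  have hidx := idx_lt_states hs
  rcases hA' with ⟨hok', hlt, rfl⟩ | ⟨hno, rfl⟩
  -- The empty phase leads back to `t` but cannot improve its time, since a phase ends no earlier
  -- than it starts.
  · have htu : t < I.idx s := by
      rcases he.idx_lt_or_eq (I := I) with h1 | h1
      · exfalso
        subst h1
        rw [h.idx t ht hf] at hlt
        have := hlt hf
        rw [hx] at this
        exact absurd this (not_lt.2 (le_fin _ _ _ _ _))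
      · rwa [h.idx t ht hf] at h1
    set u := I.idx s with hu
    have hflag : ∀ w, 0 < A.flag w → 0 < (A.put u x s t).flag w := by
      intro w hw
      by_cases hwu : w = u
      · simp [Tab.put, hwu]
      · simpa [Tab.put, hwu] using hw
    have hval : ∀ w, w ≠ u → (A.put u x s t).val w = A.val w := fun w hw => by
      simp [Tab.put, hw]
    have hflag' : ∀ w, w ≠ u → (A.put u x s t).flag w = A.flag w := fun w hw => by
      simp [Tab.put, hw]
    have hpos : ∀ w, w ≠ u → ∀ l, (A.put u x s t).pos l w = A.pos l w := fun w hw l => by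
      simp [Tab.put, hw]
    have hpre : ∀ w, w ≠ u → (A.put u x s t).pre w = A.pre w := fun w hw => by
      simp [Tab.put, hw]
    have hu0 : (0 : ℕ) ≠ u := by omega
    have htne : t ≠ u := htu.ne
    refine ⟨⟨hflag _ h.zero_flag, (hval _ hu0).trans h.zero_val,
      fun l => (hpos _ hu0 l).trans (h.zero_pos l), ?_, ?_, ?_, ?_⟩, ?_, hflag' t htne,
      hval t htne, hpos t htne⟩
    · intro w hw hfw
      by_cases hwu : w = u
      · subst hwu
        simp [Tab.put, ← hu]
      · rw [hflag' w hwu] at hfw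
        simpa [hpos w hwu] using h.idx w hw hfw
    · intro w hw hfw l
      by_cases hwu : w = u
      · subst hwu
        simpa [Tab.put] using hs l
      · rw [hflag' w hwu] at hfw
        rw [hpos w hwu]
        exact h.le w hw hfw l
    · intro w hw hfw
      by_cases hwu : w = u
      · subst hwu
        simpa [Tab.put] using hxS
      · rw [hflag' w hwu] at hfw
        rw [hval w hwu]
        exact h.mem w hw hfw
    · intro w hw hfw hw0
      by_cases hwu : w = u
      · subst hwu
        have e1 : (A.put u x s t).pre u = t := by simp [Tab.put]
        have e2 : ∀ l, (A.put u x s t).pos l u = s l := by simp [Tab.put]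
        have e3 : (A.put u x s t).val u = x := by simp [Tab.put]
        rw [e1, e3, hflag' t htne, hval t htne]
        simp only [hpos t htne, e2]
        exact ⟨htu, le_rfl, hf, a, c, he, hx, by rw [← hv]; exact hok.1 hok'⟩
      · rw [hflag' w hwu] at hfw
        obtain ⟨h1, h2, h3, h4⟩ := h.pre w hw hfw hw0
        have hne : A.pre w ≠ u := by omega
        rw [hpre w hwu, hflag' _ hne, hval _ hne, hval w hwu]
        simp only [hpos _ hne, hpos w hwu]
        exact ⟨h1, h2, h3, h4⟩
    · have hnew : ∀ s', (0 < A.flag (I.idx s') ∨ I.idx s' = u) → ∀ y : ℝ,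
          (I.idx s' ≠ u → A.val (I.idx s') ≤ y) → (I.idx s' = u → x ≤ y) →
          0 < (A.put u x s t).flag (I.idx s') ∧ (A.put u x s t).val (I.idx s') ≤ y := by
        intro s' h1 y h2 h3
        by_cases hwu : I.idx s' = u
        · rw [hwu]
          simpa [Tab.put] using h3 hwu
        · have h1 := h1.resolve_right hwu
          rw [hflag' _ hwu, hval _ hwu]
          exact ⟨h1, h2 hwu⟩
      intro p hp hfp a' c' s' he' hs' hE'' hpen
      by_cases hpu : p = u
      · exfalso
        have := hEt _ _ _ _ hE''
        omega
      · rw [hflag' p hpu] at hfp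
        rw [hval p hpu] at hpen ⊢
        simp only [hpos p hpu] at hpen he' ⊢
        rcases hE p a' c' s' he' hE'' with h1 | ⟨rfl, rfl, rfl, rfl⟩
        · obtain ⟨h2, h3⟩ := hC p hp hfp a' c' s' he' hs' h1 hpen
          refine hnew s' (Or.inl h2) _ (fun _ => h3) fun h4 => ?_
          rw [h4] at h2 h3
          exact (hlt h2).le.trans h3
        · exact hnew s' (Or.inr rfl) _ (fun h4 => absurd rfl h4) fun _ => hx.le
  · refine ⟨h, ?_, rfl, rfl, fun _ => rfl⟩
    intro p hp hfp a' c' s' he' hs' hE' hpen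
    rcases hE p a' c' s' he' hE' with h1 | ⟨rfl, rfl, rfl, rfl⟩
    · exact hC p hp hfp a' c' s' he' hs' h1 hpen
    · have h2 : ok := hok.2 (hv ▸ hpen)
      simp only [h2, true_and, Classical.not_imp, not_lt] at hno
      exact ⟨hno.1, hx ▸ hno.2⟩

/-! ### An a priori feasible delay bound -/

/-- A bound for the absolute values of all times. -/
noncomputable def total (I : Crossing) : ℝ :=
  ∑ l, ∑ i ∈ Finset.range (I.count l), (I.ln l i + |I.rel l i|)

theorem total_eq (I : Crossing) : I.total = ∑ p, (I.len p + |I.release p|) := by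
  rw [total, Fintype.sum_sigma]
  refine Finset.sum_congr rfl fun l _ => ?_
  rw [Finset.sum_range]
  simp [I.rel_eq, I.ln_eq]

theorem abs_release_le_total (p : I.Plat) : |I.release p| ≤ I.total := by
  rw [total_eq]
  refine le_trans ?_ (Finset.single_le_sum (f := fun p => I.len p + |I.release p|)
    (fun p _ => add_nonneg (I.len_pos p).le (abs_nonneg _)) (Finset.mem_univ p))
  have := I.len_pos p
  linarith

theorem total_mem {S : AddSubgroup ℝ} (hr : ∀ l i, I.rel l i ∈ S) (hl : ∀ l i, I.ln l i ∈ S) :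
    I.total ∈ S := by
  refine S.sum_mem fun l _ => S.sum_mem fun i _ => S.add_mem (hl l i) ?_
  rcases abs_choice (I.rel l i) with h | h <;> rw [h]
  exacts [hr l i, S.neg_mem (hr l i)]

/-- Wait until all releases have passed, then serve the platoons one at a time, lane after lane. The
start of a platoon is at most `R` plus the sum of the lengths, which is `total`; subtracting a
release time costs at most another `total`. -/
theorem feas_total (I : Crossing) : I.Feas (I.total + I.total) := by
  classical
  let key : I.Plat → Fin 4 ×ₗ ℕ := fun p => toLex (p.1, (p.2 : ℕ))
  let before : I.Plat → Finset I.Plat := fun p => Finset.univ.filter (key · < key p)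
  let R : ℝ := ∑ p, |I.release p|
  let c : I.Schedule := fun p => R + ∑ q ∈ before p, I.len q
  have hlt : ∀ p q, key p < key q → c p + I.len p ≤ c q := by
    intro p q hpq
    have h1 : p ∉ before p := by simp [before]
    have h2 : insert p (before p) ⊆ before q := by
      intro r hr
      rcases Finset.mem_insert.1 hr with rfl | hr
      · simpa [before] using hpq
      · simp only [before, Finset.mem_filter, Finset.mem_univ, true_and] at hr ⊢
        exact hr.trans hpq
    have h3 := Finset.sum_le_sum_of_subset_of_nonneg h2 (f := I.len)
      fun r _ _ => (I.len_pos r).le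
    rw [Finset.sum_insert h1] at h3
    simp only [c]
    linarith
  have hR : ∀ p, |I.release p| ≤ R := fun p =>
    Finset.single_le_sum (f := fun p => |I.release p|) (fun _ _ => abs_nonneg _) (Finset.mem_univ p)
  refine ⟨c, ⟨fun p => ?_, fun l i j hij => ?_, fun p q hpq => ?_⟩, fun p => ?_⟩
  · have h1 : 0 ≤ ∑ q ∈ before p, I.len q := Finset.sum_nonneg fun q _ => (I.len_pos q).le
    have h2 := hR p
    have h3 := le_abs_self (I.release p)
    simp only [c]
    linarith
  · refine hlt _ _ ?_
    rw [Prod.Lex.toLex_lt_toLex]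
    exact Or.inr ⟨rfl, hij⟩
  · have hne : key p ≠ key q := by
      intro h
      have : p.1 = q.1 := congrArg (fun x => (ofLex x).1) h
      exact hpq (by rw [this])
    rw [Set.disjoint_left]
    rintro x ⟨h1, h2⟩ ⟨h3, h4⟩
    rcases lt_or_gt_of_ne hne with h | h
    · have := hlt _ _ h
      linarith
    · have := hlt _ _ h
      linarith
  · have h1 : ∑ q ∈ before p, I.len q ≤ ∑ q, I.len q :=
      Finset.sum_le_univ_sum_of_nonneg fun q => (I.len_pos q).le
    have h2 : I.total = ∑ q, I.len q + R := by rw [total_eq, Finset.sum_add_distrib]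
    have h3 := abs_release_le_total p
    have h4 := neg_abs_le (I.release p)
    simp only [c]
    linarith

end Crossing
end Platoon

/-! ### A program logic with step bounds -/

namespace Platoon

/-- Started on `s`, the program `P` halts within `k` steps on a memory that satisfies `Q`. -/
def Ends (P : Prog) (s : Memory) (k : ℕ) (Q : Memory → Prop) : Prop :=
  ∃ s' t, Runs P s s' t ∧ t ≤ k ∧ Q s'

theorem Ends.imp {P : Prog} {s : Memory} {k k' : ℕ} {Q Q' : Memory → Prop} (h : Ends P s k Q)
    (hk : k ≤ k') (hQ : ∀ s', Q s' → Q' s') : Ends P s k' Q' := by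
  obtain ⟨s', t, h1, h2, h3⟩ := h
  exact ⟨s', t, h1, h2.trans hk, hQ s' h3⟩

theorem Ends.seq {P P' : Prog} {s : Memory} {k k' : ℕ} {Q Q' : Memory → Prop}
    (h : Ends P s k Q) (h' : ∀ s', Q s' → Ends P' s' k' Q') : Ends (.seq P P') s (k + k') Q' := by
  obtain ⟨s', t, h1, h2, h3⟩ := h
  obtain ⟨s'', t', h4, h5, h6⟩ := h' s' h3
  exact ⟨s'', t + t', .seq h1 h4, add_le_add h2 h5, h6⟩

theorem Ends.branch {b : BExp} {P P' : Prog} {s : Memory} {k : ℕ} {Q : Memory → Prop}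
    (h : b.eval s → Ends P s k Q) (h' : ¬ b.eval s → Ends P' s k Q) :
    Ends (.branch b P P') s (b.cost + k + 1) Q := by
  by_cases hb : b.eval s
  · obtain ⟨s', t, h1, h2, h3⟩ := h hb
    exact ⟨s', _, .branch_true hb h1, by omega, h3⟩
  · obtain ⟨s', t, h1, h2, h3⟩ := h' hb
    exact ⟨s', _, .branch_false hb h1, by omega, h3⟩

/-- Total correctness with a measure: each round decreases `μ`, so the initial value of `μ` bounds
the number of rounds. -/
theorem Ends.loop {b : BExp} {P : Prog} (Inv : Memory → Prop) (μ : Memory → ℕ) {k : ℕ}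
    (h : ∀ s, Inv s → b.eval s → Ends P s k (fun s' => Inv s' ∧ μ s' < μ s)) {s : Memory}
    (hs : Inv s) :
    Ends (.loop b P) s (μ s * (k + b.cost + 1) + b.cost + 1)
      (fun s' => Inv s' ∧ ¬ b.eval s') := by
  induction hn : μ s using Nat.strong_induction_on generalizing s with
  | _ n ih =>
    subst hn
    by_cases hb : b.eval s
    · obtain ⟨s', t, h1, h2, h3, h4⟩ := h s hs hb
      obtain ⟨s'', t', h5, h6, h7⟩ := ih _ h4 h3 rfl
      refine ⟨s'', _, .loop_step hb h1 h5, ?_, h7⟩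
      have h8 : (μ s' + 1) * (k + b.cost + 1) ≤ μ s * (k + b.cost + 1) :=
        Nat.mul_le_mul_right _ h4
      rw [add_mul] at h8
      omega
    · exact ⟨s, _, .loop_done hb, by omega, hs, hb⟩

/-- The program contains no loop. -/
def Prog.Straight : Prog → Prop
  | .skip => True
  | .nset _ _ _ => True
  | .rset _ _ _ => True
  | .seq P Q => P.Straight ∧ Q.Straight
  | .branch _ P Q => P.Straight ∧ Q.Straight
  | .loop _ _ => False

/-- The effect of a program without loops. -/
noncomputable def Prog.exec : Prog → Memory → Memory
  | .skip, s => s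
  | .nset a i e, s => s.setNat a (i.eval s) (e.eval s)
  | .rset a i e, s => s.setReal a (i.eval s) (e.eval s)
  | .seq P Q, s => Q.exec (P.exec s)
  | .branch b P Q, s => open Classical in if b.eval s then P.exec s else Q.exec s
  | .loop _ _, s => s

/-- A bound for the number of steps of a program without loops. -/
def Prog.cost : Prog → ℕ
  | .skip => 1
  | .nset _ i e => i.cost + e.cost + 1
  | .rset _ i e => i.cost + e.cost + 1
  | .seq P Q => P.cost + Q.cost
  | .branch b P Q => b.cost + (P.cost + Q.cost) + 1
  | .loop _ _ => 0

theorem Prog.Straight.runs {P : Prog} (h : P.Straight) (s : Memory) :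
    ∃ t ≤ P.cost, Runs P s (P.exec s) t := by
  induction P generalizing s with
  | skip => exact ⟨_, le_rfl, .skip s⟩
  | nset a i e => exact ⟨_, le_rfl, .nset s a i e⟩
  | rset a i e => exact ⟨_, le_rfl, .rset s a i e⟩
  | seq P Q ihP ihQ =>
    obtain ⟨t, h1, h2⟩ := ihP h.1 s
    obtain ⟨t', h3, h4⟩ := ihQ h.2 (P.exec s)
    exact ⟨_, add_le_add h1 h3, .seq h2 h4⟩
  | branch b P Q ihP ihQ =>
    by_cases hb : b.eval s
    · obtain ⟨t, h1, h2⟩ := ihP h.1 s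
      refine ⟨_, ?_, by simpa [Prog.exec, hb] using Runs.branch_true (Q := Q) hb h2⟩
      simp only [Prog.cost]
      omega
    · obtain ⟨t, h1, h2⟩ := ihQ h.2 s
      refine ⟨_, ?_, by simpa [Prog.exec, hb] using Runs.branch_false (P := P) hb h2⟩
      simp only [Prog.cost]
      omega
  | loop => exact h.elim

/-- Loop-free code is verified by computing `exec` symbolically; its cost is a closed numeral, so
the time bound can be checked by evaluation. -/
theorem Prog.Straight.ends {P : Prog} (h : P.Straight) {s : Memory} {k : ℕ} {Q : Memory → Prop}
    (hk : P.cost ≤ k) (hQ : Q (P.exec s)) : Ends P s k Q := by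
  obtain ⟨t, h1, h2⟩ := h.runs s
  exact ⟨_, t, h2, h1.trans hk, hQ⟩

/-- The program may write to natural-number array `a`. -/
def Prog.WritesNat (a : ℕ) : Prog → Prop
  | .skip => False
  | .nset a' _ _ => a = a'
  | .rset _ _ _ => False
  | .seq P Q => P.WritesNat a ∨ Q.WritesNat a
  | .branch _ P Q => P.WritesNat a ∨ Q.WritesNat a
  | .loop _ P => P.WritesNat a

/-- The program may write to real array `a`. -/
def Prog.WritesReal (a : ℕ) : Prog → Prop
  | .skip => False
  | .nset _ _ _ => False
  | .rset a' _ _ => a = a'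
  | .seq P Q => P.WritesReal a ∨ Q.WritesReal a
  | .branch _ P Q => P.WritesReal a ∨ Q.WritesReal a
  | .loop _ P => P.WritesReal a

theorem Runs.nat_eq {P : Prog} {s s' : Memory} {t : ℕ} (h : Runs P s s' t) {a : ℕ}
    (ha : ¬ P.WritesNat a) : s'.nat a = s.nat a := by
  induction h <;> simp_all [Prog.WritesNat, Memory.setNat, Memory.setReal]

theorem Runs.real_eq {P : Prog} {s s' : Memory} {t : ℕ} (h : Runs P s s' t) {a : ℕ}
    (ha : ¬ P.WritesReal a) : s'.real a = s.real a := by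
  induction h <;> simp_all [Prog.WritesReal, Memory.setNat, Memory.setReal]

/-- `s'` agrees with `s` except in arrays to which `P` writes. -/
def Frame (P : Prog) (s s' : Memory) : Prop :=
  (∀ a, ¬ P.WritesNat a → s'.nat a = s.nat a) ∧ (∀ a, ¬ P.WritesReal a → s'.real a = s.real a)

/-- What a program leaves alone is read off its syntax, so specifications need to mention only the
cells that change. -/
theorem Ends.frame {P : Prog} {s : Memory} {k : ℕ} {Q : Memory → Prop} (h : Ends P s k Q) :
    Ends P s k (fun s' => Q s' ∧ Frame P s s') := by
  obtain ⟨s', t, h1, h2, h3⟩ := h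
  exact ⟨s', t, h1, h2, h3, fun _ => h1.nat_eq, fun _ => h1.real_eq⟩

theorem Memory.setNat_nat (s : Memory) (a i v : ℕ) :
    (s.setNat a i v).nat = Function.update s.nat a (Function.update (s.nat a) i v) := rfl

theorem Memory.setNat_real (s : Memory) (a i v : ℕ) : (s.setNat a i v).real = s.real := rfl

theorem Memory.setReal_nat (s : Memory) (a i : ℕ) (v : ℝ) : (s.setReal a i v).nat = s.nat := rfl

theorem Memory.setReal_real (s : Memory) (a i : ℕ) (v : ℝ) :
    (s.setReal a i v).real = Function.update s.real a (Function.update (s.real a) i v) := rfl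

/-- Sequential composition of a list of programs. -/
def Prog.block : List Prog → Prog
  | [] => .skip
  | P :: l => .seq P (Prog.block l)

/-- The content of a variable: cell `0` of an array. -/
abbrev NExp.var (a : ℕ) : NExp := .get a (.lit 0)

/-- The content of a variable: cell `0` of an array. -/
abbrev RExp.var (a : ℕ) : RExp := .get a (.lit 0)

/-- Assignment to a variable. -/
abbrev Prog.nvar (a : ℕ) (e : NExp) : Prog := .nset a (.lit 0) e

/-- Assignment to a variable. -/
abbrev Prog.rvar (a : ℕ) (e : RExp) : Prog := .rset a (.lit 0) e

end Platoon

/-! ### Memory layout and the code for one phase -/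

namespace Platoon

open Crossing

/-- The input and the constants computed from it, as they are stored during the whole computation:
the tables `20 + l` contain the multiples of the powers of the radix. -/
structure Glob (I : Crossing) (T₀ : ℝ) (m : Memory) : Prop where
  count : ∀ l : Fin 4, m.nat 0 l = I.count l
  rel : ∀ l : Fin 4, m.real l = I.rel l
  ln : ∀ l : Fin 4, m.real (4 + l) = I.ln l
  pow : ∀ l : Fin 4, ∀ i < I.radix, m.nat (20 + l) i = i * I.radix ^ (l : ℕ)
  states : m.nat 26 0 = I.states
  final : m.nat 27 0 = I.idx I.count
  start : m.real 9 0 = T₀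

theorem Glob.congr {I : Crossing} {T₀ : ℝ} {m m' : Memory} (h : Glob I T₀ m)
    (hn : ∀ a < 28, m'.nat a = m.nat a) (hr : ∀ a < 10, a ≠ 8 → m'.real a = m.real a) :
    Glob I T₀ m' := by
  constructor
  · intro l
    rw [hn 0 (by omega), h.count]
  · intro l
    rw [hr l (by omega) (by omega), h.rel]
  · intro l
    rw [hr (4 + l) (by omega) (by omega), h.ln]
  · intro l i hi
    rw [hn (20 + l) (by omega), h.pow l i hi]
  · rw [hn 26 (by omega), h.states]
  · rw [hn 27 (by omega), h.final]
  · rw [hr 9 (by omega) (by omega), h.start]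

/-- The table stored in the arrays from `b` on. -/
def tab (b : ℕ) (m : Memory) : Tab where
  flag := m.nat b
  val := m.real b
  pos l := m.nat (b + 2 + l)
  pre := m.nat (b + 1)

/-- What is required of the program that compares a delay, stored in variable `b + 6`, with the
unknown delay bound and stores the result in variable `b + 12`. Here `D` is the set of the delay
bounds that are still possible. -/
structure TestSpec (I : Crossing) (T₀ : ℝ) (S : AddSubgroup ℝ) (b : ℕ) (test : Prog) (τ : ℕ)
    (J : Memory → Prop) (D : Memory → Set ℝ) : Prop where
  base : 100 ≤ b
  nonempty : ∀ m, J m → (D m).Nonempty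
  congr : ∀ m m', (∀ a < 100, m'.nat a = m.nat a) → (∀ a < 100, m'.real a = m.real a) → J m →
    J m' ∧ D m' = D m
  writesNat : ∀ a, test.WritesNat a → a = b + 12 ∨ (28 ≤ a ∧ a < b)
  writesReal : ∀ a, test.WritesReal a → a = 8 ∨ (10 ≤ a ∧ a < b)
  ends : ∀ m, Glob I T₀ m → J m → m.real (b + 6) 0 ∈ S → Ends test m τ fun m' =>
    J m' ∧ D m' ⊆ D m ∧ ∀ d ∈ D m', (0 < m'.nat (b + 12) 0 ↔ m.real (b + 6) 0 ≤ d)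
  mem_rel : ∀ l i, I.rel l i ∈ S
  mem_ln : ∀ l i, I.ln l i ∈ S

/-- Compute finish time, delay and number of the prefix reached by the current phase. -/
def relaxHead (b : ℕ) : Prog := .block [
  .rvar (b + 5) (.var (b + 1)),
  .branch (.rle (.var (b + 1)) (.var (b + 2))) (.rvar (b + 5) (.var (b + 2))) .skip,
  .rvar (b + 6) (.var (b + 3)),
  .branch (.rle (.var (b + 3)) (.var (b + 4))) (.rvar (b + 6) (.var (b + 4))) .skip,
  .nvar (b + 11) (.add (.add (.add (.get 20 (.var (b + 6))) (.get 21 (.var (b + 7))))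
    (.get 22 (.var (b + 8)))) (.get 23 (.var (b + 9))))]

/-- Update the table. -/
def relaxTail (b : ℕ) : Prog :=
  .branch (.and (.nle (.lit 1) (.var (b + 12))) (.neg (.and
    (.nle (.lit 1) (.get b (.var (b + 11)))) (.rle (.get b (.var (b + 11))) (.var (b + 5))))))
  (.block [
    .nset b (.var (b + 11)) (.lit 1),
    .rset b (.var (b + 11)) (.var (b + 5)),
    .nset (b + 1) (.var (b + 11)) (.var (b + 10)),
    .nset (b + 2) (.var (b + 11)) (.var (b + 6)),
    .nset (b + 3) (.var (b + 11)) (.var (b + 7)),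
    .nset (b + 4) (.var (b + 11)) (.var (b + 8)),
    .nset (b + 5) (.var (b + 11)) (.var (b + 9))]) .skip

/-- Take account of the current phase. -/
def relax (b : ℕ) (test : Prog) : Prog := .seq (relaxHead b) (.seq test (relaxTail b))

theorem relaxHead_ends {b : ℕ} (m : Memory) : Ends (relaxHead b) m 60 fun m' =>
    (m'.real (b + 5) 0 = max (m.real (b + 1) 0) (m.real (b + 2) 0) ∧
    m'.real (b + 6) 0 = max (m.real (b + 3) 0) (m.real (b + 4) 0) ∧
    m'.nat (b + 11) 0 = m.nat 20 (m.nat (b + 6) 0) + m.nat 21 (m.nat (b + 7) 0) +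
      m.nat 22 (m.nat (b + 8) 0) + m.nat 23 (m.nat (b + 9) 0)) ∧ Frame (relaxHead b) m m' := by
  refine Ends.frame (Prog.Straight.ends (by simp [relaxHead, Prog.block, Prog.Straight])
    (Nat.le_of_ble_eq_true rfl) ?_)
  by_cases h1 : m.real (b + 1) 0 ≤ m.real (b + 2) 0 <;>
  by_cases h2 : m.real (b + 3) 0 ≤ m.real (b + 4) 0 <;>
  simp [relaxHead, Prog.block, Prog.exec, NExp.eval, RExp.eval, BExp.eval, Memory.setNat_nat,
    Memory.setNat_real, Memory.setReal_nat, Memory.setReal_real, h1, h2,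
    le_of_not_ge]

theorem relaxTail_ends {b : ℕ} (m : Memory) (s : Fin 4 → ℕ)
    (hs : ∀ l : Fin 4, m.nat (b + 6 + l) 0 = s l) : Ends (relaxTail b) m 60 fun m' =>
    ((0 < m.nat (b + 12) 0 ∧ (0 < (tab b m).flag (m.nat (b + 11) 0) →
      m.real (b + 5) 0 < (tab b m).val (m.nat (b + 11) 0)) ∧
      tab b m' = (tab b m).put (m.nat (b + 11) 0) (m.real (b + 5) 0) s (m.nat (b + 10) 0)) ∨
    (¬ (0 < m.nat (b + 12) 0 ∧ (0 < (tab b m).flag (m.nat (b + 11) 0) →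
      m.real (b + 5) 0 < (tab b m).val (m.nat (b + 11) 0))) ∧ tab b m' = tab b m)) ∧
    Frame (relaxTail b) m m' := by
  refine Ends.frame (Ends.imp (Ends.branch (k := 40) (fun h => ?_) (fun h => ?_))
    (Nat.le_of_ble_eq_true rfl) fun _ h => h)
  · refine Prog.Straight.ends (by simp [Prog.block, Prog.Straight]) (Nat.le_of_ble_eq_true rfl)
      (Or.inl ⟨h.1, fun h1 => not_le.1 fun h2 => h.2 ⟨h1, h2⟩, ?_⟩)
    simp only [tab, Tab.put, Prog.block, Prog.exec, NExp.eval, RExp.eval, Memory.setNat_nat,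
      Memory.setNat_real, Memory.setReal_nat, Memory.setReal_real]
    congr 1
    · simp
    · simp
    · funext l
      rw [← hs l]
      fin_cases l <;> simp
    · simp
  · refine Prog.Straight.ends (P := .skip) trivial (Nat.le_of_ble_eq_true rfl)
      (Or.inr ⟨fun h1 => h ⟨h1.1, fun h2 => not_le.2 (h1.2 h2.1) h2.2⟩, rfl⟩)

end Platoon

/-! ### The program for one phase preserves the invariant -/

namespace Platoon

open Crossing

section

variable {I : Crossing} {T₀ : ℝ} {S : AddSubgroup ℝ} {b : ℕ} {test : Prog} {τ : ℕ}
  {J : Memory → Prop} {D : Memory → Set ℝ}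

/-- Invariant of the dynamic program while the phases that start from prefix number `t` are
considered; `p` and `T` are this prefix and its finish time. -/
structure Core (I : Crossing) (T₀ : ℝ) (S : AddSubgroup ℝ) (b : ℕ) (J : Memory → Prop)
    (D : Memory → Set ℝ) (t : ℕ) (p : Fin 4 → ℕ) (T : ℝ)
    (E : ℕ → Fin 4 → Fin 4 → (Fin 4 → ℕ) → Prop) (m : Memory) : Prop where
  glob : Glob I T₀ m
  amb : J m
  cur : m.nat (b + 10) 0 = t
  lt : t < I.states
  flag : 0 < (tab b m).flag t
  pos : ∀ l, (tab b m).pos l t = p l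
  val : (tab b m).val t = T
  inv : ∀ d ∈ D m, (tab b m).Sound I T₀ S d t ∧ (tab b m).Closed I d E

theorem tab_congr {m m' : Memory} (hn : ∀ a, b ≤ a → a < b + 6 → m'.nat a = m.nat a)
    (hr : m'.real b = m.real b) : tab b m' = tab b m := by
  simp only [tab, hr, hn b le_rfl (by omega), hn (b + 1) (by omega) (by omega)]
  congr 1
  funext l
  exact hn _ (by omega) (by omega)

theorem Core.congr (hT : TestSpec I T₀ S b test τ J D) {t : ℕ} {p : Fin 4 → ℕ} {T : ℝ}
    {E : ℕ → Fin 4 → Fin 4 → (Fin 4 → ℕ) → Prop} {m m' : Memory}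
    (h : Core I T₀ S b J D t p T E m)
    (hn : ∀ a, a < 100 ∨ (b ≤ a ∧ a < b + 6) ∨ a = b + 10 → m'.nat a = m.nat a)
    (hr : ∀ a, a < 100 ∨ a = b → m'.real a = m.real a) : Core I T₀ S b J D t p T E m' := by
  have ht : tab b m' = tab b m := tab_congr (fun a h1 h2 => hn a (by omega)) (hr b (by omega))
  have hJ := hT.congr m m' (fun a ha => hn a (by omega)) (fun a ha => hr a (by omega)) h.amb
  refine ⟨h.glob.congr (fun a ha => hn a (by omega)) (fun a ha _ => hr a (by omega)), hJ.1,
    by rw [hn _ (by omega), h.cur], h.lt, ?_, ?_, ?_, ?_⟩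
  · rw [ht]; exact h.flag
  · rw [ht]; exact h.pos
  · rw [ht]; exact h.val
  · rw [ht, hJ.2]; exact h.inv

/-- The set `E` of phases considered may be exchanged for any other that agrees on genuine phases
from recorded prefixes. This turns the bookkeeping of the loops into case distinctions on positions.
-/
theorem Core.mono {t : ℕ} {p : Fin 4 → ℕ} {T : ℝ}
    {E E' : ℕ → Fin 4 → Fin 4 → (Fin 4 → ℕ) → Prop} {m : Memory}
    (h : Core I T₀ S b J D t p T E m)
    (hE : ∀ q a c s, Edge a c ((tab b m).pos · q) s → (∀ l, s l ≤ I.count l) → E' q a c s →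
      E q a c s) : Core I T₀ S b J D t p T E' m :=
  ⟨h.glob, h.amb, h.cur, h.lt, h.flag, h.pos, h.val, fun d hd => ⟨(h.inv d hd).1,
    (h.inv d hd).2.mono fun q _ _ a c s he hs => hE q a c s he hs⟩⟩

theorem relax_writesNat (hT : TestSpec I T₀ S b test τ J D) {a : ℕ}
    (h : (relax b test).WritesNat a) : (28 ≤ a ∧ a < b + 6) ∨ a = b + 11 ∨ a = b + 12 := by
  have h1 := hT.writesNat a
  have h2 := hT.base
  by_cases ht : test.WritesNat a
  · have := h1 ht
    omega
  · simp only [relax, relaxHead, relaxTail, Prog.block, Prog.WritesNat, ht, or_false, false_or] at h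
    omega

theorem relax_writesReal (hT : TestSpec I T₀ S b test τ J D) {a : ℕ}
    (h : (relax b test).WritesReal a) : a = 8 ∨ (10 ≤ a ∧ a ≤ b) ∨ a = b + 5 ∨ a = b + 6 := by
  have h1 := hT.writesReal a
  have h2 := hT.base
  by_cases ht : test.WritesReal a
  · have := h1 ht
    omega
  · simp only [relax, relaxHead, relaxTail, Prog.block, Prog.WritesReal, ht, or_false, false_or] at h
    omega

/-- The code is matched with `Tab.relax` for all bounds still possible after the test. The test may
shrink this set, but on what is left its answer does not depend on the bound, so one table serves
all of them. -/
theorem relax_ends (hT : TestSpec I T₀ S b test τ J D) {t : ℕ} {p s : Fin 4 → ℕ} {T : ℝ}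
    {E : ℕ → Fin 4 → Fin 4 → (Fin 4 → ℕ) → Prop} {m : Memory} {a c : Fin 4}
    (h : Core I T₀ S b J D t p T E m) (hE : ∀ q a c s, E q a c s → q ≤ t)
    (he : Edge a c p s) (hs : ∀ l, s l ≤ I.count l)
    (hy : ∀ l : Fin 4, m.nat (b + 6 + l) 0 = s l)
    (h1 : m.real (b + 1) 0 = I.chain a T (p a) (s a))
    (h2 : m.real (b + 2) 0 = I.chain c T (p c) (s c))
    (h3 : m.real (b + 3) 0 = I.lag a T (p a) (s a))
    (h4 : m.real (b + 4) 0 = I.lag c T (p c) (s c)) :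
    Ends (relax b test) m (120 + τ) fun m' =>
      Core I T₀ S b J D t p T
        (fun q a' c' s' => E q a' c' s' ∨ (q = t ∧ a' = a ∧ c' = c ∧ s' = s)) m' ∧
      Frame (relax b test) m m' := by
  have hb := hT.base
  -- Facts that do not mention the bound are taken from any one of the possible bounds; this is why
  -- `TestSpec` demands that some bound remain.
  obtain ⟨d₀, hd₀⟩ := hT.nonempty m h.amb
  have hTS : T ∈ S := by
    have := (h.inv d₀ hd₀).1.mem t h.lt h.flag
    rwa [h.val] at this
  refine Ends.frame (Ends.imp (Ends.seq (relaxHead_ends m) fun m₁ hm₁ => Ends.seq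
    (k := τ) (k' := 60) (Q := fun m₂ => (J m₂ ∧ D m₂ ⊆ D m₁ ∧ ∀ d ∈ D m₂,
      (0 < m₂.nat (b + 12) 0 ↔ m₁.real (b + 6) 0 ≤ d)) ∧ Frame test m₁ m₂)
    ?_ fun m₂ hm₂ => Ends.imp (relaxTail_ends m₂ s ?_) le_rfl ?_) (by omega) fun _ h => h)
  all_goals
    obtain ⟨⟨hf, hv, hi⟩, hfn, hfr⟩ := hm₁
    have en : ∀ a, a ≠ b + 11 → m₁.nat a = m.nat a := fun a ha => hfn a (by
      simp [relaxHead, Prog.block, Prog.WritesNat]; omega)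
    have er : ∀ a, a ≠ b + 5 → a ≠ b + 6 → m₁.real a = m.real a := fun a ha ha' => hfr a (by
      simp [relaxHead, Prog.block, Prog.WritesReal]; omega)
    have hc₁ : Core I T₀ S b J D t p T E m₁ :=
      h.congr hT (fun a _ => en a (by omega)) (fun a _ => er a (by omega) (by omega))
    have hv' : m₁.real (b + 6) 0 = I.pen a c p T s := by rw [hv, h3, h4, pen]
    have hf' : m₁.real (b + 5) 0 = I.fin a c p T s := by rw [hf, h1, h2, fin]
    have hfS : I.fin a c p T s ∈ S := by
      unfold fin
      rcases max_choice (I.chain a T (p a) (s a)) (I.chain c T (p c) (s c)) with h | h <;> rw [h]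
      exacts [chain_mem hT.mem_rel hT.mem_ln hTS _ _, chain_mem hT.mem_rel hT.mem_ln hTS _ _]
    have hvS : I.pen a c p T s ∈ S := by
      unfold pen
      rcases max_choice (I.lag a T (p a) (s a)) (I.lag c T (p c) (s c)) with h | h <;> rw [h]
      exacts [lag_mem hT.mem_rel hT.mem_ln hTS _ _, lag_mem hT.mem_rel hT.mem_ln hTS _ _]
  · exact Ends.frame (hT.ends m₁ hc₁.glob hc₁.amb (hv' ▸ hvS))
  all_goals
    obtain ⟨⟨hJ, hD, hok⟩, hgn, hgr⟩ := hm₂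
    have en₂ : ∀ a, (a < 28 ∨ b ≤ a) → a ≠ b + 12 → m₂.nat a = m₁.nat a := fun a h1 h2 =>
      hgn a fun h3 => by
        have := hT.writesNat a h3
        omega
    have er₂ : ∀ a, ((a < 10 ∧ a ≠ 8) ∨ b ≤ a) → m₂.real a = m₁.real a := fun a h1 =>
      hgr a fun h3 => by
        have := hT.writesReal a h3
        omega
  · intro l
    rw [en₂ _ (by omega) (by omega), en _ (by omega), hy]
  · rintro m' ⟨hput, hkn, hkr⟩
    have en₃ : ∀ a, (a < b ∨ b + 6 ≤ a) → m'.nat a = m₂.nat a := fun a h1 => hkn a (by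
      simp [relaxTail, Prog.block, Prog.WritesNat]; omega)
    have er₃ : ∀ a, a ≠ b → m'.real a = m₂.real a := fun a h1 => hkr a (by
      simp [relaxTail, Prog.block, Prog.WritesReal]; omega)
    have hJ' := hT.congr m₂ m' (fun a ha => en₃ a (by omega)) (fun a ha => er₃ a (by omega)) hJ
    have htab : tab b m₂ = tab b m₁ :=
      tab_congr (fun a h1 h2 => en₂ a (by omega) (by omega)) (er₂ b (by omega))
    have hidx : m₂.nat (b + 11) 0 = I.idx s := by
      have hw : ∀ l : Fin 4, m.nat (20 + l) (m.nat (b + 6 + l) 0) =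
          s l * I.radix ^ (l : ℕ) := fun l => by
        rw [hy l]
        exact h.glob.pow l _ ((hs l).trans_lt (count_lt_radix l))
      have e0 : m.nat 20 (m.nat (b + 6) 0) = _ := hw 0
      have e1 : m.nat 21 (m.nat (b + 7) 0) = _ := hw 1
      have e2 : m.nat 22 (m.nat (b + 8) 0) = _ := hw 2
      have e3 : m.nat 23 (m.nat (b + 9) 0) = _ := hw 3
      rw [en₂ _ (by omega) (by omega), hi, idx, Fin.sum_univ_four, e0, e1, e2, e3]
    rw [hidx, htab, er₂ (b + 5) (by omega), hf', en₂ (b + 10) (by omega) (by omega), hc₁.cur]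
      at hput
    have hpos : ((tab b m₁).pos · t) = p := funext hc₁.pos
    have hstep : ∀ d ∈ D m', _ := fun d hd =>
      Tab.relax (E' := fun q a' c' s' => E q a' c' s' ∨ (q = t ∧ a' = a ∧ c' = c ∧ s' = s))
        (v := I.pen a c p T s) (A' := tab b m') (ok := 0 < m₂.nat (b + 12) 0)
        (hc₁.inv d (hD (hJ'.2 ▸ hd))).1 (hc₁.inv d (hD (hJ'.2 ▸ hd))).2 h.lt hc₁.flag
        (by rw [hpos]; exact he) hs (by rw [hpos, hc₁.val]) (by rw [hpos, hc₁.val]) hfS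
        (by rw [hok d (hJ'.2 ▸ hd), hv']) (fun q a' c' s' _ h => h)
        (by
          rintro q a' c' s' (h | h)
          exacts [hE _ _ _ _ h, h.1.le]) hput
    obtain ⟨d₁, hd₁⟩ := hT.nonempty m' hJ'.1
    obtain ⟨-, -, k1, k2, k3⟩ := hstep d₁ hd₁
    refine ⟨?_, hJ'.1, ?_, h.lt, ?_, ?_, ?_, fun d hd => ⟨(hstep d hd).1, (hstep d hd).2.1⟩⟩
    · refine hc₁.glob.congr (fun a ha => ?_) (fun a ha ha' => ?_)
      · rw [en₃ _ (by omega), en₂ _ (by omega) (by omega)]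
      · rw [er₃ _ (by omega), er₂ _ (by omega)]
    · rw [en₃ _ (by omega), en₂ _ (by omega) (by omega), hc₁.cur]
    · rw [k1]; exact hc₁.flag
    · intro l
      rw [k3, hc₁.pos]
    · rw [k2, hc₁.val]

end

end Platoon

/-! ### Enumerating the phases of a road: the inner loop -/

namespace Platoon

open Crossing

/-- Serve the next platoon of lane `a`: update the finish time in variable `u`, the delay in
variable `w` and the position. -/
def advance (b a u w : ℕ) : Prog := .block [
  .branch (.rle (.var u) (.get a (.var (b + 6 + a)))) (.rvar u (.get a (.var (b + 6 + a)))) .skip,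
  .branch (.rle (.var w) (.sub (.var u) (.get a (.var (b + 6 + a)))))
    (.rvar w (.sub (.var u) (.get a (.var (b + 6 + a))))) .skip,
  .rvar u (.add (.var u) (.get (4 + a) (.var (b + 6 + a)))),
  .nvar (b + 6 + a) (.add (.var (b + 6 + a)) (.lit 1))]

theorem advance_ends {b a u w : ℕ} (ha : a < 100) (h4 : 4 + a < 100) (hu : 100 ≤ u)
    (hw : 100 ≤ w) (huw : u ≠ w) (m : Memory) : Ends (advance b a u w) m 60 fun m' =>
    (m'.real u 0 = max (m.real a (m.nat (b + 6 + a) 0)) (m.real u 0) +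
      m.real (4 + a) (m.nat (b + 6 + a) 0) ∧
    m'.real w 0 = max (m.real w 0) (max (m.real a (m.nat (b + 6 + a) 0)) (m.real u 0) -
      m.real a (m.nat (b + 6 + a) 0)) ∧
    m'.nat (b + 6 + a) 0 = m.nat (b + 6 + a) 0 + 1) ∧ Frame (advance b a u w) m m' := by
  refine Ends.frame (Prog.Straight.ends (by simp [advance, Prog.block, Prog.Straight])
    (Nat.le_of_ble_eq_true rfl) ?_)
  have e1 : a ≠ u := by omega
  have e2 : 4 + a ≠ u := by omega
  have e3 : a ≠ w := by omega
  have e4 : 4 + a ≠ w := by omega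
  by_cases h1 : m.real u 0 ≤ m.real a (m.nat (b + 6 + a) 0)
  · by_cases h2 : m.real w 0 ≤ 0 <;>
    simp [advance, Prog.block, Prog.exec, NExp.eval, RExp.eval, BExp.eval, Memory.setNat_nat,
      Memory.setNat_real, Memory.setReal_nat, Memory.setReal_real, h1, h2, e1, e2, e4,
      huw, huw.symm, le_of_not_ge]
  · by_cases h2 : m.real w 0 ≤ m.real u 0 - m.real a (m.nat (b + 6 + a) 0) <;>
    simp [advance, Prog.block, Prog.exec, NExp.eval, RExp.eval, BExp.eval, Memory.setNat_nat,
      Memory.setNat_real, Memory.setReal_nat, Memory.setReal_real, h1, h2, e4,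
      huw, huw.symm, le_of_not_ge]

theorem loop_cost_le {n N x y c z : ℕ} (h1 : n ≤ N) (h2 : x ≤ y) (h3 : c + 1 ≤ z) :
    n * x + c + 1 ≤ N * y + z := by
  rw [add_assoc]
  gcongr

/-- Consider all continuations of the current phase on lane `c`. -/
def innerLoop (b c : ℕ) (test : Prog) : Prog :=
  .loop (.nle (.var (b + 6 + c)) (.get 0 (.lit c)))
    (.seq (relax b test) (advance b c (b + 2) (b + 4)))

/-- Prepare for serving lane `c` from the current prefix on. -/
def innerInit (b c : ℕ) : Prog := .block [
  .rvar (b + 2) (.get b (.var (b + 10))),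
  .rvar (b + 4) (.lit 0),
  .nvar (b + 6 + c) (.get (b + 2 + c) (.var (b + 10)))]

/-- Consider all phases on lanes `a`, `c` from the current prefix on. -/
def outerLoop (b a c : ℕ) (test : Prog) : Prog :=
  .loop (.nle (.var (b + 6 + a)) (.get 0 (.lit a)))
    (.seq (.seq (innerInit b c) (innerLoop b c test)) (advance b a (b + 1) (b + 3)))

/-- Prepare for serving lane `a` from the current prefix on. -/
def outerInit (b : ℕ) : Prog := .block [
  .rvar (b + 1) (.get b (.var (b + 10))),
  .rvar (b + 3) (.lit 0)]

/-- Return to the current prefix. -/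
def outerDone (b a c : ℕ) : Prog := .block [
  .nvar (b + 6 + a) (.get (b + 2 + a) (.var (b + 10))),
  .nvar (b + 6 + c) (.get (b + 2 + c) (.var (b + 10)))]

/-- Consider all phases on lanes `a`, `c` from the current prefix on. -/
def push (b a c : ℕ) (test : Prog) : Prog :=
  .seq (outerInit b) (.seq (outerLoop b a c test) (outerDone b a c))

section

variable {I : Crossing} {T₀ : ℝ} {S : AddSubgroup ℝ} {b : ℕ} {test : Prog} {τ : ℕ}
  {J : Memory → Prop} {D : Memory → Set ℝ}

/-- The target of a phase is determined by its two counters, so a double loop over counters meets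
every phase. -/
theorem Crossing.Edge.eq_update {a c : Fin 4} {p s : Fin 4 → ℕ} (h : Edge a c p s) :
    s = Function.update (Function.update p a (s a)) c (s c) := by
  funext l
  by_cases h1 : l = c
  · subst h1; simp
  · by_cases h2 : l = a
    · subst h2; simp [h1]
    · simp [h1, h2, h.eq l h2 h1]

theorem Crossing.Pair.ne {a c : Fin 4} (h : Pair a c) : a ≠ c := by
  rcases h with ⟨rfl, rfl⟩ | ⟨rfl, rfl⟩ <;> decide

theorem Crossing.Edge.update {a c : Fin 4} (hac : Pair a c) {p : Fin 4 → ℕ} {i j : ℕ} (hi : p a ≤ i)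
    (hj : p c ≤ j) : Edge a c p (Function.update (Function.update p a i) c j) := by
  refine ⟨hac, fun l => ?_, fun l h1 h2 => by simp [h1, h2]⟩
  by_cases h1 : l = c
  · subst h1; simpa
  · by_cases h2 : l = a
    · subst h2; simpa [h1]
    · simp [h1, h2]

theorem update_le_count {a c : Fin 4} {p : Fin 4 → ℕ} {i j : ℕ} (hp : ∀ l, p l ≤ I.count l)
    (hi : i ≤ I.count a) (hj : j ≤ I.count c) (l : Fin 4) :
    Function.update (Function.update p a i) c j l ≤ I.count l := by
  by_cases h1 : l = c
  · subst h1; simpa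
  · by_cases h2 : l = a
    · subst h2; simpa [h1]
    · simpa [h1, h2] using hp l

theorem Core.pos_le (hT : TestSpec I T₀ S b test τ J D) {t : ℕ} {p : Fin 4 → ℕ} {T : ℝ}
    {E : ℕ → Fin 4 → Fin 4 → (Fin 4 → ℕ) → Prop} {m : Memory}
    (h : Core I T₀ S b J D t p T E m) (l : Fin 4) : p l ≤ I.count l := by
  obtain ⟨d₀, hd₀⟩ := hT.nonempty m h.amb
  rw [← h.pos]
  exact (h.inv d₀ hd₀).1.le t h.lt h.flag l

/-- The state of the variables that describe how far lane `a` has been served in the current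
phase. -/
structure LaneAt (I : Crossing) (b : ℕ) (a : Fin 4) (u w : ℕ) (T : ℝ) (j i : ℕ) (m : Memory) :
    Prop where
  pos : m.nat (b + 6 + a) 0 = i
  le : j ≤ i
  chain : m.real u 0 = I.chain a T j i
  lag : m.real w 0 = I.lag a T j i

theorem LaneAt.advance {a : Fin 4} {u w : ℕ} {T : ℝ} {j i : ℕ} {m : Memory}
    (h : LaneAt I b a u w T j i m) (hg : Glob I T₀ m) (hu : 100 ≤ u) (hw : 100 ≤ w)
    (huw : u ≠ w) : Ends (advance b a u w) m 60 fun m' =>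
      LaneAt I b a u w T j (i + 1) m' ∧ Frame (Platoon.advance b a u w) m m' := by
  refine Ends.imp (advance_ends (by omega) (by omega) hu hw huw m) le_rfl ?_
  rintro m' ⟨⟨h1, h2, h3⟩, h4⟩
  rw [hg.rel, hg.ln, h.pos, h.chain, ← chain_succ h.le] at h1
  rw [hg.rel, h.pos, h.chain, h.lag, ← lag_succ h.le] at h2
  exact ⟨⟨by rw [h3, h.pos], h.le.trans (Nat.le_succ i), h1, h2⟩, h4⟩

theorem LaneAt.congr {a : Fin 4} {u w : ℕ} {T : ℝ} {j i : ℕ} {m m' : Memory}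
    (h : LaneAt I b a u w T j i m) (hn : m'.nat (b + 6 + a) = m.nat (b + 6 + a))
    (hu : m'.real u = m.real u) (hw : m'.real w = m.real w) : LaneAt I b a u w T j i m' :=
  ⟨by rw [hn, h.pos], h.le, by rw [hu, h.chain], by rw [hw, h.lag]⟩

theorem advance_writesNat {a u w x : ℕ} (h : (advance b a u w).WritesNat x) : x = b + 6 + a := by
  simpa [advance, Prog.block, Prog.WritesNat] using h

theorem advance_writesReal {a u w x : ℕ} (h : (advance b a u w).WritesReal x) :
    x = u ∨ x = w := by
  simp [advance, Prog.block, Prog.WritesReal] at h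
  tauto

theorem innerLoop_writesNat (hT : TestSpec I T₀ S b test τ J D) {a : ℕ} {c : Fin 4}
    (h : (innerLoop b c test).WritesNat a) :
    (28 ≤ a ∧ a < b + 6) ∨ a = b + 6 + c ∨ a = b + 11 ∨ a = b + 12 := by
  rcases h with h | h
  · have := relax_writesNat hT h
    omega
  · have := advance_writesNat h
    omega

theorem innerLoop_writesReal (hT : TestSpec I T₀ S b test τ J D) {a : ℕ} {c : Fin 4}
    (h : (innerLoop b c test).WritesReal a) :
    a = 8 ∨ (10 ≤ a ∧ a ≤ b) ∨ a = b + 2 ∨ (b + 4 ≤ a ∧ a ≤ b + 6) := by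
  rcases h with h | h
  · have := relax_writesReal hT h
    omega
  · have := advance_writesReal h
    omega

/-- With the position on lane `a` fixed at `i`, lane `c` is extended one platoon at a time. Its
finish time and delay are updated incrementally, so each phase costs a bounded number of steps plus
one test. -/
theorem innerLoop_ends (hT : TestSpec I T₀ S b test τ J D) {t : ℕ} {p : Fin 4 → ℕ} {T : ℝ}
    {E : ℕ → Fin 4 → Fin 4 → (Fin 4 → ℕ) → Prop} {m : Memory} {a c : Fin 4} {i : ℕ}
    (hac : Pair a c) (h : Core I T₀ S b J D t p T E m) (hE : ∀ q a c s, E q a c s → q ≤ t)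
    (hi : i ≤ I.count a) (ha : LaneAt I b a (b + 1) (b + 3) T (p a) i m)
    (hc : LaneAt I b c (b + 2) (b + 4) T (p c) (p c) m)
    (hy : ∀ l, l ≠ a → l ≠ c → m.nat (b + 6 + l) 0 = p l) :
    Ends (innerLoop b c test) m (I.radix * (200 + τ) + 10) fun m' =>
      Core I T₀ S b J D t p T
        (fun q a' c' s => E q a' c' s ∨ (q = t ∧ a' = a ∧ c' = c ∧ s a = i)) m' ∧
      Frame (innerLoop b c test) m m' := by
  have hb := hT.base
  have hne := hac.ne
  have hne' : (a : ℕ) ≠ c := fun h => hne (Fin.ext h)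
  refine Ends.frame (Ends.imp (Ends.loop
    (fun m => ∃ j, j ≤ I.count c + 1 ∧ LaneAt I b c (b + 2) (b + 4) T (p c) j m ∧
      LaneAt I b a (b + 1) (b + 3) T (p a) i m ∧
      (∀ l, l ≠ a → l ≠ c → m.nat (b + 6 + l) 0 = p l) ∧
      Core I T₀ S b J D t p T
        (fun q a' c' s => E q a' c' s ∨ (q = t ∧ a' = a ∧ c' = c ∧ s a = i ∧ s c < j)) m)
    (fun m => I.count c + 1 - m.nat (b + 6 + c) 0) (k := 180 + τ) ?_
    ⟨p c, (h.pos_le hT c).trans (Nat.le_succ _), hc, ha, hy, h.mono ?_⟩) ?_ ?_)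
  · rintro m₁ ⟨j, hj, hc, ha, hy, h⟩ hcond
    have hj' : j ≤ I.count c := by
      simpa [BExp.eval, NExp.eval, hc.pos, h.glob.count] using hcond
    have hpl := h.pos_le hT
    refine Ends.imp (Ends.seq (k := 120 + τ) (k' := 60) (relax_ends hT h
      (s := Function.update (Function.update p a i) c j) ?_ (Edge.update hac ha.le hc.le)
      (update_le_count hpl hi hj') ?_
      ?_ ?_ ?_ ?_) fun m₂ hm₂ => ?_) (by omega) fun _ h => h
    · rintro q a' c' s (h | h)
      exacts [hE _ _ _ _ h, h.1.le]
    · intro l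
      by_cases h1 : l = c
      · subst h1; simpa using hc.pos
      · by_cases h2 : l = a
        · subst h2; simpa [h1] using ha.pos
        · simpa [h1, h2] using hy l h2 h1
    · simpa [hne] using ha.chain
    · simpa using hc.chain
    · simpa [hne] using ha.lag
    · simpa using hc.lag
    · obtain ⟨h₂, hfn, hfr⟩ := hm₂
      have en : ∀ l : Fin 4, m₂.nat (b + 6 + l) = m₁.nat (b + 6 + l) := fun l =>
        hfn _ fun hw => by
          have := relax_writesNat hT hw
          omega
      have er : ∀ k, 1 ≤ k → k ≤ 4 → m₂.real (b + k) = m₁.real (b + k) := fun k h1 h2 =>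
        hfr _ fun hw => by
          have := relax_writesReal hT hw
          omega
      have hc₂ : LaneAt I b c (b + 2) (b + 4) T (p c) j m₂ :=
        hc.congr (en c) (er 2 (by omega) (by omega)) (er 4 (by omega) (by omega))
      refine Ends.imp (hc₂.advance h₂.glob (by omega) (by omega) (by omega)) le_rfl ?_
      rintro m₃ ⟨h₃, hgn, hgr⟩
      have en₃ : ∀ x, x ≠ b + 6 + c → m₃.nat x = m₂.nat x := fun x hx => hgn x fun hw =>
        hx (advance_writesNat hw)
      have er₃ : ∀ x, x ≠ b + 2 → x ≠ b + 4 → m₃.real x = m₂.real x := fun x h1 h2 =>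
        hgr x fun hw => by
          have := advance_writesReal hw
          omega
      refine ⟨⟨j + 1, by omega, h₃, ?_, ?_, ?_⟩, ?_⟩
      · exact ha.congr ((en₃ _ (by omega)).trans (en a))
          ((er₃ _ (by omega) (by omega)).trans (er 1 (by omega) (by omega)))
          ((er₃ _ (by omega) (by omega)).trans (er 3 (by omega) (by omega)))
      · intro l h1 h2
        have : (l : ℕ) ≠ c := fun h => h2 (Fin.ext h)
        rw [en₃ _ (by omega), en l, hy l h1 h2]
      · have h₃' : Core I T₀ S b J D t p T _ m₃ := h₂.congr hT (fun x hx => en₃ x (by omega))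
          (fun x hx => er₃ x (by omega) (by omega))
        refine h₃'.mono ?_
        rintro q a' c' s he - (h5 | ⟨rfl, rfl, rfl, h5, h6⟩)
        · exact Or.inl (Or.inl h5)
        · rcases Nat.lt_succ_iff_lt_or_eq.1 h6 with h7 | h7
          · exact Or.inl (Or.inr ⟨rfl, rfl, rfl, h5, h7⟩)
          · refine Or.inr ⟨rfl, rfl, rfl, ?_⟩
            have hp : ((tab b m₃).pos · q) = p := funext h₃'.pos
            rw [hp] at he
            rw [← h5, ← h7]
            exact Edge.eq_update he
      · simp only [h₃.pos, hc.pos]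
        omega
  -- At the start nothing has been considered, and nothing needs to be: a phase never moves lane `c`
  -- back below `p c`.
  · rintro q a' c' s he - (h5 | ⟨rfl, rfl, rfl, h5, h6⟩)
    · exact h5
    · have hp : ((tab b m).pos · q) = p := funext h.pos
      rw [hp] at he
      exact absurd (he.le c') (not_le.2 h6)
  · have h1 : I.count c + 1 - m.nat (b + 6 + c) 0 ≤ I.radix := by
      have := I.count_lt_radix c
      omega
    refine loop_cost_le h1 ?_ ?_ <;> simp only [BExp.cost, NExp.cost] <;> omega
  · rintro m' ⟨⟨j, hj, hc, ha, hy, h⟩, hcond⟩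
    have hj' : ¬ j ≤ I.count c := by
      simpa [BExp.eval, NExp.eval, hc.pos, h.glob.count] using hcond
    -- The counter has passed the end of the lane, so every admissible position on it has been
    -- considered.
    refine h.mono ?_
    rintro q a' c' s he hs (h5 | ⟨rfl, rfl, rfl, h5⟩)
    · exact Or.inl h5
    · have := hs c'
      exact Or.inr ⟨rfl, rfl, rfl, h5, by omega⟩

end

end Platoon

/-! ### Enumerating the phases of a road: the outer loop -/

namespace Platoon

open Crossing

/-- Take the position of the current prefix from the table. -/
def loadPos (b : ℕ) : Prog := .block [
  .nvar (b + 6) (.get (b + 2) (.var (b + 10))),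
  .nvar (b + 7) (.get (b + 3) (.var (b + 10))),
  .nvar (b + 8) (.get (b + 4) (.var (b + 10))),
  .nvar (b + 9) (.get (b + 5) (.var (b + 10)))]

/-- Consider all phases from the current prefix on, if it has been reached. -/
def visit (b : ℕ) (test : Prog) : Prog :=
  .branch (.nle (.lit 1) (.get b (.var (b + 10))))
    (.seq (loadPos b) (.seq (push b 0 1 test) (push b 2 3 test))) .skip

/-- Make the table empty. -/
def clear (b : ℕ) : Prog := .seq (.nvar (b + 10) (.lit 0))
  (.loop (.nle (.add (.var (b + 10)) (.lit 1)) (.var 26))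
    (.block [.nset b (.var (b + 10)) (.lit 0), .nvar (b + 10) (.add (.var (b + 10)) (.lit 1))]))

/-- Enter the empty prefix into the table. -/
def initTab (b : ℕ) : Prog := .block [
  .nset b (.lit 0) (.lit 1),
  .rset b (.lit 0) (.var 9),
  .nset (b + 2) (.lit 0) (.lit 0),
  .nset (b + 3) (.lit 0) (.lit 0),
  .nset (b + 4) (.lit 0) (.lit 0),
  .nset (b + 5) (.lit 0) (.lit 0),
  .nvar (b + 10) (.lit 0)]

/-- Consider all prefixes in turn. -/
def sweep (b : ℕ) (test : Prog) : Prog :=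
  .loop (.nle (.add (.var (b + 10)) (.lit 1)) (.var 26))
    (.seq (visit b test) (.nvar (b + 10) (.add (.var (b + 10)) (.lit 1))))

/-- The dynamic program. -/
def dp (b : ℕ) (test : Prog) : Prog := .seq (clear b) (.seq (initTab b) (sweep b test))

section

variable {I : Crossing} {T₀ : ℝ} {S : AddSubgroup ℝ} {b : ℕ} {test : Prog} {τ : ℕ}
  {J : Memory → Prop} {D : Memory → Set ℝ}

theorem innerInit_ends {c : Fin 4} (m : Memory) :
    Ends (innerInit b c) m 30 fun m' =>
    (m'.real (b + 2) 0 = (tab b m).val (m.nat (b + 10) 0) ∧ m'.real (b + 4) 0 = 0 ∧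
      m'.nat (b + 6 + c) 0 = (tab b m).pos c (m.nat (b + 10) 0)) ∧
    Frame (innerInit b c) m m' := by
  refine Ends.frame (Prog.Straight.ends (by simp [innerInit, Prog.block, Prog.Straight])
    (Nat.le_of_ble_eq_true rfl) ?_)
  simp [innerInit, Prog.block, Prog.exec, NExp.eval, RExp.eval, Memory.setNat_nat,
    Memory.setNat_real, Memory.setReal_nat, Memory.setReal_real, tab]

theorem innerInit_writesNat {a c : ℕ} (h : (innerInit b c).WritesNat a) : a = b + 6 + c := by
  simpa [innerInit, Prog.block, Prog.WritesNat] using h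

theorem innerInit_writesReal {a c : ℕ} (h : (innerInit b c).WritesReal a) :
    a = b + 2 ∨ a = b + 4 := by
  simpa [innerInit, Prog.block, Prog.WritesReal] using h

theorem outerLoop_writesNat (hT : TestSpec I T₀ S b test τ J D) {x : ℕ} {a c : Fin 4}
    (h : (outerLoop b a c test).WritesNat x) :
    (28 ≤ x ∧ x < b + 6) ∨ x = b + 6 + a ∨ x = b + 6 + c ∨ x = b + 11 ∨ x = b + 12 := by
  rcases h with (h | h) | h
  · have := innerInit_writesNat h
    omega
  · have := innerLoop_writesNat hT h
    omega
  · have := advance_writesNat h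
    omega

theorem outerLoop_ends (hT : TestSpec I T₀ S b test τ J D) {t : ℕ} {p : Fin 4 → ℕ} {T : ℝ}
    {E : ℕ → Fin 4 → Fin 4 → (Fin 4 → ℕ) → Prop} {m : Memory} {a c : Fin 4}
    (hac : Pair a c) (h : Core I T₀ S b J D t p T E m) (hE : ∀ q a c s, E q a c s → q ≤ t)
    (ha : LaneAt I b a (b + 1) (b + 3) T (p a) (p a) m)
    (hy : ∀ l, l ≠ a → l ≠ c → m.nat (b + 6 + l) 0 = p l) :
    Ends (outerLoop b a c test) m (I.radix * (I.radix * (200 + τ) + 110) + 10) fun m' =>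
      Core I T₀ S b J D t p T
        (fun q a' c' s => E q a' c' s ∨ (q = t ∧ a' = a ∧ c' = c)) m' ∧
      Frame (outerLoop b a c test) m m' := by
  have hb := hT.base
  have hne := hac.ne
  have hne' : (a : ℕ) ≠ c := fun h => hne (Fin.ext h)
  refine Ends.frame (Ends.imp (Ends.loop
    (fun m => ∃ i, i ≤ I.count a + 1 ∧ LaneAt I b a (b + 1) (b + 3) T (p a) i m ∧
      (∀ l, l ≠ a → l ≠ c → m.nat (b + 6 + l) 0 = p l) ∧
      Core I T₀ S b J D t p T
        (fun q a' c' s => E q a' c' s ∨ (q = t ∧ a' = a ∧ c' = c ∧ s a < i)) m)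
    (fun m => I.count a + 1 - m.nat (b + 6 + a) 0) (k := I.radix * (200 + τ) + 100) ?_
    ⟨p a, (h.pos_le hT a).trans (Nat.le_succ _), ha, hy, h.mono ?_⟩) ?_ ?_)
  · rintro m₁ ⟨i, hi, ha, hy, h⟩ hcond
    have hi' : i ≤ I.count a := by
      simpa [BExp.eval, NExp.eval, ha.pos, h.glob.count] using hcond
    refine Ends.imp (Ends.seq (k' := 60) (Ends.seq (innerInit_ends m₁)
      (k' := I.radix * (200 + τ) + 10)
      (Q' := fun m₃ => LaneAt I b a (b + 1) (b + 3) T (p a) i m₃ ∧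
        (∀ l, l ≠ a → l ≠ c → m₃.nat (b + 6 + l) 0 = p l) ∧
        Core I T₀ S b J D t p T (fun q a' c' s => (E q a' c' s ∨ (q = t ∧ a' = a ∧ c' = c ∧
          s a < i)) ∨ (q = t ∧ a' = a ∧ c' = c ∧ s a = i)) m₃) fun m₂ hm₂ => ?_)
      fun m₃ hm₃ => ?_) (by omega) fun _ h => h
    · obtain ⟨⟨h1, h2, h3⟩, hfn, hfr⟩ := hm₂
      have en : ∀ x, x ≠ b + 6 + c → m₂.nat x = m₁.nat x := fun x hx => hfn x fun hw =>
        hx (innerInit_writesNat hw)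
      have er : ∀ x, x ≠ b + 2 → x ≠ b + 4 → m₂.real x = m₁.real x := fun x hx hx' =>
        hfr x fun hw => by
          have := innerInit_writesReal hw
          omega
      rw [h.cur, h.val] at h1
      rw [h.cur, h.pos] at h3
      have ha₂ := ha.congr (en _ (by omega)) (er _ (by omega) (by omega))
        (er _ (by omega) (by omega))
      have hy₂ : ∀ l, l ≠ a → l ≠ c → m₂.nat (b + 6 + l) 0 = p l := fun l h1 h2 => by
        have : (l : ℕ) ≠ c := fun h => h2 (Fin.ext h)
        rw [en _ (by omega), hy l h1 h2]
      refine Ends.imp (innerLoop_ends hT hac (h.congr hT (fun x hx => en x (by omega))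
        (fun x hx => er x (by omega) (by omega))) ?_ hi' ha₂
        ⟨h3, le_rfl, by rw [h1, chain_of_le le_rfl], by rw [h2, lag_of_le le_rfl]⟩ hy₂) le_rfl ?_
      · rintro q a' c' s (h | h)
        exacts [hE _ _ _ _ h, h.1.le]
      · rintro m₃ ⟨hc₃, hgn, hgr⟩
        have en₃ : ∀ l : Fin 4, l ≠ c → m₃.nat (b + 6 + l) = m₂.nat (b + 6 + l) := fun l hl =>
          hgn _ fun hw => by
            have : (l : ℕ) ≠ c := fun h => hl (Fin.ext h)
            have := innerLoop_writesNat hT hw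
            omega
        have er₃ : ∀ x, x = b + 1 ∨ x = b + 3 → m₃.real x = m₂.real x := fun x hx =>
          hgr _ fun hw => by
            have := innerLoop_writesReal hT hw
            omega
        exact ⟨ha₂.congr (en₃ a hne) (er₃ _ (by omega)) (er₃ _ (by omega)),
          fun l h1 h2 => by rw [en₃ l h2, hy₂ l h1 h2], hc₃⟩
    · obtain ⟨ha₃, hy₃, hc₃⟩ := hm₃
      refine Ends.imp (ha₃.advance hc₃.glob (by omega) (by omega) (by omega)) le_rfl ?_
      rintro m₄ ⟨h₄, hgn, hgr⟩
      have en : ∀ x, x ≠ b + 6 + a → m₄.nat x = m₃.nat x := fun x hx => hgn x fun hw =>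
        hx (advance_writesNat hw)
      have er : ∀ x, x ≠ b + 1 → x ≠ b + 3 → m₄.real x = m₃.real x := fun x h1 h2 =>
        hgr x fun hw => by
          have := advance_writesReal hw
          omega
      refine ⟨⟨i + 1, by omega, h₄, ?_, ?_⟩, ?_⟩
      · intro l h1 h2
        have : (l : ℕ) ≠ a := fun h => h1 (Fin.ext h)
        rw [en _ (by omega), hy₃ l h1 h2]
      · refine (hc₃.congr hT (fun x hx => en x (by omega))
          (fun x hx => er x (by omega) (by omega))).mono ?_
        rintro q a' c' s he - (h5 | ⟨rfl, rfl, rfl, h5⟩)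
        · exact Or.inl (Or.inl h5)
        · rcases Nat.lt_succ_iff_lt_or_eq.1 h5 with h7 | h7
          · exact Or.inl (Or.inr ⟨rfl, rfl, rfl, h7⟩)
          · exact Or.inr ⟨rfl, rfl, rfl, h7⟩
      · simp only [h₄.pos, ha.pos]
        omega
  · rintro q a' c' s he - (h5 | ⟨rfl, rfl, rfl, h5⟩)
    · exact h5
    · have hp : ((tab b m).pos · q) = p := funext h.pos
      rw [hp] at he
      exact absurd (he.le a') (not_le.2 h5)
  · have h1 : I.count a + 1 - m.nat (b + 6 + a) 0 ≤ I.radix := by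
      have := I.count_lt_radix a
      omega
    refine loop_cost_le h1 ?_ ?_ <;> simp only [BExp.cost, NExp.cost] <;> omega
  · rintro m' ⟨⟨i, hi, ha, hy, h⟩, hcond⟩
    have hi' : ¬ i ≤ I.count a := by
      simpa [BExp.eval, NExp.eval, ha.pos, h.glob.count] using hcond
    refine h.mono ?_
    rintro q a' c' s he hs (h5 | ⟨rfl, rfl, rfl⟩)
    · exact Or.inl h5
    · have := hs a'
      exact Or.inr ⟨rfl, rfl, rfl, by omega⟩

theorem push_writesNat (hT : TestSpec I T₀ S b test τ J D) {x : ℕ} {a c : Fin 4}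
    (h : (push b a c test).WritesNat x) :
    28 ≤ x ∧ x < b + 20 ∧ x ≠ b + 10 := by
  have := hT.base
  rcases h with h | h | h
  · simp [outerInit, Prog.block, Prog.WritesNat] at h
  · have := outerLoop_writesNat hT h
    omega
  · simp [outerDone, Prog.block, Prog.WritesNat] at h
    omega

/-- The position variables are restored at the end, so that the other road can be treated from the
same prefix. -/
theorem push_ends (hT : TestSpec I T₀ S b test τ J D) {t : ℕ} {p : Fin 4 → ℕ} {T : ℝ}
    {E : ℕ → Fin 4 → Fin 4 → (Fin 4 → ℕ) → Prop} {m : Memory} {a c : Fin 4}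
    (hac : Pair a c) (h : Core I T₀ S b J D t p T E m) (hE : ∀ q a c s, E q a c s → q ≤ t)
    (hy : ∀ l : Fin 4, m.nat (b + 6 + l) 0 = p l) :
    Ends (push b a c test) m (I.radix * (I.radix * (200 + τ) + 110) + 100) fun m' =>
      Core I T₀ S b J D t p T
        (fun q a' c' s => E q a' c' s ∨ (q = t ∧ a' = a ∧ c' = c)) m' ∧
      ∀ l : Fin 4, m'.nat (b + 6 + l) 0 = p l := by
  have hb := hT.base
  have hne' : (a : ℕ) ≠ c := fun h => hac.ne (Fin.ext h)
  have hinit : Ends (outerInit b) m 30 fun m' => (m'.real (b + 1) 0 = T ∧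
      m'.real (b + 3) 0 = 0) ∧ Frame (outerInit b) m m' := by
    refine Ends.frame (Prog.Straight.ends (by simp [outerInit, Prog.block, Prog.Straight])
      (Nat.le_of_ble_eq_true rfl) ?_)
    have hv : m.real b t = T := h.val
    simp [outerInit, Prog.block, Prog.exec, NExp.eval, RExp.eval,
      Memory.setReal_real, h.cur, hv]
  refine Ends.imp (Ends.seq hinit fun m₁ hm₁ => Ends.seq (k' := 40)
    (k := I.radix * (I.radix * (200 + τ) + 110) + 10)
    (Q := fun m₂ => (∀ l, l ≠ a → l ≠ c → m₂.nat (b + 6 + l) 0 = p l) ∧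
      Core I T₀ S b J D t p T (fun q a' c' s => E q a' c' s ∨ (q = t ∧ a' = a ∧ c' = c)) m₂)
    ?_ fun m₂ hm₂ => ?_) (by omega) fun _ h => h
  · obtain ⟨⟨h1, h2⟩, hfn, hfr⟩ := hm₁
    have en : m₁.nat = m.nat := funext fun x => hfn x (by
      simp [outerInit, Prog.block, Prog.WritesNat])
    have er : ∀ x, x ≠ b + 1 → x ≠ b + 3 → m₁.real x = m.real x := fun x _ _ => hfr x (by
      simp [outerInit, Prog.block, Prog.WritesReal]; omega)
    refine Ends.imp (outerLoop_ends hT hac (h.congr hT (fun x _ => by rw [en])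
      (fun x hx => er x (by omega) (by omega))) hE ⟨by rw [en, hy], le_rfl, by
      rw [h1, chain_of_le le_rfl], by rw [h2, lag_of_le le_rfl]⟩ (fun l _ _ => by rw [en, hy]))
      le_rfl ?_
    rintro m₂ ⟨h3, hgn, -⟩
    refine ⟨fun l h1 h2 => ?_, h3⟩
    have : (l : ℕ) ≠ c := fun h => h2 (Fin.ext h)
    have : (l : ℕ) ≠ a := fun h => h1 (Fin.ext h)
    rw [hgn _ fun hw => by
      have := outerLoop_writesNat hT hw
      omega, en, hy]
  · obtain ⟨hy₂, hc₂⟩ := hm₂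
    have hpa : m₂.nat (b + 2 + a) t = p a := hc₂.pos a
    have hpc : m₂.nat (b + 2 + c) t = p c := hc₂.pos c
    have hdone : Ends (outerDone b a c) m₂ 40 fun m' => (m'.nat (b + 6 + a) 0 = p a ∧
        m'.nat (b + 6 + c) 0 = p c) ∧ Frame (outerDone b a c) m₂ m' := by
      refine Ends.frame (Prog.Straight.ends (by simp [outerDone, Prog.block, Prog.Straight])
        (Nat.le_of_ble_eq_true rfl) ?_)
      have e1 : b + 10 ≠ b + 6 + (a : ℕ) := by omega
      have e2 : b + 2 + (c : ℕ) ≠ b + 6 + a := by omega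
      simp [outerDone, Prog.block, Prog.exec, NExp.eval, hne',
        Memory.setNat_nat, hc₂.cur, hpa, hpc, e1, e2]
    refine Ends.imp hdone le_rfl ?_
    rintro m₃ ⟨⟨h1, h2⟩, hfn, hfr⟩
    have en : ∀ x, x ≠ b + 6 + a → x ≠ b + 6 + c → m₃.nat x = m₂.nat x := fun x _ _ =>
      hfn x (by simp [outerDone, Prog.block, Prog.WritesNat]; omega)
    refine ⟨hc₂.congr hT (fun x hx => en x (by omega) (by omega)) (fun x hx => hfr x (by
      simp [outerDone, Prog.block, Prog.WritesReal])), fun l => ?_⟩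
    by_cases hl : l = a
    · rw [hl, h1]
    by_cases hl' : l = c
    · rw [hl', h2]
    have : (l : ℕ) ≠ c := fun h => hl' (Fin.ext h)
    have : (l : ℕ) ≠ a := fun h => hl (Fin.ext h)
    rw [en _ (by omega) (by omega), hy₂ l hl hl']

end

end Platoon

/-! ### The complete dynamic program -/

namespace Platoon

open Crossing

section

variable {I : Crossing} {T₀ : ℝ} {S : AddSubgroup ℝ} {b : ℕ} {test : Prog} {τ : ℕ}
  {J : Memory → Prop} {D : Memory → Set ℝ}

/-- Invariant of the dynamic program between the visits to prefixes: those with numbers less than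
`t` have been taken into account. -/
structure Stage (I : Crossing) (T₀ : ℝ) (S : AddSubgroup ℝ) (b : ℕ) (J : Memory → Prop)
    (D : Memory → Set ℝ) (t : ℕ) (m : Memory) : Prop where
  glob : Glob I T₀ m
  amb : J m
  inv : ∀ d ∈ D m, (tab b m).Sound I T₀ S d t ∧ (tab b m).Closed I d (fun q _ _ _ => q < t)

theorem Stage.congr (hT : TestSpec I T₀ S b test τ J D) {t : ℕ} {m m' : Memory}
    (h : Stage I T₀ S b J D t m)
    (hn : ∀ a, a < 100 ∨ (b ≤ a ∧ a < b + 6) → m'.nat a = m.nat a)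
    (hr : ∀ a, a < 100 ∨ a = b → m'.real a = m.real a) : Stage I T₀ S b J D t m' := by
  have ht : tab b m' = tab b m := tab_congr (fun a h1 h2 => hn a (by omega)) (hr b (by omega))
  have hJ := hT.congr m m' (fun a ha => hn a (by omega)) (fun a ha => hr a (by omega)) h.amb
  refine ⟨h.glob.congr (fun a ha => hn a (by omega)) (fun a ha _ => hr a (by omega)), hJ.1, ?_⟩
  rw [ht, hJ.2]
  exact h.inv

theorem visit_writesNat (hT : TestSpec I T₀ S b test τ J D) {x : ℕ}
    (h : (visit b test).WritesNat x) : 28 ≤ x ∧ x < b + 20 ∧ x ≠ b + 10 := by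
  have := hT.base
  rcases h with (h | h | h) | h
  · simp [loadPos, Prog.block, Prog.WritesNat] at h
    omega
  · exact push_writesNat (a := 0) (c := 1) hT h
  · exact push_writesNat (a := 2) (c := 3) hT h
  · exact h.elim

theorem visit_ends (hT : TestSpec I T₀ S b test τ J D) {t : ℕ} {m : Memory}
    (h : Stage I T₀ S b J D t m) (ht : m.nat (b + 10) 0 = t) (hlt : t < I.states) :
    Ends (visit b test) m (2 * (I.radix * (I.radix * (200 + τ) + 110)) + 300) fun m' =>
      Stage I T₀ S b J D (t + 1) m' ∧ Frame (visit b test) m m' := by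
  have hb := hT.base
  refine Ends.frame (Ends.imp (Ends.branch
    (k := 2 * (I.radix * (I.radix * (200 + τ) + 110)) + 260) (fun hcond => ?_) (fun hcond => ?_))
    (by simp only [BExp.cost, NExp.cost]; omega) fun _ h => h)
  · have hcond' : 0 < (tab b m).flag t := by
      simp only [BExp.eval, NExp.eval, ht] at hcond
      exact hcond
    have hload : Ends (loadPos b) m 60 fun m' => (∀ l : Fin 4,
        m'.nat (b + 6 + l) 0 = (tab b m).pos l t) ∧ Frame (loadPos b) m m' := by
      refine Ends.frame (Prog.Straight.ends (by simp [loadPos, Prog.block, Prog.Straight])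
        (Nat.le_of_ble_eq_true rfl) ?_)
      intro l
      fin_cases l <;> simp [loadPos, Prog.block, Prog.exec, NExp.eval, Memory.setNat_nat, ht, tab]
    refine Ends.imp (Ends.seq hload fun m₁ hm₁ => Ends.seq
      (k := I.radix * (I.radix * (200 + τ) + 110) + 100)
      (k' := I.radix * (I.radix * (200 + τ) + 110) + 100)
      (push_ends (a := 0) (c := 1) (E := fun q _ _ _ => q < t) (t := t) (T := (tab b m).val t)
        (p := ((tab b m).pos · t)) hT (Or.inl ⟨rfl, rfl⟩) ?_ (fun q _ _ _ h => h.le) hm₁.1)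
        fun m₂ hm₂ => Ends.imp (push_ends (a := 2) (c := 3) hT (Or.inr ⟨rfl, rfl⟩) hm₂.1
          ?_ hm₂.2) le_rfl ?_) (by omega) fun _ h => h
    · obtain ⟨-, hfn, hfr⟩ := hm₁
      have en : ∀ x, x < b + 6 ∨ b + 10 ≤ x → m₁.nat x = m.nat x := fun x _ => hfn x (by
        simp [loadPos, Prog.block, Prog.WritesNat]; omega)
      have er : ∀ x, m₁.real x = m.real x := fun x => hfr x (by
        simp [loadPos, Prog.block, Prog.WritesReal])
      have h₁ := h.congr hT (fun x _ => en x (by omega)) (fun x _ => er x)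
      have htab : tab b m₁ = tab b m := tab_congr (fun x _ _ => en x (by omega)) (er b)
      exact ⟨h₁.glob, h₁.amb, by rw [en _ (by omega), ht], hlt, by rw [htab]; exact hcond',
        fun l => by rw [htab], by rw [htab], h₁.inv⟩
    · rintro q a c s (h | h)
      exacts [h.le, h.1.le]
    · rintro m₃ ⟨h₃, -⟩
      refine ⟨h₃.glob, h₃.amb, fun d hd => ?_⟩
      obtain ⟨h4, h5⟩ := h₃.inv d hd
      refine ⟨⟨h4.zero_flag, h4.zero_val, h4.zero_pos, h4.idx, h4.le, h4.mem,
        fun u hu hf hu0 => ?_⟩, h5.mono ?_⟩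
      · obtain ⟨k1, k2, k3⟩ := h4.pre u hu hf hu0
        exact ⟨k1, k2.trans (Nat.le_succ t), k3⟩
      · intro q _ _ a c s he _ hq
        -- A phase from the current prefix belongs to one of the two roads, and each has been
        -- treated by its own `push`.
        rcases Nat.lt_succ_iff_lt_or_eq.1 hq with h6 | rfl
        · exact Or.inl (Or.inl h6)
        · rcases he.pair with ⟨rfl, rfl⟩ | ⟨rfl, rfl⟩
          · exact Or.inl (Or.inr ⟨rfl, rfl, rfl⟩)
          · exact Or.inr ⟨rfl, rfl, rfl⟩
  -- Closedness speaks of reached prefixes only, so an unreached one may be skipped.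
  · have hcond' : ¬ 0 < (tab b m).flag t := by
      simp only [BExp.eval, NExp.eval, ht] at hcond
      exact hcond
    refine Prog.Straight.ends (P := .skip) trivial (by simp only [Prog.cost]; omega)
      ⟨h.glob, h.amb, fun d hd => ?_⟩
    obtain ⟨h4, h5⟩ := h.inv d hd
    refine ⟨⟨h4.zero_flag, h4.zero_val, h4.zero_pos, h4.idx, h4.le, h4.mem,
      fun u hu hf hu0 => ?_⟩, h5.mono ?_⟩
    · obtain ⟨k1, k2, k3⟩ := h4.pre u hu hf hu0
      exact ⟨k1, k2.trans (Nat.le_succ t), k3⟩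
    · intro q _ hf a c s he _ hq
      rcases Nat.lt_succ_iff_lt_or_eq.1 hq with h6 | rfl
      · exact h6
      · exact absurd hf hcond'

theorem sweep_ends (hT : TestSpec I T₀ S b test τ J D) {m : Memory}
    (h : Stage I T₀ S b J D 0 m) (ht : m.nat (b + 10) 0 = 0) :
    Ends (sweep b test) m
      (I.states * (2 * (I.radix * (I.radix * (200 + τ) + 110)) + 400) + 100) fun m' =>
        Stage I T₀ S b J D I.states m' := by
  have hb := hT.base
  refine Ends.imp (Ends.loop (fun m => ∃ t ≤ I.states, m.nat (b + 10) 0 = t ∧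
    Stage I T₀ S b J D t m) (fun m => I.states - m.nat (b + 10) 0)
    (k := 2 * (I.radix * (I.radix * (200 + τ) + 110)) + 350) ?_ ⟨0, Nat.zero_le _, ht, h⟩) ?_ ?_
  · rintro m₁ ⟨t, ht, htm, h⟩ hcond
    have hlt : t < I.states := by
      simp only [BExp.eval, NExp.eval, htm, h.glob.states] at hcond
      exact hcond
    refine Ends.imp (Ends.seq (k' := 20) (visit_ends hT h htm hlt) fun m₂ hm₂ =>
      Prog.Straight.ends (by exact trivial) (Nat.le_of_ble_eq_true rfl) ?_) (by omega) fun _ h => h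
    obtain ⟨h₂, hfn, -⟩ := hm₂
    have ht₂ : m₂.nat (b + 10) 0 = t := by
      rw [hfn _ fun hw => (visit_writesNat hT hw).2.2 rfl, htm]
    have e : (Prog.exec (.nvar (b + 10) (.add (.var (b + 10)) (.lit 1))) m₂).nat (b + 10) 0
        = t + 1 := by
      simp [Prog.exec, NExp.eval, Memory.setNat_nat, ht₂]
    refine ⟨⟨t + 1, hlt, e, h₂.congr hT (fun x hx => ?_) fun x hx => rfl⟩, ?_⟩
    · have : x ≠ b + 10 := by omega
      simp [Prog.exec, NExp.eval, Memory.setNat_nat, this]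
    · simp only [e, htm]
      omega
  · refine loop_cost_le (Nat.sub_le _ _) ?_ ?_ <;> simp only [BExp.cost, NExp.cost] <;> omega
  · rintro m' ⟨⟨t, ht, htm, h⟩, hcond⟩
    have hlt : ¬ t < I.states := by
      simp only [BExp.eval, NExp.eval, htm, h.glob.states] at hcond
      exact hcond
    rwa [show I.states = t by omega]

theorem clear_writesNat {x : ℕ} (h : (clear b).WritesNat x) : x = b ∨ x = b + 10 := by
  simp [clear, Prog.block, Prog.WritesNat] at h
  omega

theorem clear_ends (hb : 100 ≤ b) {m : Memory} (h : Glob I T₀ m) :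
    Ends (clear b) m (I.states * 100 + 100) fun m' =>
      (∀ u < I.states, m'.nat b u = 0) ∧ Frame (clear b) m m' := by
  have e26 : (26 : ℕ) ≠ b := by omega
  have e26' : (26 : ℕ) ≠ b + 10 := by omega
  refine Ends.frame (Ends.imp (Ends.seq (k := 20) (Q := fun m => m.nat (b + 10) 0 = 0 ∧
    m.nat 26 0 = I.states) (Prog.Straight.ends (by exact trivial) (Nat.le_of_ble_eq_true rfl) ?_)
    fun m₁ hm₁ => Ends.imp (Ends.loop (fun m => m.nat (b + 10) 0 ≤ I.states ∧
      m.nat 26 0 = I.states ∧ ∀ u < m.nat (b + 10) 0, m.nat b u = 0)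
      (fun m => I.states - m.nat (b + 10) 0) (k := 50) ?_ ⟨by omega, hm₁.2, by
        rw [hm₁.1]; omega⟩) (k' := I.states * 100 + 80) ?_ ?_) (by omega) fun _ h => h)
  · simp [Prog.exec, NExp.eval, Memory.setNat_nat, h.states, e26']
  · rintro m₂ ⟨h1, h2, h3⟩ hcond
    have hlt : m₂.nat (b + 10) 0 < I.states := by
      simp only [BExp.eval, NExp.eval, h2] at hcond
      exact hcond
    refine Prog.Straight.ends (by simp [Prog.block, Prog.Straight]) (Nat.le_of_ble_eq_true rfl) ?_
    simp only [Prog.block, Prog.exec, NExp.eval, Memory.setNat_nat]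
    refine ⟨⟨?_, ?_, ?_⟩, ?_⟩
    · simpa using hlt
    · simpa [e26, e26'] using h2
    · intro u hu
      have hu : u < m₂.nat (b + 10) 0 + 1 := by simpa using hu
      by_cases h4 : u = m₂.nat (b + 10) 0
      · simp [h4]
      · simpa [h4] using h3 u (by omega)
    · simp
      omega
  · refine loop_cost_le (Nat.sub_le _ _) ?_ ?_ <;> simp only [BExp.cost, NExp.cost] <;> omega
  · rintro m' ⟨⟨h1, h2, h3⟩, hcond⟩ u hu
    refine h3 u ?_
    simp only [BExp.eval, NExp.eval, h2, not_le] at hcond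
    omega

theorem initTab_writesNat {x : ℕ} (h : (initTab b).WritesNat x) :
    (b ≤ x ∧ x < b + 6) ∨ x = b + 10 := by
  simp [initTab, Prog.block, Prog.WritesNat] at h
  omega

theorem initTab_writesReal {x : ℕ} (h : (initTab b).WritesReal x) : x = b := by
  simpa [initTab, Prog.block, Prog.WritesReal] using h

/-- There are `radix ^ 4` prefixes, two roads and at most `radix ^ 2` phases for each, with one test
per phase. -/
theorem dp_cost_le (I : Crossing) (τ : ℕ) : (I.states * 100 + 100) + (100 +
    (I.states * (2 * (I.radix * (I.radix * (200 + τ) + 110)) + 400) + 100)) ≤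
    2000 * I.radix ^ 6 * (τ + 1) := by
  have hM : 1 ≤ I.radix := radix_pos
  rw [states]
  obtain ⟨k, hk⟩ := Nat.exists_eq_add_of_le hM
  rw [hk]
  ring_nf
  omega

theorem dp_ends (hT : TestSpec I T₀ S b test τ J D) (hT₀ : T₀ ∈ S) {m : Memory}
    (hg : Glob I T₀ m) (hJ : J m) :
    Ends (dp b test) m (2000 * I.radix ^ 6 * (τ + 1)) fun m' =>
      Stage I T₀ S b J D I.states m' ∧ Frame (dp b test) m m' := by
  have hb := hT.base
  refine Ends.frame (Ends.imp (Ends.seq (clear_ends hb hg) fun m₁ hm₁ => Ends.seq (k := 100)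
    (Q := fun m₂ => Stage I T₀ S b J D 0 m₂ ∧ m₂.nat (b + 10) 0 = 0) ?_
      fun m₂ hm₂ => sweep_ends hT hm₂.1 hm₂.2) (dp_cost_le I τ) fun _ h => h)
  obtain ⟨h0, hfn, hfr⟩ := hm₁
  have en₁ : ∀ a < 100, m₁.nat a = m.nat a := fun a ha => hfn a fun hw => by
    have := clear_writesNat hw
    omega
  have er₁ : ∀ a, m₁.real a = m.real a := fun a => hfr a fun hw => by
    simp [clear, Prog.block, Prog.WritesReal] at hw
  have hg₁ := hg.congr (fun a ha => en₁ a (by omega)) (fun a _ _ => er₁ a)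
  have hJ₁ := (hT.congr m m₁ en₁ (fun a _ => er₁ a) hJ).1
  refine Ends.imp (Ends.frame (Prog.Straight.ends (P := initTab b) (s := m₁) (k := 100)
    (Q := fun m₂ => tab b m₂ = ((tab b m₁).put 0 T₀ (fun _ => 0) (m₁.nat (b + 1) 0)) ∧
      m₂.nat (b + 10) 0 = 0)
    (by simp [initTab, Prog.block, Prog.Straight]) (Nat.le_of_ble_eq_true rfl) ?_)) le_rfl ?_
  · have e9 : (9 : ℕ) ≠ b := by omega
    refine ⟨?_, ?_⟩
    · simp only [tab, Tab.put, initTab, Prog.block, Prog.exec, NExp.eval, RExp.eval,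
        Memory.setNat_nat, Memory.setNat_real, Memory.setReal_nat, Memory.setReal_real, hg₁.start]
      congr 1
      · simp
      · simp
      · funext l
        fin_cases l <;> simp
      · simp
    · simp [initTab, Prog.block, Prog.exec, NExp.eval, Memory.setNat_nat]
  · rintro m₂ ⟨⟨htab, hz⟩, hgn, hgr⟩
    have en₂ : ∀ a < 100, m₂.nat a = m₁.nat a := fun a ha => hgn a fun hw => by
      have := initTab_writesNat hw
      omega
    have er₂ : ∀ a < 100, m₂.real a = m₁.real a := fun a ha => hgr a fun hw => by
      have := initTab_writesReal hw
      omega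
    refine ⟨⟨hg₁.congr (fun a ha => en₂ a (by omega)) (fun a ha _ => er₂ a (by omega)),
      (hT.congr m₁ m₂ en₂ er₂ hJ₁).1, fun d hd => ?_⟩, hz⟩
    -- Only the flags have been cleared: stale values, positions and predecessors are harmless
    -- because the invariants look at flagged entries alone.
    have hflag : ∀ u < I.states, 0 < (tab b m₂).flag u → u = 0 := by
      intro u hu hf
      by_contra hu0
      rw [htab] at hf
      simp only [Tab.put, Function.update_of_ne hu0, tab, h0 u hu] at hf
      exact absurd hf (lt_irrefl _)
    have hpos : ∀ l, (tab b m₂).pos l 0 = 0 := by simp [htab, Tab.put]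
    have hval : (tab b m₂).val 0 = T₀ := by simp [htab, Tab.put]
    refine ⟨⟨by simp [htab, Tab.put], hval, hpos, ?_, ?_, ?_, ?_⟩, ?_⟩
    · intro u hu hf
      obtain rfl := hflag u hu hf
      simp [idx, hpos]
    · intro u hu hf l
      obtain rfl := hflag u hu hf
      simp [hpos]
    · intro u hu hf
      obtain rfl := hflag u hu hf
      rwa [hval]
    · intro u hu hf hu0
      exact absurd (hflag u hu hf) hu0
    · intro q _ _ a c s _ _ hq
      exact absurd hq (Nat.not_lt_zero q)

/-- After the dynamic program has run with a set of possible delay bounds, each of these is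
feasible if and only if the full prefix has been reached. -/
theorem Stage.feas_iff {m : Memory} (h : Stage I T₀ S b J D I.states m)
    (hT₀ : ∀ p, T₀ ≤ I.release p) {d : ℝ} (hd : d ∈ D m) (hd0 : 0 < I.size ∨ 0 ≤ d) :
    I.Feas d ↔ 0 < m.nat b (m.nat 27 0) := by
  rw [h.glob.final]
  obtain ⟨h1, h2⟩ := h.inv d hd
  exact ⟨fun hf => (h2.mono fun q hq _ _ _ _ _ _ _ => hq).flag_of_feas h1 hT₀ hd0 hf,
    fun hf => h1.feas hf⟩

end

end Platoon

/-! ### The decision program and the initial computations -/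

namespace Platoon

open Crossing

section

variable {I : Crossing} {T₀ : ℝ} {S : AddSubgroup ℝ}

/-- Compare a delay with the delay bound in real array `8`. -/
def decTest : Prog :=
  .branch (.rle (.var 106) (.var 8)) (.nvar 112 (.lit 1)) (.nvar 112 (.lit 0))

/-- Decide whether the delay bound in real array `8` is feasible. -/
def dec : Prog := dp 100 decTest

/-- Here the bound is known, so the set of possible bounds is a singleton and the test is a plain
comparison. -/
theorem decTest_spec (hr : ∀ l i, I.rel l i ∈ S) (hl : ∀ l i, I.ln l i ∈ S) (d : ℝ) :
    TestSpec I T₀ S 100 decTest 20 (fun m => m.real 8 0 = d) (fun _ => {d}) where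
  base := le_rfl
  nonempty _ _ := Set.singleton_nonempty d
  congr m m' _ h hd := ⟨by rw [h 8 (by omega), hd], rfl⟩
  writesNat a h := by
    simp [decTest, Prog.WritesNat] at h
    omega
  writesReal a h := by
    simp [decTest, Prog.WritesReal] at h
  ends m _ hd _ := by
    refine Prog.Straight.ends (by simp [decTest, Prog.Straight]) (Nat.le_of_ble_eq_true rfl) ?_
    by_cases h : m.real 106 0 ≤ m.real 8 0
    · simp [decTest, Prog.exec, BExp.eval, RExp.eval, NExp.eval, Memory.setNat_nat,
        Memory.setNat_real, h, ← hd, lt_of_not_ge]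
    · simp [decTest, Prog.exec, BExp.eval, RExp.eval, NExp.eval, Memory.setNat_nat,
        Memory.setNat_real, h, ← hd, lt_of_not_ge]
  mem_rel := hr
  mem_ln := hl

theorem dec_writesNat {x : ℕ} (h : dec.WritesNat x) : 100 ≤ x ∧ x < 120 := by
  simp [dec, dp, clear, initTab, sweep, visit, loadPos, push, outerInit, outerLoop, innerInit,
    innerLoop, relax, relaxHead, relaxTail, decTest, outerDone, advance, Prog.block,
    Prog.WritesNat] at h
  omega

theorem dec_writesReal {x : ℕ} (h : dec.WritesReal x) : 100 ≤ x ∧ x < 120 := by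
  simp [dec, dp, clear, initTab, sweep, visit, loadPos, push, outerInit, outerLoop, innerInit,
    innerLoop, relax, relaxHead, relaxTail, decTest, outerDone, advance, Prog.block,
    Prog.WritesReal] at h
  omega

theorem dec_ends (hr : ∀ l i, I.rel l i ∈ S) (hl : ∀ l i, I.ln l i ∈ S) (hT₀ : T₀ ∈ S)
    (hT₀' : ∀ p, T₀ ≤ I.release p) {m : Memory} (hg : Glob I T₀ m) :
    Ends dec m (42000 * I.radix ^ 6) fun m' =>
      (Glob I T₀ m' ∧ (tab 100 m').Sound I T₀ S (m.real 8 0) I.states ∧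
        (0 < I.size ∨ 0 ≤ m.real 8 0 →
          (I.Feas (m.real 8 0) ↔ 0 < m'.nat 100 (m'.nat 27 0)))) ∧ Frame dec m m' := by
  refine Ends.imp (dp_ends (decTest_spec hr hl (m.real 8 0)) hT₀ hg rfl) (by omega) ?_
  rintro m' ⟨h, hf⟩
  exact ⟨⟨h.glob, (h.inv _ rfl).1, fun h0 => h.feas_iff hT₀' rfl h0⟩, hf⟩

/-- The memory contains the instance. -/
structure Inp (I : Crossing) (m : Memory) : Prop where
  count : ∀ l : Fin 4, m.nat 0 l = I.count l
  rel : ∀ l : Fin 4, m.real l = I.rel l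
  ln : ∀ l : Fin 4, m.real (4 + l) = I.ln l

theorem inp_input (I : Crossing) (d : ℝ) : Inp I (I.input d) := by
  refine ⟨fun l => ?_, fun l => ?_, fun l => ?_⟩
  · simp [input]
  · funext i
    simp [input, Crossing.rel]
  · funext i
    have : ¬ 4 + (l : ℕ) < 4 := by omega
    simp [input, Crossing.ln, this]

theorem Inp.congr {m m' : Memory} (h : Inp I m) (hn : m'.nat 0 = m.nat 0)
    (hr : ∀ a < 8, m'.real a = m.real a) : Inp I m' := by
  refine ⟨fun l => ?_, fun l => ?_, fun l => ?_⟩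
  · rw [hn, h.count]
  · rw [hr l (by omega), h.rel]
  · rw [hr (4 + l) (by omega), h.ln]

/-- Tabulate the multiples of variable `29` and multiply this variable by the radix. -/
def mkPow (l : ℕ) : Prog := .seq (.block [.nset (20 + l) (.lit 0) (.lit 0), .nvar 30 (.lit 0)])
  (.seq (.loop (.nle (.add (.var 30) (.lit 1)) (.var 28)) (.block [
    .nset (20 + l) (.add (.var 30) (.lit 1)) (.add (.get (20 + l) (.var 30)) (.var 29)),
    .nvar 30 (.add (.var 30) (.lit 1))]))
  (.nvar 29 (.get (20 + l) (.var 28))))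

/-- The machine cannot multiply. Multiples are tabulated by repeated addition, and the last entry `M
* x` is the next power. -/
theorem mkPow_ends {l : ℕ} (hl : l < 6) {m : Memory} {M x : ℕ} (hM : m.nat 28 0 = M)
    (hx : m.nat 29 0 = x) : Ends (mkPow l) m (M * 60 + 60) fun m' =>
      ((∀ i ≤ M, m'.nat (20 + l) i = i * x) ∧ m'.nat 29 0 = M * x) ∧ Frame (mkPow l) m m' := by
  have e1 : 28 ≠ 20 + l := by omega
  have e2 : 29 ≠ 20 + l := by omega
  have e3 : 30 ≠ 20 + l := by omega
  have e1' : 20 + l ≠ 28 := by omega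
  have e2' : 20 + l ≠ 29 := by omega
  have e3' : 20 + l ≠ 30 := by omega
  refine Ends.frame (Ends.imp (Ends.seq (k := 20) (k' := M * 60 + 40)
    (Q := fun m => m.nat 28 0 = M ∧ m.nat 29 0 = x ∧ m.nat 30 0 = 0 ∧ m.nat (20 + l) 0 = 0)
    (Prog.Straight.ends (by simp [Prog.block, Prog.Straight]) (Nat.le_of_ble_eq_true rfl) ?_)
    fun m₁ hm₁ => Ends.imp (Ends.seq (Q' := fun m' => (∀ i ≤ M, m'.nat (20 + l) i = i * x) ∧
      m'.nat 29 0 = M * x) (k' := 20) (Ends.loop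
      (fun m => m.nat 28 0 = M ∧ m.nat 29 0 = x ∧ m.nat 30 0 ≤ M ∧
        ∀ i ≤ m.nat 30 0, m.nat (20 + l) i = i * x) (fun m => M - m.nat 30 0) (k := 40) ?_ ?_)
        fun m₂ hm₂ => Prog.Straight.ends (by exact trivial) (Nat.le_of_ble_eq_true rfl) ?_)
      ?_ fun _ h => h) (by omega) fun _ h => h)
  · simp [Prog.block, Prog.exec, NExp.eval, Memory.setNat_nat, hM, hx, e1, e2, e3']
  · rintro m₂ ⟨h1, h2, h3, h4⟩ hcond
    have hlt : m₂.nat 30 0 < M := by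
      simp only [BExp.eval, NExp.eval, h1] at hcond
      exact hcond
    refine Prog.Straight.ends (by simp [Prog.block, Prog.Straight]) (Nat.le_of_ble_eq_true rfl) ?_
    simp only [Prog.block, Prog.exec, NExp.eval, Memory.setNat_nat]
    refine ⟨⟨by simpa [e1] using h1, by simpa [e2] using h2, by simpa [e3] using hlt, ?_⟩, ?_⟩
    · intro i hi
      have hi : i ≤ m₂.nat 30 0 + 1 := by simpa [e3] using hi
      by_cases h5 : i = m₂.nat 30 0 + 1
      · simp [h5, e3', h4, h2]
        ring
      · simpa [h5, e3'] using h4 i (by omega)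
    · simp [e3]
      omega
  · refine ⟨hm₁.1, hm₁.2.1, by omega, fun i hi => ?_⟩
    rw [hm₁.2.2.1, Nat.le_zero] at hi
    rw [hi, hm₁.2.2.2, zero_mul]
  · obtain ⟨⟨h1, h2, h3, h4⟩, hcond⟩ := hm₂
    have h5 : m₂.nat 30 0 = M := by
      simp only [BExp.eval, NExp.eval, h1, not_le] at hcond
      omega
    rw [h5] at h4
    refine ⟨fun i hi => ?_, ?_⟩
    · simpa [Prog.exec, NExp.eval, Memory.setNat_nat, e2'] using h4 i hi
    · simpa [Prog.exec, NExp.eval, Memory.setNat_nat, h1] using h4 M le_rfl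
  · have : M - m₁.nat 30 0 ≤ M := Nat.sub_le _ _
    have := loop_cost_le (z := 20) this (show 40 + (BExp.nle (.add (.var 30) (.lit 1))
      (.var 28)).cost + 1 ≤ 60 by simp [BExp.cost, NExp.cost])
      (show (BExp.nle (.add (.var 30) (.lit 1)) (.var 28)).cost + 1 ≤ 20 by
        simp [BExp.cost, NExp.cost])
    omega

/-- Tabulate the multiples of the first `k` powers of the radix. -/
def mkPows : ℕ → Prog
  | 0 => .nvar 29 (.lit 1)
  | k + 1 => .seq (mkPows k) (mkPow k)

theorem mkPow_writesNat {k x : ℕ} (h : (mkPow k).WritesNat x) : x = 20 + k ∨ x = 29 ∨ x = 30 := by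
  simp [mkPow, Prog.block, Prog.WritesNat] at h
  omega

theorem mkPow_writesReal {k x : ℕ} : ¬ (mkPow k).WritesReal x := by
  simp [mkPow, Prog.block, Prog.WritesReal]

theorem mkPows_writesNat {k x : ℕ} (hk : k ≤ 6) (h : (mkPows k).WritesNat x) :
    (20 ≤ x ∧ x < 26) ∨ x = 29 ∨ x = 30 := by
  induction k with
  | zero => exact Or.inr (Or.inl h)
  | succ k ih =>
    rcases h with h | h
    · exact ih (by omega) h
    · have := mkPow_writesNat h
      omega

theorem mkPows_writesReal {k x : ℕ} : ¬ (mkPows k).WritesReal x := by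
  induction k with
  | zero => exact id
  | succ k ih => exact fun h => h.elim ih mkPow_writesReal

theorem mkPows_ends {k : ℕ} (hk : k ≤ 6) {m : Memory} {M : ℕ} (hM : m.nat 28 0 = M) :
    Ends (mkPows k) m (k * (M * 60 + 60) + 10) fun m' =>
      ((∀ l < k, ∀ i ≤ M, m'.nat (20 + l) i = i * M ^ l) ∧ m'.nat 29 0 = M ^ k) ∧
      Frame (mkPows k) m m' := by
  refine Ends.frame ?_
  induction k with
  | zero =>
    refine Prog.Straight.ends (by exact trivial) (Nat.le_of_ble_eq_true rfl) ?_
    simp [mkPows, Prog.exec, NExp.eval, Memory.setNat_nat]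
  | succ k ih =>
    refine Ends.imp (Ends.seq (Ends.frame (ih (by omega))) fun m₁ hm₁ => Ends.imp
      (mkPow_ends (x := M ^ k) (M := M) (by omega) ?_ hm₁.1.2) le_rfl ?_)
      (by rw [add_mul]; omega) fun _ h => h
    · rw [hm₁.2.1 _ fun hw => by
        have := mkPows_writesNat (by omega) hw
        omega, hM]
    · rintro m₂ ⟨⟨h1, h2⟩, h3⟩
      refine ⟨fun l hl i hi => ?_, by rw [h2, pow_succ, mul_comm]⟩
      rcases Nat.lt_succ_iff_lt_or_eq.1 hl with h4 | rfl
      · rw [h3.1 _ fun hw => by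
          have := mkPow_writesNat hw
          omega, hm₁.1.1 l h4 i hi]
      · exact h1 i hi

/-- Add the lengths and the absolute values of the release times of lane `l` to variable `12`. -/
def accLane (l : ℕ) : Prog := .seq (.nvar 30 (.lit 0))
  (.loop (.nle (.add (.var 30) (.lit 1)) (.get 0 (.lit l))) (.block [
    .rvar 12 (.add (.var 12) (.get (4 + l) (.var 30))),
    .branch (.rle (.lit 0) (.get l (.var 30))) (.rvar 12 (.add (.var 12) (.get l (.var 30))))
      (.rvar 12 (.sub (.var 12) (.get l (.var 30)))),
    .nvar 30 (.add (.var 30) (.lit 1))]))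

theorem accLane_ends (l : Fin 4) {m : Memory} (h : Inp I m) :
    Ends (accLane l) m (I.count l * 60 + 60) fun m' =>
      (Inp I m' ∧ m'.real 12 0 = m.real 12 0 +
        ∑ i ∈ Finset.range (I.count l), (I.ln l i + |I.rel l i|)) ∧ Frame (accLane l) m m' := by
  have e1 : 12 ≠ (l : ℕ) := by omega
  have e2 : 12 ≠ 4 + (l : ℕ) := by omega
  have e1' : (l : ℕ) ≠ 12 := by omega
  have e2' : 4 + (l : ℕ) ≠ 12 := by omega
  refine Ends.frame (Ends.imp (Ends.seq (k := 20) (k' := I.count l * 60 + 30)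
    (Q := fun m₁ => Inp I m₁ ∧ m₁.nat 30 0 = 0 ∧ m₁.real 12 0 = m.real 12 0)
    (Prog.Straight.ends (by exact trivial) (Nat.le_of_ble_eq_true rfl) ⟨?_, ?_, ?_⟩)
    fun m₁ hm₁ => Ends.imp (Ends.loop (fun m₂ => Inp I m₂ ∧ m₂.nat 30 0 ≤ I.count l ∧
      m₂.real 12 0 = m.real 12 0 + ∑ i ∈ Finset.range (m₂.nat 30 0), (I.ln l i + |I.rel l i|))
      (fun m => I.count l - m.nat 30 0) (k := 50) ?_ ⟨hm₁.1, ?_, ?_⟩) ?_ ?_)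
      (by omega) fun _ h => h)
  · exact h.congr (by simp [Prog.exec, Memory.setNat_nat]) fun _ _ => rfl
  · simp [Prog.exec, NExp.eval, Memory.setNat_nat]
  · simp [Prog.exec, Memory.setNat_real]
  · rintro m₂ ⟨h1, h2, h3⟩ hcond
    have hlt : m₂.nat 30 0 < I.count l := by
      simp only [BExp.eval, NExp.eval, h1.count] at hcond
      exact hcond
    refine Ends.imp (Ends.frame (Prog.Straight.ends (k := 50) (Q := fun m' =>
      m'.nat 30 0 = m₂.nat 30 0 + 1 ∧ m'.real 12 0 = m₂.real 12 0 +
        (I.ln l (m₂.nat 30 0) + |I.rel l (m₂.nat 30 0)|))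
      (by simp [Prog.block, Prog.Straight]) (Nat.le_of_ble_eq_true rfl) ?_)) le_rfl ?_
    · by_cases h0 : 0 ≤ I.rel l (m₂.nat 30 0)
      · simp [Prog.block, Prog.exec, NExp.eval, RExp.eval, BExp.eval, Memory.setNat_nat,
          Memory.setNat_real, Memory.setReal_nat, Memory.setReal_real, e1', h1.rel, h1.ln,
          h0, abs_of_nonneg h0, add_assoc]
      · simp [Prog.block, Prog.exec, NExp.eval, RExp.eval, BExp.eval, Memory.setNat_nat,
          Memory.setNat_real, Memory.setReal_nat, Memory.setReal_real, e1', h1.rel, h1.ln,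
          h0, abs_of_neg (not_le.1 h0), sub_eq_add_neg, add_assoc]
    · rintro m₃ ⟨⟨h4, h5⟩, hfn, hfr⟩
      refine ⟨⟨h1.congr (hfn 0 (by simp [Prog.block, Prog.WritesNat])) fun a ha => hfr a (by
        simp [Prog.block, Prog.WritesReal]; omega), by omega, ?_⟩, by omega⟩
      rw [h4, Finset.sum_range_succ, h5, h3, add_assoc]
  · rw [hm₁.2.1]
    exact Nat.zero_le _
  · rw [hm₁.2.1, hm₁.2.2]
    simp
  · refine loop_cost_le (Nat.sub_le _ _) ?_ ?_ <;> simp only [BExp.cost, NExp.cost] <;> omega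
  · rintro m' ⟨⟨h1, h2, h3⟩, hcond⟩
    have : m'.nat 30 0 = I.count l := by
      simp only [BExp.eval, NExp.eval, h1.count, not_le] at hcond
      omega
    exact ⟨h1, by rw [h3, this]⟩

theorem accLane_writesNat {k x : ℕ} (h : (accLane k).WritesNat x) : x = 30 := by
  simpa [accLane, Prog.block, Prog.WritesNat] using h

theorem accLane_writesReal {k x : ℕ} (h : (accLane k).WritesReal x) : x = 12 := by
  simpa [accLane, Prog.block, Prog.WritesReal] using h

/-- Compute the radix. -/
def initRadix : Prog := .nvar 28 (.add (.add (.add (.add (.get 0 (.lit 0)) (.get 0 (.lit 1)))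
  (.get 0 (.lit 2))) (.get 0 (.lit 3))) (.lit 1))

/-- Compute the number of prefixes and the number of the full prefix. -/
def initStates : Prog := .block [
  .nvar 26 (.get 23 (.var 28)),
  .nvar 27 (.add (.add (.add (.get 20 (.get 0 (.lit 0))) (.get 21 (.get 0 (.lit 1))))
    (.get 22 (.get 0 (.lit 2)))) (.get 23 (.get 0 (.lit 3)))),
  .rvar 12 (.lit 0)]

/-- Compute the tables and numbers that depend on the numbers of platoons only. -/
def initTables : Prog := .seq initRadix (.seq (mkPows 6) initStates)

theorem initTables_writesNat {x : ℕ} (h : initTables.WritesNat x) : 20 ≤ x ∧ x < 31 := by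
  rcases h with h | h | h
  · have : x = 28 := h
    omega
  · have := mkPows_writesNat le_rfl h
    omega
  · simp [initStates, Prog.block, Prog.WritesNat] at h
    omega

theorem initTables_writesReal {x : ℕ} (h : initTables.WritesReal x) : x = 12 := by
  rcases h with h | h | h
  · exact h.elim
  · exact (mkPows_writesReal h).elim
  · simpa [initStates, Prog.block, Prog.WritesReal] using h

/-- Four tables suffice to number the prefixes. Six powers are formed so that variable `29` receives
`radix ^ 6`, the cap on the number of doublings. -/
theorem initTables_ends {m : Memory} (h : Inp I m) :
    Ends initTables m (6 * (I.radix * 60 + 60) + 100) fun m' =>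
      ((∀ l : Fin 4, ∀ i < I.radix, m'.nat (20 + l) i = i * I.radix ^ (l : ℕ)) ∧
        m'.nat 26 0 = I.states ∧ m'.nat 27 0 = I.idx I.count ∧ m'.nat 29 0 = I.radix ^ 6 ∧
        m'.real 12 0 = 0) ∧ Frame initTables m m' := by
  refine Ends.frame (Ends.imp (Ends.seq (k := 30) (Q := fun m => m.nat 28 0 = I.radix ∧
    ∀ l : Fin 4, m.nat 0 l = I.count l)
    (Prog.Straight.ends (by exact trivial) (Nat.le_of_ble_eq_true rfl) ⟨?_, ?_⟩) fun m₁ hm₁ =>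
    Ends.seq (k' := 50) (mkPows_ends le_rfl hm₁.1) fun m₂ hm₂ =>
      (Prog.Straight.ends (by simp [initStates, Prog.block, Prog.Straight])
      (Nat.le_of_ble_eq_true rfl) ?_)) (by omega) fun _ h => h)
  · have h0 := h.count 0
    have h1 := h.count 1
    have h2 := h.count 2
    have h3 := h.count 3
    simp only [Fin.val_zero, Fin.val_one, Fin.val_two, show ((3 : Fin 4) : ℕ) = 3 from rfl]
      at h0 h1 h2 h3
    simp [initRadix, Prog.exec, NExp.eval, Memory.setNat_nat, radix, size, Fin.sum_univ_four,
      h0, h1, h2, h3]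
  · intro l
    simpa [initRadix, Prog.exec, Memory.setNat_nat] using h.count l
  · obtain ⟨⟨h1, h2⟩, hfn, -⟩ := hm₂
    have hcnt : ∀ l : Fin 4, m₂.nat 0 l = I.count l := fun l => by
      rw [hfn 0 fun hw => by
        have := mkPows_writesNat le_rfl hw
        omega, hm₁.2]
    have h28 : m₂.nat 28 0 = I.radix := by
      rw [hfn 28 fun hw => by
        have := mkPows_writesNat le_rfl hw
        omega, hm₁.1]
    have hw : ∀ l : Fin 4, m₂.nat (20 + l) (m₂.nat 0 l) = I.count l * I.radix ^ (l : ℕ) :=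
      fun l => by
        rw [hcnt]
        exact h1 l (by omega) _ (count_lt_radix l).le
    have e0 : m₂.nat 20 (m₂.nat 0 0) = _ := hw 0
    have e1 : m₂.nat 21 (m₂.nat 0 1) = _ := hw 1
    have e2 : m₂.nat 22 (m₂.nat 0 2) = _ := hw 2
    have e3 : m₂.nat 23 (m₂.nat 0 3) = _ := hw 3
    have e4 : m₂.nat 23 (m₂.nat 28 0) = I.states := by
      rw [h28]
      refine (h1 3 (by omega) _ le_rfl).trans ?_
      rw [states]
      ring
    refine ⟨fun l i hi => ?_, ?_, ?_, ?_, ?_⟩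
    · have e5 : 20 + (l : ℕ) ≠ 26 := by omega
      have e6 : 20 + (l : ℕ) ≠ 27 := by omega
      simpa [initStates, Prog.block, Prog.exec, Memory.setNat_nat, Memory.setReal_nat, e5, e6]
        using h1 l (by omega) i hi.le
    · simpa [initStates, Prog.block, Prog.exec, NExp.eval, Memory.setNat_nat,
        Memory.setReal_nat] using e4
    · simp [initStates, Prog.block, Prog.exec, NExp.eval, Memory.setNat_nat,
        Memory.setReal_nat, e0, e1, e2, e3, idx, Fin.sum_univ_four]
    · simpa [initStates, Prog.block, Prog.exec, NExp.eval, Memory.setNat_nat,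
        Memory.setReal_nat] using h2
    · simp [initStates, Prog.block, Prog.exec, RExp.eval, NExp.eval, Memory.setReal_real]

/-- Compute the constants used by the other programs. -/
def init : Prog := .seq initTables (.seq (accLane (0 : Fin 4)) (.seq (accLane (1 : Fin 4))
  (.seq (accLane (2 : Fin 4)) (.seq (accLane (3 : Fin 4)) (.rvar 9 (.sub (.lit 0) (.var 12)))))))

theorem init_writesReal {x : ℕ} (h : init.WritesReal x) : x = 9 ∨ x = 12 := by
  rcases h with h | h | h | h | h | h
  · exact Or.inr (initTables_writesReal h)
  iterate 4 exact Or.inr (accLane_writesReal h)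
  exact Or.inl h

theorem init_ends {m : Memory} (h : Inp I m) : Ends init m (2000 * I.radix) fun m' =>
    (Glob I (-I.total) m' ∧ m'.nat 29 0 = I.radix ^ 6 ∧ m'.real 12 0 = I.total) ∧
      Frame init m m' := by
  have hM : 1 ≤ I.radix := radix_pos
  have hc := fun l => I.count_lt_radix l
  refine Ends.frame (Ends.imp (Ends.seq (initTables_ends h) fun m₁ hm₁ =>
    Ends.seq (accLane_ends (I := I) 0 ?_) fun m₂ hm₂ =>
    Ends.seq (accLane_ends 1 hm₂.1.1) fun m₃ hm₃ =>
    Ends.seq (accLane_ends 2 hm₃.1.1) fun m₄ hm₄ =>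
    Ends.seq (k' := 20) (accLane_ends 3 hm₄.1.1) fun m₅ hm₅ => Ends.imp (Ends.frame
      (Q := fun m' => m'.real 9 0 = 0 - m₅.real 12 0)
      (Prog.Straight.ends (by exact trivial) (Nat.le_of_ble_eq_true rfl) ?_)) le_rfl ?_) ?_
      fun _ h => h)
  · exact h.congr (hm₁.2.1 0 fun hw => by
      have := initTables_writesNat hw
      omega) fun a ha => hm₁.2.2 a fun hw => by
        have := initTables_writesReal hw
        omega
  · simp [Prog.exec, RExp.eval, NExp.eval, Memory.setReal_real]
  · rintro m₆ ⟨h9, hfn, hfr⟩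
    have i₅ := hm₅.1.1
    have hn : ∀ a, a ≠ 30 → m₆.nat a = m₁.nat a := fun a ha => by
      rw [hfn a (by simp [Prog.WritesNat]), hm₅.2.1 a fun hw => ha (accLane_writesNat hw),
        hm₄.2.1 a fun hw => ha (accLane_writesNat hw),
        hm₃.2.1 a fun hw => ha (accLane_writesNat hw),
        hm₂.2.1 a fun hw => ha (accLane_writesNat hw)]
    have h12 : m₅.real 12 0 = I.total := by
      rw [hm₅.1.2, hm₄.1.2, hm₃.1.2, hm₂.1.2, hm₁.1.2.2.2.2, total, Fin.sum_univ_four, zero_add]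
    have hr : ∀ a, a ≠ 9 → m₆.real a = m₅.real a := fun a ha => hfr a (by
      simpa [Prog.WritesReal] using ha)
    have i₆ : Inp I m₆ := i₅.congr (hfn 0 (by simp [Prog.WritesNat])) fun a ha => hr a (by omega)
    obtain ⟨⟨k1, k2, k3, k4, -⟩, -⟩ := hm₁
    refine ⟨⟨i₆.count, i₆.rel, i₆.ln, fun l i hi => ?_, ?_, ?_, ?_⟩, ?_, ?_⟩
    · rw [hn _ (by omega), k1 l i hi]
    · rw [hn _ (by omega), k2]
    · rw [hn _ (by omega), k3]
    · rw [h9, h12, zero_sub]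
    · rw [hn _ (by omega), k4]
    · rw [hr _ (by omega), h12]
  · have h0 := hc 0
    have h1 := hc 1
    have h2 := hc 2
    have h3 := hc 3
    omega

/-- The empty prefix needs a time that delays nobody, even when release times are negative. -/
theorem neg_total_le (p : I.Plat) : -I.total ≤ I.release p :=
  (neg_le_neg (abs_release_le_total p)).trans (neg_abs_le _)

/-- Decide whether there is a valid schedule whose delay is at most the given bound. -/
def decideDelay : Prog := .seq init (.seq dec (.branch
  (.and (.nle (.lit 1) (.get 100 (.var 27))) (.rle (.lit 0) (.var 8)))
  (.nvar 0 (.lit 1)) (.nvar 0 (.lit 0))))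

theorem delay_le_iff {d : ℝ} (hd : 0 ≤ d) (c : I.Schedule) :
    I.delay c ≤ d ↔ ∀ p, c p - I.release p ≤ d :=
  ⟨fun h p => (le_ciSup (f := fun p => c p - I.release p) (Set.finite_range _).bddAbove p).trans h,
    fun h => Real.iSup_le h hd⟩

theorem delay_nonneg {c : I.Schedule} (hc : I.Valid c) : 0 ≤ I.delay c :=
  Real.iSup_nonneg fun p => sub_nonneg.2 (hc.release_le p)

theorem decideDelay_ends (I : Crossing) (d : ℝ) :
    Ends decideDelay (I.input d) (2000 * I.radix + (42000 * I.radix ^ 6 + 30)) fun m' =>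
      m'.nat 0 0 = 1 ↔ ∃ c : I.Schedule, I.Valid c ∧ I.delay c ≤ d := by
  have h8 : (I.input d).real 8 0 = d := by simp [input]
  -- Deciding a single bound requires no integrality, so `S` is everything.
  refine Ends.seq (init_ends (inp_input I d)) fun m₁ hm₁ => Ends.seq (dec_ends (S := ⊤)
    (fun _ _ => trivial) (fun _ _ => trivial) trivial neg_total_le hm₁.1.1) fun m₂ hm₂ =>
    Prog.Straight.ends (by simp [Prog.Straight]) (Nat.le_of_ble_eq_true rfl) ?_
  have h8₁ : m₁.real 8 0 = d := by
    rw [hm₁.2.2 8 fun hw => by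
      have := init_writesReal hw
      omega, h8]
  have h8₂ : m₂.real 8 0 = d := by
    rw [hm₂.2.2 8 fun hw => by
      have := dec_writesReal hw
      omega, h8₁]
  obtain ⟨⟨-, -, hiff⟩, -⟩ := hm₂
  rw [h8₁] at hiff
  by_cases hd : 0 ≤ d
  · have : (∃ c : I.Schedule, I.Valid c ∧ I.delay c ≤ d) ↔ I.Feas d := by
      simp only [delay_le_iff hd, Feas]
    rw [this, hiff (Or.inr hd)]
    by_cases hf : 0 < m₂.nat 100 (m₂.nat 27 0)
    · simp [Prog.exec, BExp.eval, NExp.eval, RExp.eval, Memory.setNat_nat, h8₂, hd, hf,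
        Nat.one_le_iff_ne_zero, hf.ne']
    · simp [Prog.exec, BExp.eval, NExp.eval, RExp.eval, Memory.setNat_nat, h8₂, hd,
        Nat.eq_zero_of_not_pos hf]
  -- For a negative bound the explicit comparison with `0` answers no. It is indispensable without
  -- platoons: every bound is then feasible in the sense of `Feas`, while the delay is `0`.
  · have : ¬ ∃ c : I.Schedule, I.Valid c ∧ I.delay c ≤ d := fun ⟨c, hc, hcd⟩ =>
      hd ((delay_nonneg hc).trans hcd)
    simp [Prog.exec, BExp.eval, NExp.eval, RExp.eval, Memory.setNat_nat, h8₂, hd, this]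

end

end Platoon

/-! ### Bisection and parametric search -/

namespace Platoon

open Crossing

section

variable {I : Crossing} {T₀ : ℝ} {S : AddSubgroup ℝ}

/-- What the programs below rely on: `T₀` precedes all release times, and all times belong to
the group `S`. -/
structure Times (I : Crossing) (T₀ : ℝ) (S : AddSubgroup ℝ) : Prop where
  mem_rel : ∀ l i, I.rel l i ∈ S
  mem_ln : ∀ l i, I.ln l i ∈ S
  mem_start : T₀ ∈ S
  start_le : ∀ p, T₀ ≤ I.release p

/-- Replace the lower bound (in variable `11`) or the upper bound (in variable `10`) of the minimum
delay by the delay bound in variable `8`. -/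
def probe : Prog := .seq dec (.branch (.nle (.lit 1) (.get 100 (.var 27)))
  (.rvar 10 (.var 8)) (.rvar 11 (.var 8)))

theorem probe_writesNat {x : ℕ} (h : probe.WritesNat x) : 100 ≤ x ∧ x < 120 := by
  rcases h with h | h | h
  exacts [dec_writesNat h, h.elim, h.elim]

theorem probe_writesReal {x : ℕ} (h : probe.WritesReal x) :
    x = 10 ∨ x = 11 ∨ (100 ≤ x ∧ x < 120) := by
  rcases h with h | h | h
  exacts [Or.inr (Or.inr (dec_writesReal h)), Or.inl h, Or.inr (Or.inl h)]

theorem probe_ends (hT : Times I T₀ S) (hn : 0 < I.size) {m : Memory} (hg : Glob I T₀ m) :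
    Ends probe m (42000 * I.radix ^ 6 + 30) fun m' =>
      (Glob I T₀ m' ∧
        ((I.Feas (m.real 8 0) ∧ m'.real 10 0 = m.real 8 0 ∧ m'.real 11 0 = m.real 11 0) ∨
        (¬ I.Feas (m.real 8 0) ∧ m'.real 10 0 = m.real 10 0 ∧ m'.real 11 0 = m.real 8 0))) ∧
      Frame probe m m' := by
  refine Ends.frame (Ends.seq (dec_ends hT.mem_rel hT.mem_ln hT.mem_start hT.start_le hg)
    fun m₁ hm₁ => ?_)
  obtain ⟨⟨hg₁, -, hiff⟩, -, hfr⟩ := hm₁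
  have er : ∀ a < 100, m₁.real a = m.real a := fun a ha => hfr a fun hw => by
    have := dec_writesReal hw
    omega
  have hiff := hiff (Or.inl hn)
  refine Prog.Straight.ends (by simp [Prog.Straight]) (Nat.le_of_ble_eq_true rfl) ⟨?_, ?_⟩
  · refine hg₁.congr (fun a _ => ?_) (fun a ha _ => ?_)
    · simp only [Prog.exec]
      split <;> rfl
    · have e1 : a ≠ 10 := by omega
      have e2 : a ≠ 11 := by omega
      simp only [Prog.exec]
      split <;> simp [Memory.setReal_real, e1, e2]
  · by_cases hf : 0 < m₁.nat 100 (m₁.nat 27 0)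
    · left
      refine ⟨hiff.2 hf, ?_, ?_⟩ <;>
      simp [Prog.exec, BExp.eval, NExp.eval, RExp.eval, Memory.setReal_real, hf.ne',
        Nat.one_le_iff_ne_zero, er]
    · right
      refine ⟨fun h => hf (hiff.1 h), ?_, ?_⟩ <;>
      simp [Prog.exec, BExp.eval, NExp.eval, RExp.eval, Memory.setReal_real,
        Nat.eq_zero_of_not_pos hf, er]

/-- The variables `11` and `10` contain an infeasible and a feasible delay bound. -/
structure Bracket (I : Crossing) (m : Memory) : Prop where
  lo : ¬ I.Feas (m.real 11 0)
  hi : I.Feas (m.real 10 0)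

theorem Bracket.lt {m : Memory} (h : Bracket I m) : m.real 11 0 < m.real 10 0 :=
  not_le.1 fun h' => h.lo (h.hi.mono h')

/-- Start with the bounds `-1` and twice the contents of variable `12`, and tabulate powers of two
until they exceed the difference of the bounds, but at most as many as variable `29` says. -/
def doubling : Prog := .seq (.block [.rvar 11 (.sub (.lit 0) (.lit 1)),
    .rvar 10 (.add (.var 12) (.var 12)), .rset 13 (.lit 0) (.lit 1), .nvar 40 (.lit 0)])
  (.loop (.and (.nle (.add (.var 40) (.lit 1)) (.var 29))
      (.neg (.rle (.sub (.var 10) (.var 11)) (.get 13 (.var 40)))))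
    (.block [.rset 13 (.add (.var 40) (.lit 1)) (.add (.get 13 (.var 40)) (.get 13 (.var 40))),
      .nvar 40 (.add (.var 40) (.lit 1))]))

theorem doubling_writesNat {x : ℕ} (h : doubling.WritesNat x) : x = 40 := by
  simpa [doubling, Prog.block, Prog.WritesNat] using h

theorem doubling_writesReal {x : ℕ} (h : doubling.WritesReal x) :
    x = 10 ∨ x = 11 ∨ x = 13 := by
  simp [doubling, Prog.block, Prog.WritesReal] at h
  tauto

/-- The machine cannot halve, so the step widths of the bisection are prepared by doubling. Doubling
ends once the width `H + H + 1` of the bracket is covered or the cap `N` is reached. The bound on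
the last but one power later gives the logarithm. -/
theorem doubling_ends {m : Memory} {N : ℕ} {H : ℝ} (hN : m.nat 29 0 = N) (hH : m.real 12 0 = H) :
    Ends doubling m (N * 60 + 100) fun m' =>
      (m'.real 11 0 = -1 ∧ m'.real 10 0 = H + H ∧
      (∀ j ≤ m'.nat 40 0, m'.real 13 j = 2 ^ j) ∧ m'.nat 40 0 ≤ N ∧
      (m'.nat 40 0 = 0 ∨ (2 : ℝ) ^ (m'.nat 40 0 - 1) < H + H + 1) ∧
      (m'.nat 40 0 = N ∨ H + H + 1 ≤ 2 ^ m'.nat 40 0)) ∧ Frame doubling m m' := by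
  refine Ends.frame (Ends.imp (Ends.seq (k := 40) (k' := N * 60 + 40)
    (Q := fun m => m.nat 29 0 = N ∧ m.real 11 0 = -1 ∧ m.real 10 0 = H + H ∧
      m.real 13 0 = 1 ∧ m.nat 40 0 = 0)
    (Prog.Straight.ends (by simp [Prog.block, Prog.Straight]) (Nat.le_of_ble_eq_true rfl) ?_)
    fun m₁ hm₁ => Ends.imp (Ends.loop (fun m => m.nat 29 0 = N ∧ m.real 11 0 = -1 ∧
      m.real 10 0 = H + H ∧ (∀ j ≤ m.nat 40 0, m.real 13 j = 2 ^ j) ∧ m.nat 40 0 ≤ N ∧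
      (m.nat 40 0 = 0 ∨ (2 : ℝ) ^ (m.nat 40 0 - 1) < H + H + 1))
      (fun m => N - m.nat 40 0) (k := 35) ?_ ?_) ?_ ?_) (by omega) fun _ h => h)
  · simp [Prog.block, Prog.exec, NExp.eval, RExp.eval, Memory.setNat_nat, Memory.setNat_real,
      Memory.setReal_nat, Memory.setReal_real, hN, hH]
  · rintro m₂ ⟨h1, h2, h3, h4, h5, h6⟩ ⟨c1, c2⟩
    have hlt : m₂.nat 40 0 < N := by
      simp only [BExp.eval, NExp.eval, h1] at c1
      exact c1
    have c2 : (2 : ℝ) ^ m₂.nat 40 0 < H + H + 1 := by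
      simpa [BExp.eval, NExp.eval, RExp.eval, h2, h3, h4] using c2
    refine Prog.Straight.ends (by simp [Prog.block, Prog.Straight]) (Nat.le_of_ble_eq_true rfl) ?_
    simp only [Prog.block, Prog.exec, NExp.eval, RExp.eval, Memory.setNat_nat, Memory.setNat_real,
      Memory.setReal_nat, Memory.setReal_real]
    refine ⟨⟨by simpa using h1, by simpa using h2, by simpa using h3, ?_, by simpa using hlt, ?_⟩,
      ?_⟩
    · intro j hj
      have hj : j ≤ m₂.nat 40 0 + 1 := by simpa using hj
      by_cases h : j = m₂.nat 40 0 + 1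
      · simp [h, h4]
        ring
      · simpa [h] using h4 j (by omega)
    · simpa using c2
    · simp
      omega
  · obtain ⟨h1, h2, h3, h4, h5⟩ := hm₁
    refine ⟨h1, h2, h3, fun j hj => ?_, by omega, Or.inl h5⟩
    rw [h5, Nat.le_zero] at hj
    rw [hj, h4, pow_zero]
  · refine loop_cost_le (Nat.sub_le _ _) ?_ ?_ <;>
      simp only [BExp.cost, NExp.cost, RExp.cost] <;> omega
  · rintro m' ⟨⟨h1, h2, h3, h4, h5, h6⟩, hcond⟩
    refine ⟨h2, h3, h4, h5, h6, ?_⟩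
    by_contra! hc
    refine hcond ⟨?_, ?_⟩
    · simp only [BExp.eval, NExp.eval, h1]
      omega
    · simpa [BExp.eval, NExp.eval, RExp.eval, h2, h3, h4] using hc.2

/-- Bisection with the tabulated powers of two. -/
def bisect : Prog := .loop (.nle (.lit 1) (.var 40)) (.seq (.block [
    .nvar 40 (.sub (.var 40) (.lit 1)), .rvar 8 (.add (.var 11) (.get 13 (.var 40)))])
  (.branch (.rle (.var 10) (.var 8)) .skip probe))

/-- Each round tries the lower bound plus the next smaller power of two; whichever end moves, the
width is at most that power. If doubling was cut off by the cap, the bracket remains valid but need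
not be narrow, whence the implication in the conclusion. -/
theorem bisect_ends (hT : Times I T₀ S) (hn : 0 < I.size) {m : Memory} (hg : Glob I T₀ m)
    (hB : Bracket I m) (hlo : m.real 11 0 ∈ S) (hhi : m.real 10 0 ∈ S)
    (hpow : ∀ j ≤ m.nat 40 0, m.real 13 j = 2 ^ j) (h1 : (1 : ℝ) ∈ S) :
    Ends bisect m (m.nat 40 0 * (42000 * I.radix ^ 6 + 200) + 10) fun m' =>
      Glob I T₀ m' ∧ Bracket I m' ∧ m'.real 11 0 ∈ S ∧ m'.real 10 0 ∈ S ∧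
      (m.real 10 0 - m.real 11 0 ≤ 2 ^ m.nat 40 0 → m'.real 10 0 - m'.real 11 0 ≤ 1) := by
  refine Ends.imp (Ends.loop (fun m' => Glob I T₀ m' ∧ Bracket I m' ∧ m'.real 11 0 ∈ S ∧
    m'.real 10 0 ∈ S ∧ (∀ j ≤ m'.nat 40 0, m'.real 13 j = 2 ^ j) ∧
    (m.real 10 0 - m.real 11 0 ≤ 2 ^ m.nat 40 0 →
      m'.real 10 0 - m'.real 11 0 ≤ 2 ^ m'.nat 40 0)) (fun m => m.nat 40 0)
    (k := 42000 * I.radix ^ 6 + 100) ?_ ⟨hg, hB, hlo, hhi, hpow, fun h => h⟩) ?_ ?_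
  · rintro m₁ ⟨hg₁, hB₁, hlo₁, hhi₁, hpow₁, hw⟩ hcond
    obtain ⟨k, hk⟩ : ∃ k, m₁.nat 40 0 = k + 1 := Nat.exists_eq_add_of_le' (by
      simpa [BExp.eval, NExp.eval] using hcond)
    -- For integer data the ends of the bracket must stay integral.
    have hdS : m₁.real 11 0 + 2 ^ k ∈ S := by
      refine S.add_mem hlo₁ ?_
      have := S.nsmul_mem h1 (2 ^ k)
      simpa using this
    refine Ends.imp (Ends.seq (k := 40) (k' := 42000 * I.radix ^ 6 + 50) (Ends.frame
      (Q := fun m₂ => m₂.nat 40 0 = k ∧ m₂.real 8 0 = m₁.real 11 0 + 2 ^ k)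
      (Prog.Straight.ends (by simp [Prog.block, Prog.Straight]) (Nat.le_of_ble_eq_true rfl) ?_))
      fun m₂ hm₂ => ?_) (by omega) fun _ h => h
    · simp [Prog.block, Prog.exec, NExp.eval, RExp.eval, Memory.setNat_nat, Memory.setNat_real,
        Memory.setReal_nat, Memory.setReal_real, hk, hpow₁ k (by omega)]
    · obtain ⟨⟨h40, h8⟩, hfn, hfr⟩ := hm₂
      have en : ∀ a, a ≠ 40 → m₂.nat a = m₁.nat a := fun a ha => hfn a (by
        simpa [Prog.block, Prog.WritesNat] using ha)
      have er : ∀ a, a ≠ 8 → m₂.real a = m₁.real a := fun a ha => hfr a (by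
        simpa [Prog.block, Prog.WritesReal] using ha)
      have hg₂ := hg₁.congr (fun a _ => en a (by omega)) (fun a _ ha => er a ha)
      have e10 := er 10 (by omega)
      have e11 := er 11 (by omega)
      have e13 := er 13 (by omega)
      refine Ends.imp (Ends.branch (k := 42000 * I.radix ^ 6 + 30) (fun hc => ?_) (fun _ => ?_))
        (by simp only [BExp.cost, RExp.cost, NExp.cost]; omega) fun _ h => h
      · refine Prog.Straight.ends (P := .skip) trivial (by simp [Prog.cost]) ?_
        simp only [Prog.exec]
        have hc : m₁.real 10 0 ≤ m₁.real 11 0 + 2 ^ k := by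
          simpa [BExp.eval, RExp.eval, NExp.eval, e10, h8] using hc
        rw [h40, e10, e11, e13]
        refine ⟨⟨hg₂, ⟨by rw [e11]; exact hB₁.lo, by rw [e10]; exact hB₁.hi⟩, hlo₁, hhi₁,
          fun j hj => hpow₁ j (by omega), fun _ => by linarith⟩, by omega⟩
      · refine Ends.imp (probe_ends hT hn hg₂) le_rfl ?_
        rintro m₃ ⟨⟨hg₃, hres⟩, hgn, hgr⟩
        have e40 : m₃.nat 40 0 = k := by
          rw [hgn 40 fun hw => by
            have := probe_writesNat hw
            omega, h40]
        have e13' : m₃.real 13 = m₁.real 13 := by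
          rw [hgr 13 fun hw => by
            have := probe_writesReal hw
            omega, e13]
        rw [h8, e10, e11] at hres
        rw [e40, e13']
        rw [hk, pow_succ] at hw
        rcases hres with ⟨hf, k1, k2⟩ | ⟨hf, k1, k2⟩
        · refine ⟨⟨hg₃, ⟨by rw [k2]; exact hB₁.lo, by rw [k1]; exact hf⟩, by rwa [k2],
            by rwa [k1], fun j hj => hpow₁ j (by omega), fun _ => by rw [k1, k2]; linarith⟩,
            by omega⟩
        · refine ⟨⟨hg₃, ⟨by rw [k2]; exact hf, by rw [k1]; exact hB₁.hi⟩, by rwa [k2],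
            by rwa [k1], fun j hj => hpow₁ j (by omega), fun h => ?_⟩, by omega⟩
          have := hw h
          rw [k1, k2]
          linarith
  · refine loop_cost_le le_rfl ?_ ?_ <;> simp only [BExp.cost, NExp.cost] <;> omega
  · rintro m' ⟨⟨hg', hB', hlo', hhi', -, hw⟩, hcond⟩
    have h0 : m'.nat 40 0 = 0 := by simpa [BExp.eval, NExp.eval] using hcond
    rw [h0, pow_zero] at hw
    exact ⟨hg', hB', hlo', hhi', hw⟩

/-- Compare a delay with the minimum delay, refining the bounds if they do not settle the
question. -/
def refineTest : Prog := .seq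
  (.branch (.and (.neg (.rle (.var 206) (.var 11))) (.neg (.rle (.var 10) (.var 206))))
    (.seq (.rvar 8 (.var 206)) probe) .skip)
  (.branch (.rle (.var 10) (.var 206)) (.nvar 212 (.lit 0)) (.nvar 212 (.lit 1)))

/-- A delay outside the open bracket compares in the same way with all bounds in `[lo, hi)`. A delay
strictly inside is probed and becomes an end of the bracket, after which the same holds. `settled`
stands for the case in which no element of `S` lies strictly inside: then no probe is ever made, and
the test has constant cost. -/
theorem refineTest_spec (hT : Times I T₀ S) (hn : 0 < I.size) {settled : Prop} {τ : ℕ}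
    (hτ : 100 ≤ τ) (hτ' : ¬ settled → 42000 * I.radix ^ 6 + 200 ≤ τ) :
    TestSpec I T₀ S 200 refineTest τ
      (fun m => Bracket I m ∧ (settled → ∀ v ∈ S, ¬ (m.real 11 0 < v ∧ v < m.real 10 0)))
      (fun m => {d | m.real 11 0 ≤ d ∧ d < m.real 10 0}) where
  base := by omega
  nonempty m h := ⟨_, le_rfl, h.1.lt⟩
  congr m m' _ h hm := by
    rw [h 10 (by omega), h 11 (by omega)]
    exact ⟨⟨⟨by rw [h 11 (by omega)]; exact hm.1.lo, by rw [h 10 (by omega)]; exact hm.1.hi⟩,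
      hm.2⟩, rfl⟩
  writesNat a h := by
    rcases h with (h | h) | h
    · rcases h with h | h
      · exact h.elim
      · have := probe_writesNat h
        omega
    · exact h.elim
    · simp [Prog.WritesNat] at h
      omega
  writesReal a h := by
    rcases h with (h | h) | h
    · rcases h with h | h
      · exact Or.inl h
      · have := probe_writesReal h
        omega
    · exact h.elim
    · simp [Prog.WritesReal] at h
  ends m hg hm hv := by
    set v := m.real (200 + 6) 0 with hvdef
    refine Ends.imp (Ends.seq (k' := 20) (k := τ - 20) (Q := fun m₁ => (Bracket I m₁ ∧
      (settled → ∀ v ∈ S, ¬ (m₁.real 11 0 < v ∧ v < m₁.real 10 0))) ∧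
      m₁.real 206 0 = v ∧ m.real 11 0 ≤ m₁.real 11 0 ∧ m₁.real 10 0 ≤ m.real 10 0 ∧
      (v ≤ m₁.real 11 0 ∨ m₁.real 10 0 ≤ v)) ?_ fun m₁ hm₁ => ?_) (by omega) fun _ h => h
    · refine Ends.imp (Ends.branch (k := τ - 40) (fun hc => ?_) (fun hc => ?_))
        (by simp only [BExp.cost, RExp.cost, NExp.cost]; omega) fun _ h => h
      · have hc : m.real 11 0 < v ∧ v < m.real 10 0 := by
          simpa [BExp.eval, RExp.eval, NExp.eval] using hc
        have hs : ¬ settled := fun hs => hm.2 hs v hv hc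
        have hτ'' := hτ' hs
        refine Ends.imp (Ends.seq (k := 10) (k' := 42000 * I.radix ^ 6 + 30) (Ends.frame
          (Q := fun m₂ => m₂.real 8 0 = v) (Prog.Straight.ends (by exact trivial)
            (Nat.le_of_ble_eq_true rfl) ?_)) fun m₂ hm₂ => Ends.imp (probe_ends hT hn ?_) le_rfl
            ?_) (by omega) fun _ h => h
        · simp [Prog.exec, RExp.eval, NExp.eval, Memory.setReal_real, hvdef]
        all_goals
          obtain ⟨h8, hfn, hfr⟩ := hm₂
          have er : ∀ a, a ≠ 8 → m₂.real a = m.real a := fun a ha => hfr a (by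
            simpa [Prog.WritesReal] using ha)
        · exact hg.congr (fun a _ => hfn a (by simp [Prog.WritesNat])) (fun a _ ha => er a ha)
        · rintro m₃ ⟨⟨hg₃, hres⟩, hgn, hgr⟩
          have e206 : m₃.real 206 0 = v := by
            rw [hgr 206 fun hw => by
              have := probe_writesReal hw
              omega, er 206 (by omega)]
          rw [h8, er 10 (by omega), er 11 (by omega)] at hres
          rcases hres with ⟨hf, k1, k2⟩ | ⟨hf, k1, k2⟩
          -- A probe is made only if the bracket is not settled, so that clause holds vacuously.
          · exact ⟨⟨⟨by rw [k2]; exact hm.1.lo, by rw [k1]; exact hf⟩, fun h => absurd h hs⟩,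
              e206, k2.ge, k1.le.trans hc.2.le, Or.inr k1.le⟩
          · exact ⟨⟨⟨by rw [k2]; exact hf, by rw [k1]; exact hm.1.hi⟩, fun h => absurd h hs⟩,
              e206, hc.1.le.trans k2.ge, k1.le, Or.inl k2.ge⟩
      · have hc : v ≤ m.real 11 0 ∨ m.real 10 0 ≤ v := by
          rcases le_or_gt v (m.real 11 0) with h | h
          · exact Or.inl h
          · refine Or.inr ?_
            simpa [BExp.eval, RExp.eval, NExp.eval, ← hvdef, h] using hc
        exact Prog.Straight.ends (P := .skip) trivial (by simp only [Prog.cost]; omega)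
          ⟨hm, rfl, le_rfl, le_rfl, hc⟩
    · obtain ⟨hm₁, h206, hlo, hhi, hv'⟩ := hm₁
      refine Prog.Straight.ends (by simp [Prog.Straight]) (Nat.le_of_ble_eq_true rfl) ?_
      have er : (Prog.exec (.branch (.rle (.var 10) (.var 206)) (.nvar 212 (.lit 0))
          (.nvar 212 (.lit 1))) m₁).real = m₁.real := by
        simp only [Prog.exec]
        split <;> rfl
      refine ⟨⟨⟨by rw [er]; exact hm₁.1.lo, by rw [er]; exact hm₁.1.hi⟩, by rw [er]; exact hm₁.2⟩,
        ?_, ?_⟩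
      · rw [er]
        exact fun d hd => ⟨hlo.trans hd.1, hd.2.trans_le hhi⟩
      · rw [er]
        rintro d ⟨hd1, hd2⟩
        by_cases hc : m₁.real 10 0 ≤ v
        · have : ¬ v ≤ d := not_le.2 (hd2.trans_le hc)
          simp [Prog.exec, BExp.eval, RExp.eval, NExp.eval, Memory.setNat_nat, h206, hc, this]
        · have : v ≤ d := (hv'.resolve_right hc).trans hd1
          simp [Prog.exec, BExp.eval, RExp.eval, NExp.eval, Memory.setNat_nat, h206, hc, this]
  mem_rel := hT.mem_rel
  mem_ln := hT.mem_ln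

/-- Run the dynamic program for the unknown minimum delay, so as to make variable `10` contain
it. -/
def search : Prog := dp 200 refineTest

theorem search_ends (hT : Times I T₀ S) (hn : 0 < I.size) {settled : Prop} {τ : ℕ}
    (hτ : 100 ≤ τ) (hτ' : ¬ settled → 42000 * I.radix ^ 6 + 200 ≤ τ) {m : Memory}
    (hg : Glob I T₀ m) (hB : Bracket I m)
    (hs : settled → ∀ v ∈ S, ¬ (m.real 11 0 < v ∧ v < m.real 10 0)) :
    Ends search m (2000 * I.radix ^ 6 * (τ + 1)) fun m' =>
      Glob I T₀ m' ∧ I.Feas (m'.real 10 0) ∧ ∀ d < m'.real 10 0, ¬ I.Feas d := by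
  refine Ends.imp (dp_ends (refineTest_spec hT hn hτ hτ') hT.mem_start hg ⟨hB, hs⟩) le_rfl ?_
  rintro m' ⟨h, -⟩
  have hB' := h.amb.1
  refine ⟨h.glob, hB'.hi, fun d hd hf => ?_⟩
  -- Two bounds in the final interval are feasible or infeasible together, since the same flag
  -- decides both. The lower end is infeasible, hence so is everything below the upper end.
  have h1 := h.feas_iff hT.start_le (d := m'.real 11 0) ⟨le_rfl, hB'.lt⟩ (Or.inl hn)
  have h2 := h.feas_iff hT.start_le (d := max d (m'.real 11 0))
    ⟨le_max_right _ _, max_lt hd hB'.lt⟩ (Or.inl hn)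
  exact hB'.lo (h1.2 (h2.1 (hf.mono (le_max_left _ _))))

end

end Platoon

/-! ### Reading the schedule off the table -/

namespace Platoon

open Crossing

section

variable {I : Crossing} {T₀ : ℝ} {S : AddSubgroup ℝ}

/-- Write the crossing times of the platoons of lane `l` that are served in the phase from prefix
number `42` to prefix number `41` (both numbers are in variables). -/
def writeLane (l : ℕ) : Prog := .seq
  (.block [.nvar 43 (.get (102 + l) (.var 42)), .rvar 14 (.get 100 (.var 42))])
  (.loop (.nle (.add (.var 43) (.lit 1)) (.get (102 + l) (.var 41))) (.block [
    .branch (.rle (.get l (.var 43)) (.var 14)) (.rset l (.var 43) (.var 14)) .skip,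
    .rvar 14 (.add (.get l (.var 43)) (.get (4 + l) (.var 43))),
    .nvar 43 (.add (.var 43) (.lit 1))]))

theorem writeLane_writesNat {l x : ℕ} (h : (writeLane l).WritesNat x) : x = 43 := by
  simpa [writeLane, Prog.block, Prog.WritesNat] using h

theorem writeLane_writesReal {l x : ℕ} (h : (writeLane l).WritesReal x) : x = 14 ∨ x = l := by
  simp [writeLane, Prog.block, Prog.WritesReal] at h
  tauto

/-- Crossing times replace release times in the same array. Each release time is read just before
its cell is overwritten, so `hrel` is needed only for the cells before the end of the phase. -/
theorem writeLane_ends (l : Fin 4) {m : Memory} {t q : ℕ} (ht : m.nat 41 0 = t)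
    (hq : m.nat 42 0 = q) (hln : m.real (4 + l) = I.ln l)
    (hle : (tab 100 m).pos l q ≤ (tab 100 m).pos l t)
    (hcount : (tab 100 m).pos l t ≤ I.count l)
    (hrel : ∀ i < (tab 100 m).pos l t, m.real l i = I.rel l i) :
    Ends (writeLane l) m (I.radix * 60 + 60) fun m' =>
      ((∀ i, (tab 100 m).pos l q ≤ i → i < (tab 100 m).pos l t → m'.real l i =
        max (I.rel l i) (I.chain l ((tab 100 m).val q) ((tab 100 m).pos l q) i)) ∧
      ∀ i, (i < (tab 100 m).pos l q ∨ (tab 100 m).pos l t ≤ i) → m'.real l i = m.real l i) ∧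
      Frame (writeLane l) m m' := by
  set j := (tab 100 m).pos l q with hj
  set s := (tab 100 m).pos l t with hs
  set T := (tab 100 m).val q with hTdef
  have hj' : m.nat (102 + l) q = j := rfl
  have hs' : m.nat (102 + l) t = s := rfl
  have hT' : m.real 100 q = T := rfl
  have e1 : (l : ℕ) ≠ 14 := by omega
  have e2 : 4 + (l : ℕ) ≠ 14 := by omega
  have e3 : 102 + (l : ℕ) ≠ 43 := by omega
  have e4 : 4 + (l : ℕ) ≠ l := by omega
  have e5 : 14 ≠ (l : ℕ) := by omega
  refine Ends.frame (Ends.imp (Ends.seq (k := 20) (k' := I.radix * 60 + 30)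
    (Q := fun m₁ => m₁.nat 41 0 = t ∧ m₁.nat (102 + l) t = s ∧ m₁.real (4 + l) = I.ln l ∧
      m₁.real l = m.real l ∧ m₁.nat 43 0 = j ∧ m₁.real 14 0 = T)
    (Prog.Straight.ends (by simp [Prog.block, Prog.Straight]) (Nat.le_of_ble_eq_true rfl) ?_)
    fun m₁ hm₁ => Ends.imp (Ends.loop (fun m₂ => m₂.nat 41 0 = t ∧ m₂.nat (102 + l) t = s ∧
      m₂.real (4 + l) = I.ln l ∧ j ≤ m₂.nat 43 0 ∧ m₂.nat 43 0 ≤ s ∧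
      m₂.real 14 0 = I.chain l T j (m₂.nat 43 0) ∧
      (∀ i, j ≤ i → i < m₂.nat 43 0 → m₂.real l i = max (I.rel l i) (I.chain l T j i)) ∧
      ∀ i, (i < j ∨ m₂.nat 43 0 ≤ i) → m₂.real l i = m.real l i)
      (fun m => s - m.nat 43 0) (k := 50) ?_ ?_) ?_ ?_) (by omega) fun _ h => h)
  · simp [Prog.block, Prog.exec, NExp.eval, RExp.eval, Memory.setNat_nat, Memory.setNat_real,
      Memory.setReal_nat, Memory.setReal_real, ht, hq, hln, hj', hs', hT', e1, e2, e3]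
  · rintro m₂ ⟨h1, h2, h3, h4, h5, h6, h7, h8⟩ hcond
    have hlt : m₂.nat 43 0 < s := by
      simp only [BExp.eval, NExp.eval, h1, h2] at hcond
      exact hcond
    have hR : m₂.real l (m₂.nat 43 0) = I.rel l (m₂.nat 43 0) := by
      rw [h8 _ (Or.inr le_rfl), hrel _ hlt]
    refine Ends.imp (Ends.frame (Prog.Straight.ends (k := 50) (Q := fun m₃ =>
      m₃.nat 43 0 = m₂.nat 43 0 + 1 ∧ m₃.real l = Function.update (m₂.real l) (m₂.nat 43 0)
        (max (I.rel l (m₂.nat 43 0)) (m₂.real 14 0)) ∧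
      m₃.real 14 0 = max (I.rel l (m₂.nat 43 0)) (m₂.real 14 0) + I.ln l (m₂.nat 43 0))
      (by simp [Prog.block, Prog.Straight]) (Nat.le_of_ble_eq_true rfl) ?_)) le_rfl ?_
    · by_cases hc : I.rel l (m₂.nat 43 0) ≤ m₂.real 14 0
      · simp [Prog.block, Prog.exec, BExp.eval, NExp.eval, RExp.eval, Memory.setNat_nat,
          Memory.setNat_real, Memory.setReal_nat, Memory.setReal_real, hR, hc, h3, e1, e5]
      · simp [Prog.block, Prog.exec, BExp.eval, NExp.eval, RExp.eval, Memory.setNat_nat,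
          Memory.setNat_real, Memory.setReal_nat, Memory.setReal_real, hR, hc, h3, e1,
          max_eq_left (not_le.1 hc).le]
    · rintro m₃ ⟨⟨k1, k2, k3⟩, hfn, hfr⟩
      have en : ∀ a, a ≠ 43 → m₃.nat a = m₂.nat a := fun a ha => hfn a (by
        simpa [Prog.block, Prog.WritesNat] using ha)
      have er : ∀ a : ℕ, a ≠ 14 → a ≠ l → m₃.real a = m₂.real a := fun a ha ha' => hfr a (by
        simp [Prog.block, Prog.WritesReal, ha, ha'])
      rw [h6, ← chain_succ h4] at k3
      rw [k1, k2, k3, en 41 (by omega), en _ e3, er _ e2 e4]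
      refine ⟨⟨h1, h2, h3, by omega, by omega, rfl, fun i hi hi' => ?_, fun i hi => ?_⟩,
        by omega⟩
      · by_cases hi'' : i = m₂.nat 43 0
        · simp [hi'', h6]
        · simpa [hi''] using h7 i hi (by omega)
      · have hi'' : i ≠ m₂.nat 43 0 := by omega
        simpa [hi''] using h8 i (by omega)
  · obtain ⟨k1, k2, k3, k4, k5, k6⟩ := hm₁
    rw [k4, k5, k6]
    exact ⟨k1, k2, k3, le_rfl, hle, by rw [chain_of_le le_rfl], fun i hi hi' => by omega,
      fun i _ => rfl⟩
  · have h1 : s - m₁.nat 43 0 ≤ I.radix := by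
      have := I.count_lt_radix l
      omega
    refine loop_cost_le h1 ?_ ?_ <;> simp only [BExp.cost, NExp.cost] <;> omega
  · rintro m' ⟨⟨h1, h2, h3, h4, h5, h6, h7, h8⟩, hcond⟩
    have : m'.nat 43 0 = s := by
      simp only [BExp.eval, NExp.eval, h1, h2, not_le] at hcond
      omega
    rw [this] at h7 h8
    exact ⟨h7, h8⟩

/-- Write the crossing times of the platoons served in the phase from prefix number `42` to prefix
number `41`, and go on to the former. -/
def writePhase : Prog := .seq (.nvar 42 (.get 101 (.var 41)))
  (.seq (writeLane (0 : Fin 4)) (.seq (writeLane (1 : Fin 4)) (.seq (writeLane (2 : Fin 4))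
    (.seq (writeLane (3 : Fin 4)) (.nvar 41 (.var 42))))))

/-- Invariant while the schedule is read off the table backwards. -/
structure Back (I : Crossing) (T₀ : ℝ) (S : AddSubgroup ℝ) (d : ℝ) (A : Tab) (m : Memory) :
    Prop where
  tab : tab 100 m = A
  lt : m.nat 41 0 < I.states
  flag : 0 < A.flag (m.nat 41 0)
  ln : ∀ l : Fin 4, m.real (4 + l) = I.ln l
  rel : ∀ l : Fin 4, ∀ i < A.pos l (m.nat 41 0), m.real l i = I.rel l i
  suffix : I.Suffix d (A.pos · (m.nat 41 0)) (A.val (m.nat 41 0)) (fun l => m.real l)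

/-- Phases are written from the last to the first. Cells beyond the current prefix already hold a
correct schedule, while those inside it still hold release times. -/
theorem writePhase_ends {d : ℝ} {A : Tab} (hA : A.Sound I T₀ S d I.states) {m : Memory}
    (h : Back I T₀ S d A m) (h0 : m.nat 41 0 ≠ 0) :
    Ends writePhase m (4 * (I.radix * 60 + 60) + 40) fun m' =>
      Back I T₀ S d A m' ∧ m'.nat 41 0 < m.nat 41 0 := by
  obtain ⟨p1, -, p3, a, c, he, hv, hd⟩ := hA.pre _ h.lt h.flag h0
  have hcount := hA.le _ h.lt h.flag
  set t := m.nat 41 0 with ht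
  set q := A.pre t with hq
  -- the effect on a single lane
  let P : Fin 4 → Memory → Prop := fun l m' =>
    (∀ i, A.pos l q ≤ i → i < A.pos l t → m'.real l i =
      max (I.rel l i) (I.chain l (A.val q) (A.pos l q) i)) ∧
    ∀ i, (i < A.pos l q ∨ A.pos l t ≤ i) → m'.real l i = m.real l i
  let K : ℕ → Memory → Prop := fun k m' => tab 100 m' = A ∧ m'.nat 41 0 = t ∧ m'.nat 42 0 = q ∧
    (∀ l : Fin 4, m'.real (4 + l) = I.ln l) ∧ (∀ l : Fin 4, k ≤ l → m'.real l = m.real l) ∧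
    ∀ l : Fin 4, (l : ℕ) < k → P l m'
  have hlane : ∀ (l : Fin 4) (m' : Memory), K l m' →
      Ends (writeLane l) m' (I.radix * 60 + 60) (K (l + 1)) := by
    rintro l m₁ ⟨k1, k2, k3, k4, k5, k6⟩
    refine Ends.imp (writeLane_ends l k2 k3 (k4 l) (by rw [k1]; exact he.le l)
      (by rw [k1]; exact hcount l) (by rw [k1, k5 l le_rfl]; exact h.rel l)) le_rfl ?_
    rintro m₂ ⟨hP, hfn, hfr⟩
    rw [k1, k5 l le_rfl] at hP
    have en : ∀ a, a ≠ 43 → m₂.nat a = m₁.nat a := fun a ha => hfn a fun hw =>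
      ha (writeLane_writesNat hw)
    have er : ∀ a : ℕ, a ≠ 14 → a ≠ l → m₂.real a = m₁.real a := fun a h1 h2 => hfr a fun hw =>
      (writeLane_writesReal hw).elim h1 h2
    refine ⟨(tab_congr (fun a _ _ => en a (by omega)) (er 100 (by omega) (by omega))).trans k1,
      by rw [en 41 (by omega), k2], by rw [en 42 (by omega), k3],
      fun l' => by rw [er _ (by omega) (by omega), k4],
      fun l' hl' => by rw [er _ (by omega) (by omega), k5 l' (by omega)], fun l' hl' => ?_⟩
    by_cases hll : l' = l
    · rw [hll]
      exact hP
    · have hll' : (l' : ℕ) ≠ l := fun h => hll (Fin.ext h)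
      have := k6 l' (by omega)
      simp only [P] at this ⊢
      rwa [er _ (by omega) hll']
  refine Ends.imp (Ends.seq (k := 20) (Q := K 0) (Prog.Straight.ends (by exact trivial)
    (Nat.le_of_ble_eq_true rfl) ?_) fun m₁ h₁ => Ends.seq (hlane 0 m₁ h₁) fun m₂ h₂ =>
    Ends.seq (hlane 1 m₂ h₂) fun m₃ h₃ => Ends.seq (hlane 2 m₃ h₃) fun m₄ h₄ =>
    Ends.seq (hlane 3 m₄ h₄) fun m₅ h₅ => Prog.Straight.ends (k := 10) (by exact trivial)
    (Nat.le_of_ble_eq_true rfl) ?_) (by omega) fun _ h => h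
  · have hpre : m.nat 101 t = q := by rw [hq, ← h.tab]; rfl
    refine ⟨Eq.trans (b := tab 100 m) (tab_congr (fun a h1 h2 => ?_) rfl) h.tab, ?_, ?_, h.ln, fun _ _ => rfl,
      fun _ h => absurd h (Nat.not_lt_zero _)⟩
    · have : a ≠ 42 := by omega
      simp [Prog.exec, Memory.setNat_nat, this]
    · simp [Prog.exec, Memory.setNat_nat, ht]
    · simpa [Prog.exec, NExp.eval, Memory.setNat_nat] using hpre
  · obtain ⟨k1, k2, k3, k4, -, k6⟩ := h₅
    have hP : ∀ l, P l m₅ := fun l => k6 l l.2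
    have e41 : (Prog.exec (.nvar 41 (.var 42)) m₅).nat 41 0 = q := by
      simpa [Prog.exec, NExp.eval, Memory.setNat_nat] using k3
    have ereal : (Prog.exec (.nvar 41 (.var 42)) m₅).real = m₅.real := rfl
    refine ⟨⟨Eq.trans (b := tab 100 m₅) (tab_congr (fun a h1 h2 => ?_) rfl) k1, ?_, ?_, k4, ?_, ?_⟩, ?_⟩
    · have : a ≠ 41 := by omega
      simp [Prog.exec, Memory.setNat_nat, this]
    · rw [e41]
      exact p1.trans h.lt
    · rwa [e41]
    · intro l i hi
      rw [e41] at hi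
      rw [ereal, (hP l).2 i (Or.inl hi), h.rel l i (hi.trans_le (he.le l))]
    · rw [e41, ereal]
      have hsuf := h.suffix
      rw [← ht, hv] at hsuf
      -- The gluing lemma of the existence proof, applied to the array contents.
      exact hsuf.step he hd (fun l i hi => (hP l).2 i (Or.inr hi))
        fun l i h1 h2 => (hP l).1 i h1 h2
    · rwa [e41]

/-- Read the schedule off the table. -/
def readOff : Prog := .seq (.nvar 41 (.var 27)) (.loop (.nle (.lit 1) (.var 41)) writePhase)

theorem readOff_ends {d : ℝ} {m : Memory} (hg : Glob I T₀ m)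
    (hA : (tab 100 m).Sound I T₀ S d I.states) (hf : 0 < m.nat 100 (m.nat 27 0)) :
    Ends readOff m (1000 * I.radix ^ 6) fun m' =>
      I.Valid (I.output m') ∧ ∀ p, I.output m' p - I.release p ≤ d := by
  have hM : 1 ≤ I.radix := radix_pos
  have hlt := idx_lt_states (fun l => le_refl (I.count l))
  have hcost : 10 + (I.states * (4 * (I.radix * 60 + 60) + 40 + 10) + 20) ≤
      1000 * I.radix ^ 6 := by
    rw [states]
    obtain ⟨k, hk⟩ := Nat.exists_eq_add_of_le hM
    rw [hk]
    ring_nf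
    omega
  refine Ends.imp (Ends.seq (k := 10) (Q := Back I T₀ S d (tab 100 m))
    (Prog.Straight.ends (by exact trivial) (Nat.le_of_ble_eq_true rfl) ?_) fun m₁ hm₁ =>
    Ends.imp (Ends.loop (Back I T₀ S d (tab 100 m)) (fun m => m.nat 41 0) (fun m₂ h₂ hc =>
      writePhase_ends hA h₂ ?_) hm₁) (loop_cost_le hm₁.lt.le ?_ ?_) ?_) hcost fun _ h => h
  · rw [hg.final] at hf
    have hpos : ((tab 100 m).pos · (I.idx I.count)) = I.count :=
      idx_inj (hA.le _ hlt hf) (fun _ => le_rfl) (hA.idx _ hlt hf)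
    have e41 : (Prog.exec (.nvar 41 (.var 27)) m).nat 41 0 = I.idx I.count := by
      simpa [Prog.exec, NExp.eval, Memory.setNat_nat] using hg.final
    refine ⟨tab_congr (fun a h1 h2 => ?_) rfl, by rwa [e41], by rwa [e41], hg.ln, ?_, ?_⟩
    · have : a ≠ 41 := by omega
      simp [Prog.exec, Memory.setNat_nat, this]
    · intro l i _
      exact congrFun (hg.rel l) i
    · rw [e41, hpos]
      exact Suffix.full _ _ _
  · have : 1 ≤ m₂.nat 41 0 := hc
    omega
  · simp only [BExp.cost, NExp.cost]
    omega
  · simp only [BExp.cost, NExp.cost]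
    omega
  · rintro m' ⟨h, hc⟩
    have h0 : m'.nat 41 0 = 0 := by simpa [BExp.eval, NExp.eval] using hc
    refine h.suffix.valid fun l => ?_
    rw [h0]
    exact hA.zero_pos l

end

end Platoon

/-! ### The optimization program -/

namespace Platoon

open Crossing

section

variable {I : Crossing} {T₀ : ℝ} {S : AddSubgroup ℝ}

/-- Find a minimum-delay schedule of a nonempty instance. -/
def optimizeNonempty : Prog := .seq init (.seq doubling (.seq bisect (.seq search
  (.seq (.rvar 8 (.var 10)) (.seq dec readOff)))))

/-- Find a minimum-delay schedule. -/
def optimize : Prog := .branch (.nle (.add (.add (.add (.get 0 (.lit 0)) (.get 0 (.lit 1)))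
  (.get 0 (.lit 2))) (.get 0 (.lit 3))) (.lit 0)) .skip optimizeNonempty

theorem isMinDelay_of_feas {c : I.Schedule} {d : ℝ} (hc : I.Valid c)
    (hd : ∀ p, c p - I.release p ≤ d) (hmin : ∀ e < d, ¬ I.Feas e) : I.IsMinDelay c := by
  refine ⟨hc, fun c' hc' => ?_⟩
  have h0 := delay_nonneg hc'
  rw [delay_le_iff h0]
  have : d ≤ I.delay c' := by
    by_contra! h
    exact hmin _ h ⟨c', hc', (delay_le_iff h0 c').1 le_rfl⟩
  exact fun p => (hd p).trans this

/-- One run yields both estimates, with `k` the number of doublings: bisection costs `O(k * radix ^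
6)`, and the search costs `O(radix ^ 6)` if the bracket is settled and `O(radix ^ 12)` otherwise. -/
theorem optimizeNonempty_ends (hT : Times I (-I.total) S) (h1 : (1 : ℝ) ∈ S)
    (hn : 0 < I.size) : ∃ k T : ℕ, (k = 0 ∨ (2 : ℝ) ^ (k - 1) < I.total + I.total + 1) ∧
      k ≤ I.radix ^ 6 ∧ T ≤ 10 ^ 8 * I.radix ^ 12 ∧
      ((∀ x ∈ S, ∃ z : ℤ, x = z) → T ≤ 10 ^ 8 * (I.radix ^ 6 * (k + 1))) ∧
      Ends optimizeNonempty (I.input 0) T fun s => I.IsMinDelay (I.output s) := by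
  have hM : 1 ≤ I.radix := radix_pos
  set N := I.radix ^ 6 with hN
  have hMN : I.radix ≤ N := Nat.le_self_pow (by omega) _
  have h12 : I.radix ^ 12 = N * N := by rw [hN, ← pow_add]
  obtain ⟨m₁, t₁, r₁, b₁, ⟨hg₁, h29, hH⟩, -⟩ := init_ends (inp_input I 0)
  obtain ⟨m₂, t₂, r₂, b₂, ⟨hlo, hhi, hpow, hk, hk1, hk2⟩, hfn₂, hfr₂⟩ := doubling_ends h29 hH
  set k := m₂.nat 40 0 with hkdef
  have hg₂ := hg₁.congr (m' := m₂) (fun a ha => hfn₂ a fun hw => by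
    have := doubling_writesNat hw
    omega) (fun a ha _ => hfr₂ a fun hw => by
    have := doubling_writesReal hw
    omega)
  have htot : I.total ∈ S := total_mem hT.mem_rel hT.mem_ln
  have hB₂ : Bracket I m₂ := by
    refine ⟨?_, by rw [hhi]; exact feas_total I⟩
    -- No delay is negative and there is a platoon, so `-1` is infeasible.
    rw [hlo]
    rintro ⟨c, hc, hcd⟩
    obtain ⟨l, -, hl⟩ := Finset.exists_ne_zero_of_sum_ne_zero (show ∑ l, I.count l ≠ 0 from hn.ne')
    have h1 := hcd ⟨l, ⟨0, Nat.pos_of_ne_zero hl⟩⟩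
    have h2 := hc.release_le ⟨l, ⟨0, Nat.pos_of_ne_zero hl⟩⟩
    linarith
  obtain ⟨m₃, t₃, r₃, b₃, hg₃, hB₃, hlo₃, hhi₃, hw₃⟩ := bisect_ends hT hn hg₂ hB₂
    (by rw [hlo]; exact S.neg_mem h1) (by rw [hhi]; exact S.add_mem htot htot) hpow h1
  rw [hlo, hhi, sub_neg_eq_add] at hw₃
  -- Between two integers at distance at most `1` there is no further integer.
  let settled : Prop := (∀ x ∈ S, ∃ z : ℤ, x = z) ∧ m₃.real 10 0 - m₃.real 11 0 ≤ 1
  classical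
  let τ : ℕ := if settled then 100 else 42000 * N + 200
  obtain ⟨m₄, t₄, r₄, b₄, hg₄, hf₄, hmin₄⟩ := search_ends (settled := settled) (τ := τ) hT hn
    (by simp only [τ]; split <;> omega) (fun h => by simp only [τ, h, if_false]; exact le_rfl)
    hg₃ hB₃ (by
      rintro ⟨hz, hw⟩ v hv ⟨hv1, hv2⟩
      obtain ⟨z, rfl⟩ := hz v hv
      obtain ⟨x, hx⟩ := hz _ hlo₃
      obtain ⟨y, hy⟩ := hz _ hhi₃
      rw [hx] at hv1 hw
      rw [hy] at hv2 hw
      norm_cast at hv1 hv2 hw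
      omega)
  -- The table of the search is for bounds below the minimum, so the decision program is run once
  -- more, at the minimum, to obtain the table from which the schedule is read.
  have hstep : Ends (.seq (.rvar 8 (.var 10)) (.seq dec readOff)) m₄
      (10 + (42000 * N + 1000 * N)) fun s => I.IsMinDelay (I.output s) := by
    refine Ends.seq (k := 10) (Ends.frame (Q := fun m => m.real 8 0 = m₄.real 10 0)
      (Prog.Straight.ends (by exact trivial) (Nat.le_of_ble_eq_true rfl) ?_)) fun m₅ hm₅ => ?_
    · simp [Prog.exec, RExp.eval, NExp.eval, Memory.setReal_real]
    obtain ⟨h8, hfn, hfr⟩ := hm₅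
    refine Ends.seq (dec_ends hT.mem_rel hT.mem_ln hT.mem_start hT.start_le
      (hg₄.congr (fun a _ => hfn a (by simp [Prog.WritesNat]))
      (fun a _ ha => hfr a (by simpa [Prog.WritesReal] using ha)))) fun m₆ hm₆ => ?_
    obtain ⟨⟨hg₆, hA, hiff⟩, -⟩ := hm₆
    rw [h8] at hA hiff
    exact Ends.imp (readOff_ends hg₆ hA ((hiff (Or.inl hn)).1 hf₄)) le_rfl
      fun s hs => isMinDelay_of_feas hs.1 hs.2 hmin₄
  obtain ⟨m₅, t₅, r₅, b₅, hmin⟩ := hstep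
  have hruns := Runs.seq r₁ (Runs.seq r₂ (Runs.seq r₃ (Runs.seq r₄ r₅)))
  have hbis : t₃ ≤ k * (42000 * N + 200) + 10 := b₃
  have hkN : k * (42000 * N + 200) ≤ N * k * 42200 := by nlinarith
  have hNN : N ≤ N * N := Nat.le_mul_self N
  have hkNN : N * k ≤ N * N := Nat.mul_le_mul_left _ hk
  by_cases hs : settled
  · have hτ : τ = 100 := if_pos hs
    rw [hτ] at b₄
    refine ⟨k, _, hk1, hk, ?_, fun _ => ?_, m₅, _, hruns, le_rfl, hmin⟩
    · omega
    · rw [mul_add, mul_one]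
      omega
  · have hτ : τ = 42000 * N + 200 := if_neg hs
    have h4 : 2000 * N * (42000 * N + 200 + 1) = 84000000 * (N * N) + 402000 * N := by ring
    rw [hτ, h4] at b₄
    have hT12 : t₁ + (t₂ + (t₃ + (t₄ + t₅))) ≤ 10 ^ 8 * (N * N) := by omega
    refine ⟨k, _, hk1, hk, by rw [h12]; exact hT12, fun hz => hT12.trans ?_, m₅, _, hruns, le_rfl,
      hmin⟩
    -- For integer data, an unsettled bracket means that doubling was stopped by the cap. Then `k =
    -- N`, and the quadratic cost is itself of the form `N * (k + 1)`.
    have hkeq : k = N := by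
      rcases hk2 with h | h
      · exact h
      · exact absurd ⟨hz, hw₃ h⟩ hs
    rw [hkeq]
    gcongr
    omega

theorem isMinDelay_of_size_eq_zero (h : I.size = 0) (c : I.Schedule) : I.IsMinDelay c := by
  have hcount : ∀ l, I.count l = 0 := fun l =>
    Finset.sum_eq_zero_iff.1 (show ∑ l, I.count l = 0 from h) l (Finset.mem_univ l)
  have hempty : IsEmpty I.Plat := ⟨fun p => by
    have h₁ := hcount p.1
    have h₂ := p.2.2
    omega⟩
  refine ⟨⟨fun p => hempty.elim p, fun l i => hempty.elim ⟨l, i⟩, fun p => hempty.elim p⟩,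
    fun c' _ => ?_⟩
  rw [Subsingleton.elim c c']

theorem optimize_ends_of_size_eq_zero (h : I.size = 0) :
    Ends optimize (I.input 0) 20 fun s => I.IsMinDelay (I.output s) := by
  have hc : (BExp.nle (.add (.add (.add (.get 0 (.lit 0)) (.get 0 (.lit 1)))
      (.get 0 (.lit 2))) (.get 0 (.lit 3))) (.lit 0)).eval (I.input 0) := by
    have := h
    simp only [size, Fin.sum_univ_four] at this
    simp [BExp.eval, NExp.eval, input]
    omega
  have hskip : Ends .skip (I.input 0) 1 fun s => I.IsMinDelay (I.output s) :=
    Prog.Straight.ends (P := .skip) trivial le_rfl (isMinDelay_of_size_eq_zero h _)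
  exact (Ends.branch (fun _ => hskip) fun hn => absurd hc hn).imp (Nat.le_of_ble_eq_true rfl)
    fun _ h => h

theorem optimize_ends {T : ℕ} {Q : Memory → Prop} (hn : 0 < I.size)
    (h : Ends optimizeNonempty (I.input 0) T Q) : Ends optimize (I.input 0) (T + 20) Q := by
  have hc : ¬ (BExp.nle (.add (.add (.add (.get 0 (.lit 0)) (.get 0 (.lit 1)))
      (.get 0 (.lit 2))) (.get 0 (.lit 3))) (.lit 0)).eval (I.input 0) := by
    simp only [size, Fin.sum_univ_four] at hn
    simp [BExp.eval, NExp.eval, input]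
    omega
  refine (Ends.branch (fun hc' => absurd hc' hc) fun _ => h).imp ?_ fun _ h => h
  simp only [BExp.cost, NExp.cost]
  omega

/-! ### Running times in terms of the size and `L` -/

theorem card_plat (I : Crossing) : Fintype.card I.Plat = I.size := by
  simp [size]

/-- For integer data, all times are bounded by the square of `L`. -/
theorem total_le_sq (hI : I.IsDiscrete) (hn : 0 < I.size) :
    (I.size : ℝ) ≤ I.totalLength ∧ I.total ≤ I.totalLength ^ 2 := by
  have hlen : ∀ p, 1 ≤ I.len p := fun p => by
    obtain ⟨m, hm⟩ := (hI p).2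
    have := I.len_pos p
    rw [hm] at this ⊢
    exact_mod_cast this
  have hrel : ∀ p, 0 ≤ I.release p := fun p => by
    obtain ⟨r, hr⟩ := (hI p).1
    rw [hr]
    exact Nat.cast_nonneg r
  set R := ⨆ p, I.release p with hR
  set Λ := ∑ p, I.len p with hΛ
  have hRp : ∀ p, I.release p ≤ R := le_ciSup (Set.finite_range _).bddAbove
  have hR0 : 0 ≤ R := Real.iSup_nonneg hrel
  have hΛn : (I.size : ℝ) ≤ Λ := by
    have := Finset.card_nsmul_le_sum Finset.univ I.len 1 fun p _ => hlen p
    rwa [Finset.card_univ, card_plat, nsmul_eq_mul, mul_one] at this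
  have hΛ1 : 1 ≤ Λ := le_trans (by exact_mod_cast hn) hΛn
  have hsum : ∑ p, |I.release p| ≤ I.size * R := by
    have := Finset.sum_le_card_nsmul Finset.univ (fun p => |I.release p|) R fun p _ => by
      rw [abs_of_nonneg (hrel p)]
      exact hRp p
    rwa [Finset.card_univ, card_plat, nsmul_eq_mul] at this
  have htot : I.total ≤ Λ + Λ * R := by
    rw [total_eq, Finset.sum_add_distrib]
    nlinarith
  have hL : I.totalLength = R + Λ := rfl
  rw [hL]
  refine ⟨by linarith, htot.trans ?_⟩
  nlinarith

/-- The number of doublings is logarithmic in `L`. -/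
theorem doublings_le_log {k : ℕ} {L H : ℝ} (hL : 2 ≤ L) (hH : H ≤ L ^ 2)
    (hk : k = 0 ∨ (2 : ℝ) ^ (k - 1) < H + H + 1) : (k : ℝ) + 1 ≤ 10 * Real.log L := by
  have hlog2 : 0.69 < Real.log 2 := lt_trans (by norm_num) Real.log_two_gt_d9
  have hlogL : Real.log 2 ≤ Real.log L := Real.log_le_log (by norm_num) hL
  rcases hk with rfl | hk
  · norm_num
    linarith
  · rcases Nat.eq_zero_or_pos k with rfl | hk0
    · norm_num
      linarith
    obtain ⟨j, rfl⟩ := Nat.exists_eq_add_of_le' hk0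
    rw [Nat.add_sub_cancel] at hk
    have hL2 : 4 ≤ L ^ 2 := by nlinarith
    -- As `L ^ 2 ≥ 4`, one has `2 * L ^ 2 + 1 ≤ L ^ 4`. Hence `j * log 2 ≤ 4 * log L`, and the
    -- constant `10` leaves room for the remaining `2`.
    have hlt : (2 : ℝ) ^ j ≤ L ^ 4 := by nlinarith
    have := Real.log_le_log (by positivity) hlt
    rw [Real.log_pow, Real.log_pow] at this
    push_cast at this ⊢
    have hj : (0 : ℝ) ≤ j := Nat.cast_nonneg j
    nlinarith

theorem radix_pow_le (I : Crossing) (k : ℕ) (hn : 0 < I.size) :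
    (I.radix : ℝ) ^ k ≤ 2 ^ k * (I.size : ℝ) ^ k := by
  rw [← mul_pow]
  have : (1 : ℝ) ≤ I.size := by exact_mod_cast hn
  have h : (I.radix : ℝ) ≤ 2 * I.size := by
    rw [radix]
    push_cast
    linarith
  gcongr

theorem decideDelay_cost_le (I : Crossing) {t : ℕ}
    (ht : t ≤ 2000 * I.radix + (42000 * I.radix ^ 6 + 30)) :
    (t : ℝ) ≤ 10 ^ 7 * (1 + (I.size : ℝ) ^ 6) := by
  have hM : 1 ≤ I.radix := radix_pos
  have hMN : I.radix ≤ I.radix ^ 6 := Nat.le_self_pow (by omega) _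
  have ht' : t ≤ 45000 * I.radix ^ 6 := by omega
  have ht'' : (t : ℝ) ≤ 45000 * (I.radix : ℝ) ^ 6 := by exact_mod_cast ht'
  rcases Nat.eq_zero_or_pos I.size with h | h
  · rw [radix, h] at ht''
    rw [h]
    norm_num at ht'' ⊢
    linarith
  · have := radix_pow_le I 6 h
    have h0 : (0 : ℝ) ≤ (I.size : ℝ) ^ 6 := by positivity
    linarith

theorem optimize_cost_le {T : ℕ} (hn : 0 < I.size) (hT : T ≤ 10 ^ 8 * I.radix ^ 12) :
    ((T + 20 : ℕ) : ℝ) ≤ 10 ^ 12 * (1 + (I.size : ℝ) ^ 12) := by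
  have hT' : (T : ℝ) ≤ 10 ^ 8 * (I.radix : ℝ) ^ 12 := by exact_mod_cast hT
  have := radix_pow_le I 12 hn
  push_cast
  have h0 : (0 : ℝ) ≤ (I.size : ℝ) ^ 12 := by positivity
  linarith

theorem optimize_cost_le_log {T k : ℕ} (hI : I.IsDiscrete) (hn : 0 < I.size)
    (hk : k = 0 ∨ (2 : ℝ) ^ (k - 1) < I.total + I.total + 1) (hkN : k ≤ I.radix ^ 6)
    (hT : T ≤ 10 ^ 8 * (I.radix ^ 6 * (k + 1))) :
    ((T + 20 : ℕ) : ℝ) ≤ 10 ^ 12 * (1 + (I.size : ℝ) ^ 6 * Real.log I.totalLength) := by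
  obtain ⟨hL, hH⟩ := total_le_sq hI hn
  have hT' : (T : ℝ) ≤ 10 ^ 8 * ((I.radix : ℝ) ^ 6 * (k + 1)) := by exact_mod_cast hT
  have hL1 : 1 ≤ I.totalLength := le_trans (by exact_mod_cast hn) hL
  have hlog := Real.log_nonneg hL1
  have h6 := radix_pow_le I 6 hn
  push_cast
  -- With a single platoon `L` may be `1` and the logarithm `0`. The cap on the doublings then
  -- bounds the cost by a constant; otherwise `L ≥ 2`.
  rcases (show I.size = 1 ∨ 2 ≤ I.size by omega) with h1 | h2
  · have hM : I.radix = 2 := by rw [radix, h1]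
    rw [hM] at hT' hkN
    have hk' : (k : ℝ) ≤ 64 := by exact_mod_cast hkN
    rw [h1]
    norm_num at hT' ⊢
    linarith
  · have hL2 : 2 ≤ I.totalLength := le_trans (by exact_mod_cast h2) hL
    have hlog' := doublings_le_log hL2 hH hk
    have h7 : (I.radix : ℝ) ^ 6 * (k + 1) ≤
        2 ^ 6 * (I.size : ℝ) ^ 6 * (10 * Real.log I.totalLength) :=
      mul_le_mul h6 hlog' (by positivity) (by positivity)
    have h0 : 0 ≤ (I.size : ℝ) ^ 6 * Real.log I.totalLength := by positivity
    linarith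

/-- The program is the same for all data; only its analysis chooses `S`, as the integers or as
everything. -/
theorem exists_times (I : Crossing) : ∃ S : AddSubgroup ℝ, Times I (-I.total) S ∧ (1 : ℝ) ∈ S ∧
    (I.IsDiscrete → ∀ x ∈ S, ∃ z : ℤ, x = z) := by
  by_cases hI : I.IsDiscrete
  · let S : AddSubgroup ℝ := (Int.castAddHom ℝ).range
    have hS : ∀ n : ℕ, (n : ℝ) ∈ S := fun n => ⟨n, by simp⟩
    have hr : ∀ l i, I.rel l i ∈ S := fun l i => by
      unfold rel laneArray
      split
      · obtain ⟨r, hr⟩ := (hI ⟨l, ⟨i, ‹_›⟩⟩).1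
        rw [hr]
        exact hS r
      · exact S.zero_mem
    have hl : ∀ l i, I.ln l i ∈ S := fun l i => by
      unfold ln laneArray
      split
      · obtain ⟨r, hr⟩ := (hI ⟨l, ⟨i, ‹_›⟩⟩).2
        rw [hr]
        exact hS r
      · exact S.zero_mem
    refine ⟨S, ⟨hr, hl, S.neg_mem (total_mem hr hl), neg_total_le⟩, by simpa using hS 1, ?_⟩
    rintro _ x ⟨z, rfl⟩
    exact ⟨z, rfl⟩
  · exact ⟨⊤, ⟨fun _ _ => trivial, fun _ _ => trivial, trivial, neg_total_le⟩, trivial,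
      fun h => absurd h hI⟩

end

end Platoon

/-! ### The theorem -/

theorem mainTheorem3 :
    -- the decision problem, in time O(n ^ 6)
    (∃ (P : Platoon.Prog) (C : ℝ), ∀ (I : Platoon.Crossing) (d : ℝ),
      ∃ (s : Platoon.Memory) (t : ℕ), Platoon.Runs P (I.input d) s t ∧
        (s.nat 0 0 = 1 ↔ ∃ c : I.Schedule, I.Valid c ∧ I.delay c ≤ d) ∧
        (t : ℝ) ≤ C * (1 + (I.size : ℝ) ^ 6)) ∧
    -- the optimization problem, in time O(min (n ^ 12, n ^ 6 * log L))
    (∃ (P : Platoon.Prog) (C : ℝ), ∀ I : Platoon.Crossing,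
      ∃ (s : Platoon.Memory) (t : ℕ), Platoon.Runs P (I.input 0) s t ∧
        I.IsMinDelay (I.output s) ∧
        (t : ℝ) ≤ C * (1 + (I.size : ℝ) ^ 12) ∧
        (I.IsDiscrete → (t : ℝ) ≤
          C * (1 + min ((I.size : ℝ) ^ 12) ((I.size : ℝ) ^ 6 * Real.log I.totalLength)))) := by
  refine ⟨⟨Platoon.decideDelay, 10 ^ 7, fun I d => ?_⟩, Platoon.optimize, 10 ^ 12, fun I => ?_⟩
  · obtain ⟨s, t, hr, ht, hs⟩ := Platoon.decideDelay_ends I d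
    exact ⟨s, t, hr, hs, Platoon.decideDelay_cost_le I ht⟩
  · rcases Nat.eq_zero_or_pos I.size with h0 | hn
    · obtain ⟨s, t, hr, ht, hs⟩ := Platoon.optimize_ends_of_size_eq_zero h0
      have ht' : (t : ℝ) ≤ 20 := by exact_mod_cast ht
      refine ⟨s, t, hr, hs, ?_, fun _ => ?_⟩ <;> rw [h0] <;> norm_num <;> linarith
    · obtain ⟨S, hT, h1, hS⟩ := Platoon.exists_times I
      obtain ⟨k, T, hk, hkN, hT12, hT6, hends⟩ := Platoon.optimizeNonempty_ends hT h1 hn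
      obtain ⟨s, t, hr, ht, hs⟩ := Platoon.optimize_ends hn hends
      have ht' : (t : ℝ) ≤ ((T + 20 : ℕ) : ℝ) := by exact_mod_cast ht
      have h12 := ht'.trans (Platoon.optimize_cost_le hn hT12)
      refine ⟨s, t, hr, hs, h12, fun hI => ?_⟩
      rcases min_choice ((I.size : ℝ) ^ 12) ((I.size : ℝ) ^ 6 * Real.log I.totalLength)
        with h | h <;> rw [h]
      · exact h12
      · exact ht'.trans (Platoon.optimize_cost_le_log hI hn hk hkN (hT6 (hS hI)))
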